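/- Let $p_0=(0,0)$, $p_1=(1,0)$, $p_2=(\tfrac12,\tfrac{\sqrt3}{2})$, $f_i(x)=(x+p_i)/2$ on $\mathbb R^2$, and let $K$ be the Sierpiński gasket, i.e. the unique nonempty compact set with $K=f_0(K)\cup f_1(K)\cup f_2(K)$. For a finite word $w=w_1\dots w_n$ over $\{0,1,2\}$ write $|w|=n$, $f_w=f_{w_1}\circ\dots\circ f_{w_n}$, $K_w=f_w(K)$ and, if $n\ge1$, $w^-=w_1\dots w_{n-1}$ and $p_w=f_{w^-}(p_{w_n})$. The Sierpiński graph $X$ has all finite words as vertices, with root $o$ the empty word; $x\sim y$ if either $y=x^-$ or $x=y^-$ (vertical edges), or $|x|=|y|$, $x\ne y$ and $K_x\cap K_y\neq\emptyset$ (horizontal edges). Let $\lambda\in(1/5,1/3)$, $C_1,C_2>0$, $c\in(0,\lambda)$. Let $c(\cdot,\cdot)$ be the symmetric conductance on $X$ with $c(x,y)=(3\lambda)^{-n}$ on vertical edges between levels $n$ and $n+1$; $c(x,y)=C_1(3\lambda)^{-n}$ on horizontal edges in level $n\ge1$ with $p_x\ne p_y$; $c(x,y)=C_2(3\lambda)^{-n}$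 on horizontal edges in level $n\ge 1$ with $p_x=p_y$; and $c(x,y)=0$ otherwise. Let $P(x,y)=c(x,y)/\sum_z c(x,z)$, let $G(x,y)=\sum_{n\ge0}P^{(n)}(x,y)$ be the Green function of the random walk with transition probabilities $P$, and let $\overline X$ be its Martin compactification, i.e. the smallest compactification of the discrete set $X$ to which all the functions $y\mapsto G(x,y)/G(o,y)$, $x\in X$, extend continuously. Let $m$ be the Borel measure on $\overline X$ with $m(\{x\})=(c/(3\lambda))^{|x|}$ for $x\in X$ and $m(\overline X\setminus X)=0$. Put $$\mathcal F_{\overline X}=\Big\{u\in C(\overline X):\ \sum_{x,y\in X}c(x,y)(u(x)-u(y))^2<+\infty\Big\},\qquad \mathcal E_{\overline X}(u,u)=\frac12\sum_{x,y\in X}c(x,y)(u(x)-u(y))^2 .$$ Then $(\mathcal E_{\overline X},\mathcal F_{\overline X})$ is a regular Dirichlet form on $L^2(\overline X;m)$. That is: $\overline X$ is a locally compact separable metrizable space and $m$ is finite on compact sets with full support; $\mathcal F_{\overline X}$ is a dense linear subspace of $L^2(\overline X;m)$ on which $\mathcal E_{\overline X}$ (extended by polarization) is a non-negative symmetric bilinear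 form; $\mathcal F_{\overline X}$ is complete for $\mathcal E_{\overline X}(u,u)+\|u\|_{L^2}^2$; for $u\in\mathcal F_{\overline X}$ the function $v=\max(0,\min(u,1))$ is in $\mathcal F_{\overline X}$ with $\mathcal E_{\overline X}(v,v)\le\mathcal E_{\overline X}(u,u)$; and $\mathcal F_{\overline X}\cap C_c(\overline X)$ is dense in $\mathcal F_{\overline X}$ for $\mathcal E_{\overline X}(u,u)+\|u\|_{L^2}^2$ and uniformly dense in $C_c(\overline X)$. -/

import Mathlib

open MeasureTheory Set Filter Topology
open scoped ENNReal

noncomputable section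

/-! ### Regular Dirichlet forms -/

namespace DirichletForms

variable {E : Type*} [MeasurableSpace E]

/-- `𝓔₁(f, f) = 𝓔(f, f) + (f, f)_{L²(E; μ)}`. -/
def energyOne {μ : Measure E} (𝓔 : Lp ℝ 2 μ → Lp ℝ 2 μ → ℝ) (f : Lp ℝ 2 μ) : ℝ :=
  𝓔 f f + ‖f‖ ^ 2

/-- `(𝓔, D)` is a Dirichlet form on `L²(E; μ)`: a non-negative definite symmetric bilinear form
on a dense linear subspace `D` of `L²(E; μ)` (values of `𝓔` outside `D` are irrelevant) that is
closed (`D` is complete for `𝓔₁`) and Markovian (the unit contraction operates). -/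
structure IsDirichletForm (μ : Measure E) (D : Set (Lp ℝ 2 μ))
    (𝓔 : Lp ℝ 2 μ → Lp ℝ 2 μ → ℝ) : Prop where
  zero_mem : (0 : Lp ℝ 2 μ) ∈ D
  add_mem : ∀ f ∈ D, ∀ g ∈ D, f + g ∈ D
  smul_mem : ∀ (a : ℝ), ∀ f ∈ D, a • f ∈ D
  dense : Dense D
  symm : ∀ f ∈ D, ∀ g ∈ D, 𝓔 f g = 𝓔 g f
  add_left : ∀ f ∈ D, ∀ g ∈ D, ∀ h ∈ D, 𝓔 (f + g) h = 𝓔 f h + 𝓔 g h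
  smul_left : ∀ (a : ℝ), ∀ f ∈ D, ∀ g ∈ D, 𝓔 (a • f) g = a * 𝓔 f g
  nonneg : ∀ f ∈ D, 0 ≤ 𝓔 f f
  closed : ∀ f : ℕ → Lp ℝ 2 μ, (∀ n, f n ∈ D) →
    (∀ ε > 0, ∃ N, ∀ k ≥ N, ∀ l ≥ N, energyOne 𝓔 (f k - f l) < ε) →
    ∃ g ∈ D, Tendsto (fun n => energyOne 𝓔 (f n - g)) atTop (𝓝 0)
  markov : ∀ f ∈ D, ∃ g ∈ D, (g =ᵐ[μ] fun x => max 0 (min (f x) 1)) ∧ 𝓔 g g ≤ 𝓔 f f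

/-- `(𝓔, D)` is a regular Dirichlet form on `L²(E; μ)`. This includes the standing requirements
that `E` is a locally compact separable metrizable space and that `μ` is a Borel measure which is
finite on compact sets and has full support. The set `D ∩ C_c(E)` has to be `𝓔₁`-dense in `D`
and uniformly dense in `C_c(E)`. -/
structure IsRegularDirichletForm [TopologicalSpace E] (μ : Measure E) (D : Set (Lp ℝ 2 μ))
    (𝓔 : Lp ℝ 2 μ → Lp ℝ 2 μ → ℝ) : Prop extends IsDirichletForm μ D 𝓔 where
  borel : BorelSpace E
  locallyCompact : LocallyCompactSpace E
  separable : TopologicalSpace.SeparableSpace E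
  metrizable : TopologicalSpace.MetrizableSpace E
  finiteOnCompacts : IsFiniteMeasureOnCompacts μ
  fullSupport : μ.IsOpenPosMeasure
  dense_energy : ∀ f ∈ D, ∀ ε > 0, ∃ g ∈ D,
    (∃ v : C(E, ℝ), HasCompactSupport v ∧ g =ᵐ[μ] v) ∧ energyOne 𝓔 (f - g) < ε
  dense_uniform : ∀ u : C(E, ℝ), HasCompactSupport u → ∀ ε > 0,
    ∃ v : C(E, ℝ), HasCompactSupport v ∧ (∃ g ∈ D, g =ᵐ[μ] v) ∧ ∀ x, |u x - v x| < ε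

end DirichletForms

namespace Sierpinski

/-! ### The Sierpiński gasket -/

abbrev Plane : Type := EuclideanSpace ℝ (Fin 2)

/-- The corners `p₀ = (0, 0)`, `p₁ = (1, 0)`, `p₂ = (1/2, √3/2)`. -/
def corner : Fin 3 → Plane
  | 0 => !₂[0, 0]
  | 1 => !₂[1, 0]
  | 2 => !₂[1 / 2, Real.sqrt 3 / 2]

/-- `f_i(x) = (x + p_i) / 2`. -/
def contr (i : Fin 3) (x : Plane) : Plane := (1 / 2 : ℝ) • (x + corner i)

/-- The approximations of the gasket: `vertexSet n` is the usual `V_{n+1}`, that is,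
`V₁ = {p₀, p₁, p₂}` and `V_{n+1} = f₀(V_n) ∪ f₁(V_n) ∪ f₂(V_n)`. -/
def vertexSet : ℕ → Set Plane
  | 0 => range corner
  | n + 1 => ⋃ i, contr i '' vertexSet n

/-- The Sierpiński gasket `K`, the closure of `⋃ V_n`. By `gasket_spec` below it is
a nonempty compact set with `K = f₀(K) ∪ f₁(K) ∪ f₂(K)`. -/
def gasket : Set Plane := closure (⋃ n, vertexSet n)

theorem norm_corner_le (i : Fin 3) : ‖corner i‖ ≤ 1 := by
  fin_cases i <;> simp [corner, EuclideanSpace.norm_eq, Fin.sum_univ_two]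
  norm_num [div_pow]

theorem continuous_contr (i : Fin 3) : Continuous (contr i) := by
  unfold contr; fun_prop

theorem gasket_spec :
    IsCompact gasket ∧ gasket.Nonempty ∧ gasket = ⋃ i, contr i '' gasket := by
  have hb : ∀ n, vertexSet n ⊆ Metric.closedBall 0 1 := by
    intro n
    induction n with
    | zero =>
      rintro _ ⟨i, rfl⟩
      simpa using norm_corner_le i
    | succ n ih =>
      simp only [vertexSet, iUnion_subset_iff]
      rintro i _ ⟨x, hx, rfl⟩
      have h1 : ‖x‖ ≤ 1 := by simpa using ih hx
      have h2 := norm_add_le x (corner i)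
      have h3 := norm_corner_le i
      simp only [contr, Metric.mem_closedBall, dist_zero_right, norm_smul, Real.norm_eq_abs]
      rw [abs_of_pos (by norm_num)]
      linarith
  have hc : IsCompact gasket :=
    (Metric.isBounded_closedBall.subset (iUnion_subset hb)).isCompact_closure
  refine ⟨hc, ⟨corner 0, subset_closure (mem_iUnion.mpr ⟨0, 0, rfl⟩)⟩, ?_⟩
  have h0 : vertexSet 0 ⊆ vertexSet 1 := by
    rintro _ ⟨i, rfl⟩
    refine mem_iUnion.mpr ⟨i, corner i, ⟨i, rfl⟩, ?_⟩
    rw [contr, ← two_smul ℝ, smul_smul]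
    norm_num
  have hA : (⋃ n, vertexSet n) = ⋃ i, contr i '' ⋃ n, vertexSet n := by
    have : (⋃ i, contr i '' ⋃ n, vertexSet n) = ⋃ n, vertexSet (n + 1) := by
      simp only [image_iUnion, vertexSet]
      exact iUnion_comm _
    rw [this]
    refine Subset.antisymm (iUnion_subset fun n => ?_)
      (iUnion_subset fun n => subset_iUnion vertexSet (n + 1))
    cases n with
    | zero => exact h0.trans (subset_iUnion (fun n => vertexSet (n + 1)) 0)
    | succ n => exact subset_iUnion (fun n => vertexSet (n + 1)) n
  have him : ∀ i, contr i '' gasket = closure (contr i '' ⋃ n, vertexSet n) := fun i =>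
    image_closure_of_isCompact hc (continuous_contr i).continuousOn
  simp only [him]
  rw [← closure_iUnion_of_finite, ← hA, gasket]

/-- Finite words `w = w₁ … w_n` over `{0, 1, 2}`; the empty word is the root `o`. -/
abbrev Word : Type := List (Fin 3)

/-- `f_w = f_{w₁} ∘ … ∘ f_{w_n}`. -/
def wordMap : Word → Plane → Plane
  | [] => id
  | i :: w => contr i ∘ wordMap w

/-- `K_w = f_w(K)`. -/
def cell (w : Word) : Set Plane := wordMap w '' gasket

/-- `p_w = f_{w₁ … w_{n-1}}(p_{w_n})` for words of length `n ≥ 1` (the value at the empty word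
is never used). -/
def wordPoint (w : Word) : Plane := wordMap w.dropLast (corner (w.getLastD 0))

/-! ### The Sierpiński graph and its conductances -/

/-- Vertical edges: one of the words is the father `w₁ … w_{n-1}` of the other. -/
def IsVertical (x y : Word) : Prop :=
  (x ≠ [] ∧ y = x.dropLast) ∨ (y ≠ [] ∧ x = y.dropLast)

/-- Horizontal edges: distinct words of the same length whose cells meet. -/
def IsHorizontal (x y : Word) : Prop :=
  x.length = y.length ∧ x ≠ y ∧ (cell x ∩ cell y).Nonempty

open Classical in
/-- The conductances: `1 / (3 lam) ^ n` on vertical edges between levels `n` and `n + 1`; on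
horizontal edges in level `n`, `C₁ / (3 lam) ^ n` if `p_x ≠ p_y` (type I) and
`C₂ / (3 lam) ^ n` if `p_x = p_y` (type II). -/
def conductance (lam C₁ C₂ : ℝ) (x y : Word) : ℝ :=
  if IsVertical x y then 1 / (3 * lam) ^ (min x.length y.length)
  else if IsHorizontal x y then
    (if wordPoint x ≠ wordPoint y then C₁ else C₂) / (3 * lam) ^ x.length
  else 0

/-! ### Random walk, Green function, Martin compactification -/

/-- `P(x, y) = c(x, y) / π(x)` with `π(x) = ∑_z c(x, z)`. -/
def transition (lam C₁ C₂ : ℝ) (x y : Word) : ℝ≥0∞ :=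
  ENNReal.ofReal (conductance lam C₁ C₂ x y) /
    ∑' z, ENNReal.ofReal (conductance lam C₁ C₂ x z)

/-- The `n`-step transition probabilities. -/
def transitionIter (lam C₁ C₂ : ℝ) : ℕ → Word → Word → ℝ≥0∞
  | 0, x, y => if x = y then 1 else 0
  | n + 1, x, y => ∑' z, transition lam C₁ C₂ x z * transitionIter lam C₁ C₂ n z y

/-- The Green function `G(x, y) = ∑_n P⁽ⁿ⁾(x, y)`. -/
def green (lam C₁ C₂ : ℝ) (x y : Word) : ℝ≥0∞ := ∑' n, transitionIter lam C₁ C₂ n x y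

/-- The Martin kernel `G(x, y) / G(o, y)`. -/
def martinKernel (lam C₁ C₂ : ℝ) (x y : Word) : ℝ≥0∞ :=
  green lam C₁ C₂ x y / green lam C₁ C₂ [] y

/-- The vertex `y`, seen through all the functions `martinKernel x ·` and all the indicator
functions of single vertices. -/
def martinCoord (lam C₁ C₂ : ℝ) (y : Word) : Word → ℝ≥0∞ × Bool :=
  fun x => (martinKernel lam C₁ C₂ x y, decide (x = y))

/-- The Martin compactification: the closure of the image of the vertex set in the
compact space `∏_x ([0, ∞] × {0, 1})`. By `martin_isCompactification` and `martin_smallest` below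
it is the smallest compactification of the discrete vertex set to which all Martin kernels
extend continuously. -/
def MartinCompactification (lam C₁ C₂ : ℝ) : Type :=
  closure (range (martinCoord lam C₁ C₂))

variable {lam C₁ C₂ : ℝ}

instance : TopologicalSpace (MartinCompactification lam C₁ C₂) :=
  inferInstanceAs (TopologicalSpace (closure (range (martinCoord lam C₁ C₂))))

instance : MeasurableSpace (MartinCompactification lam C₁ C₂) := borel _

/-- The inclusion of the vertex set in its Martin compactification. -/
def incl (lam C₁ C₂ : ℝ) (x : Word) : MartinCompactification lam C₁ C₂ :=
  ⟨martinCoord lam C₁ C₂ x, subset_closure (mem_range_self x)⟩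

/-- `j` embeds the discrete vertex set as a dense open subset in the compact Hausdorff space `N`,
and all Martin kernels extend continuously to `N`. -/
structure IsMartinAdmissible (lam C₁ C₂ : ℝ) {N : Type*} [TopologicalSpace N]
    (j : Word → N) : Prop where
  compact : CompactSpace N
  t2 : T2Space N
  injective : Function.Injective j
  dense : DenseRange j
  isOpen_singleton : ∀ x, IsOpen {j x}
  extends_kernel : ∀ x, ∃ g : C(N, ℝ≥0∞), ∀ y, g (j y) = martinKernel lam C₁ C₂ x y

theorem denseRange_incl : DenseRange (incl lam C₁ C₂) := by
  intro z
  refine closure_subtype.mpr ?_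
  have : (Subtype.val '' range (incl lam C₁ C₂)) = range (martinCoord lam C₁ C₂) :=
    (range_comp _ _).symm
  exact (congrArg closure this).symm ▸ z.property

theorem martin_isCompactification : IsMartinAdmissible lam C₁ C₂ (incl lam C₁ C₂) where
  compact := isCompact_iff_compactSpace.mp isClosed_closure.isCompact
  t2 := inferInstanceAs (T2Space (closure (range (martinCoord lam C₁ C₂))))
  injective := by
    intro x y h
    have := congrArg (fun z : MartinCompactification lam C₁ C₂ => (z.1 x).2) h
    simpa [incl, martinCoord] using this
  dense := denseRange_incl
  isOpen_singleton := by
    intro x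
    have hc : Continuous (fun z : MartinCompactification lam C₁ C₂ => (z.1 x).2) :=
      continuous_snd.comp ((continuous_apply x).comp continuous_subtype_val)
    have hU : IsOpen {z : MartinCompactification lam C₁ C₂ | (z.1 x).2 = true} :=
      (isOpen_discrete {true}).preimage hc
    have hT : T2Space (MartinCompactification lam C₁ C₂) :=
      inferInstanceAs (T2Space (closure (range (martinCoord lam C₁ C₂))))
    have : {z : MartinCompactification lam C₁ C₂ | (z.1 x).2 = true} = {incl lam C₁ C₂ x} := by
      apply Subset.antisymm
      · intro z hz
        have h1 := denseRange_incl.open_subset_closure_inter hU hz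
        have h2 : {z : MartinCompactification lam C₁ C₂ | (z.1 x).2 = true} ∩
            range (incl lam C₁ C₂) ⊆ {incl lam C₁ C₂ x} := by
          rintro _ ⟨h, y, rfl⟩
          have : x = y := of_decide_eq_true h
          rw [this]; rfl
        simpa using closure_mono h2 h1
      · rintro _ rfl
        exact decide_eq_true rfl
    rwa [this] at hU
  extends_kernel := fun x =>
    ⟨⟨fun z => (z.1 x).1, continuous_fst.comp ((continuous_apply x).comp continuous_subtype_val)⟩,
      fun _ => rfl⟩

theorem martin_smallest {N : Type*} [TopologicalSpace N] {j : Word → N}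
    (hj : IsMartinAdmissible lam C₁ C₂ j) :
    ∃ φ : N → MartinCompactification lam C₁ C₂, Continuous φ ∧ ∀ y, φ (j y) = incl lam C₁ C₂ y := by
  classical
  have := hj.t2
  choose g hg using hj.extends_kernel
  let ψ : N → Word → ℝ≥0∞ × Bool := fun z x => (g x z, decide (z = j x))
  have hψ : Continuous ψ := by
    refine continuous_pi fun x => (g x).continuous.prodMk ?_
    have hcl : IsClopen {z : N | z = j x} := ⟨isClosed_singleton, hj.isOpen_singleton x⟩
    rw [continuous_discrete_rng]
    intro b
    cases b
    · convert hcl.compl.isOpen using 1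
      ext z; simp
    · convert hcl.isOpen using 1
      ext z; simp
  have hψj : ∀ y, ψ (j y) = martinCoord lam C₁ C₂ y := by
    intro y
    funext x
    simp only [ψ, martinCoord, hg, hj.injective.eq_iff]
    simp only [eq_comm]
  have hmem : ∀ z, ψ z ∈ closure (range (martinCoord lam C₁ C₂)) := by
    intro z
    refine closure_mono ?_ (image_closure_subset_closure_image hψ ⟨z, hj.dense z, rfl⟩)
    rintro _ ⟨_, ⟨y, rfl⟩, rfl⟩
    exact ⟨y, (hψj y).symm⟩
  exact ⟨fun z => ⟨ψ z, hmem z⟩, hψ.subtype_mk _, fun y => Subtype.ext (hψj y)⟩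

/-! ### The measure and the form on the Martin compactification -/

/-- The measure `m` on the Martin compactification: it charges each vertex `x` with mass
`(c / (3 lam)) ^ |x|`, and the boundary with mass zero. -/
def vertexMeasure (lam C₁ C₂ c : ℝ) : Measure (MartinCompactification lam C₁ C₂) :=
  Measure.sum fun x : Word =>
    ENNReal.ofReal ((c / (3 * lam)) ^ x.length) • Measure.dirac (incl lam C₁ C₂ x)

/-- `∑_{x,y} c(x, y) (u(x) - u(y))² < ∞` (the terms are non-negative). -/
def HasFiniteEnergy (lam C₁ C₂ : ℝ) (u : Word → ℝ) : Prop :=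
  Summable fun p : Word × Word => conductance lam C₁ C₂ p.1 p.2 * (u p.1 - u p.2) ^ 2

/-- The (classes of the) continuous functions of finite energy on the Martin compactification. -/
def formDomain (lam C₁ C₂ c : ℝ) : Set (Lp ℝ 2 (vertexMeasure lam C₁ C₂ c)) :=
  {f | ∃ u : C(MartinCompactification lam C₁ C₂, ℝ),
    HasFiniteEnergy lam C₁ C₂ (fun x => u (incl lam C₁ C₂ x)) ∧
      f =ᵐ[vertexMeasure lam C₁ C₂ c] u}

/-- `𝓔(f, g) = ½ ∑_{x,y} c(x, y) (f(x) - f(y)) (g(x) - g(y))`. As every vertex has positive mass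
(for `0 < c < lam`), the values at vertices do not depend on the representatives of the classes. -/
def energyForm (lam C₁ C₂ c : ℝ) (f g : Lp ℝ 2 (vertexMeasure lam C₁ C₂ c)) : ℝ :=
  1 / 2 * ∑' p : Word × Word, conductance lam C₁ C₂ p.1 p.2 *
    (f (incl lam C₁ C₂ p.1) - f (incl lam C₁ C₂ p.2)) *
    (g (incl lam C₁ C₂ p.1) - g (incl lam C₁ C₂ p.2))

end Sierpinski

end

open MeasureTheory Set Filter Topology
open scoped ENNReal

noncomputable section

namespace Sierpinski

variable {lam C₁ C₂ c : ℝ}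

/-! Everything rests on two facts: (i) every function of finite energy on `X` extends continuously
to the Martin compactification, and (ii) the continuous functions of finite energy are uniformly
dense. Since `m` charges every vertex and not the boundary, (i) identifies the domain with all L²
classes of finite energy (`mem_formDomain_iff`). Completeness is then Fatou's lemma
(`exists_energyOne_limit`), and the unit contraction shrinks every increment. By compactness energy
density is trivial, while (ii) yields uniform density and hence density in L².

For (i), conductances on level `n` are of order `(3λ)^(-n)`, so finite energy forces the increments
of `u` to decay like `(3λ)^(n/2)`. The Green function `pot []` is a multiple of `λ^n`, and the
Martin kernels are, up to constants, the quotients `pot x y / λ^|y|`. The Laplacian of `v = λ^|·| u`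
is `O((λρ)^n)` with `ρ = √(3λ) < 1`. Potentials of truncations of `-lap v` therefore approximate `v`
with error `o(1) λ^n`, by the maximum principle (`abs_le_of_lap_le`). After division by `λ^n`, `u`
is a uniform limit of finite combinations of Martin kernels (`IsHolder.exists_extension`).

For (ii), Stone–Weierstrass asks for separation of points. Vertices are separated by indicators. At
the boundary, harmonic splines of the barycentric coordinates have finite energy because `λ > 1/5`
(energy factor `3/5` per level against `(3λ)⁻¹`), and they see the position in the gasket. Two
boundary points with the same position are limits of vertices whose ancestors on level `n` coincide
or are horizontal neighbours. Martin kernels are Hölder along edges (`exists_kernel_isHolder`), so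
they agree at the two points, and these coincide.

The Hölder bound is a coupling argument (`exists_pot_sub_le`). Two walkers on a common level move
vertically together, and relative to `λ^n` moves to the fathers, which halve the distance, outweigh
moves to the sons, which double it. At distance one the walkers merge by a horizontal step. A
barrier in the distance turns this into decay. -/

/-! ### Integer barycentric coordinates of cells -/

/-- The integer barycentric coordinates of the cell of a word: `cell w` is the part of the gasket
whose barycentric coordinates lie in `2⁻ⁿ [coord j w, coord j w + 1]`, where `n = |w|`. -/
def coord (j : Fin 3) : Word → ℤ
  | [] => 0
  | i :: w => (if i = j then 2 ^ w.length else 0) + coord j w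

@[simp] theorem coord_nil (j : Fin 3) : coord j [] = 0 := rfl

theorem coord_concat (j k : Fin 3) (w : Word) :
    coord j (w ++ [k]) = 2 * coord j w + if k = j then 1 else 0 := by
  induction w with
  | nil => simp [coord]
  | cons i w ih =>
    simp only [List.cons_append, coord, ih, List.length_append, List.length_singleton, pow_succ]
    split_ifs <;> ring

theorem sum_coord (w : Word) : coord 0 w + coord 1 w + coord 2 w = 2 ^ w.length - 1 := by
  induction w with
  | nil => simp
  | cons i w ih =>
    simp only [coord, List.length_cons, pow_succ]
    fin_cases i <;> simp <;> linarith

theorem eq_concat_of_length {n : ℕ} {x : Word} (h : x.length = n + 1) :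
    ∃ t k, x = t ++ [k] ∧ t.length = n := by
  rcases List.eq_nil_or_concat x with rfl | ⟨t, k, rfl⟩
  · simp at h
  · exact ⟨t, k, by simp, by simpa using h⟩

/-- By `coord_concat`, `coord k` changes parity exactly when `k` is the last letter, so a word can
be decoded from its end. -/
theorem coord_injective {x y : Word} (hl : x.length = y.length)
    (h : ∀ j, coord j x = coord j y) : x = y := by
  obtain ⟨n, hn⟩ : ∃ n, x.length = n := ⟨_, rfl⟩
  induction n generalizing x y with
  | zero =>
    rw [List.length_eq_zero_iff.1 hn, List.length_eq_zero_iff.1 (hl.symm.trans hn)]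
  | succ n ih =>
    obtain ⟨s, k, rfl, hs⟩ := eq_concat_of_length hn
    obtain ⟨t, l, rfl, ht⟩ := eq_concat_of_length (hl.symm.trans hn)
    simp only [coord_concat] at h
    have hkl : k = l := by
      have := h k
      simp only [if_true] at this
      by_contra hne
      rw [if_neg (Ne.symm hne)] at this
      omega
    subst hkl
    rw [ih (hs.trans ht.symm) (fun j => by have := h j; omega) hs]

/-- The distance of two cells of the same level in units of their side length. -/
def hd (x y : Word) : ℕ := Finset.univ.sup fun j => (coord j x - coord j y).natAbs

theorem hd_le_iff {x y : Word} {r : ℕ} :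
    hd x y ≤ r ↔ ∀ j, (coord j x - coord j y).natAbs ≤ r := by
  simp [hd, Finset.sup_le_iff]

theorem natAbs_le_hd (j : Fin 3) (x y : Word) : (coord j x - coord j y).natAbs ≤ hd x y :=
  hd_le_iff.1 le_rfl j

theorem hd_comm (x y : Word) : hd x y = hd y x := by
  unfold hd; congr 1; ext j; omega

@[simp] theorem hd_self (x : Word) : hd x x = 0 := by
  simpa using (hd_le_iff (x := x) (y := x) (r := 0)).2 (by simp)

theorem hd_triangle (x y z : Word) : hd x z ≤ hd x y + hd y z := by
  rw [hd_le_iff]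
  intro j
  have := natAbs_le_hd j x y
  have := natAbs_le_hd j y z
  omega

theorem eq_of_hd_eq_zero {x y : Word} (hl : x.length = y.length) (h : hd x y = 0) : x = y :=
  coord_injective hl fun j => by have := natAbs_le_hd j x y; omega

theorem hd_pos {x y : Word} (hl : x.length = y.length) (h : x ≠ y) : 1 ≤ hd x y := by
  by_contra h0
  exact h (eq_of_hd_eq_zero hl (by omega))

/-- This and the next lemma are the two vertical moves of the coupling: the same letter appended to
both words at most doubles the distance, and passing to the fathers halves it up to rounding. -/
theorem hd_concat_le (x y : Word) (k : Fin 3) : hd (x ++ [k]) (y ++ [k]) ≤ 2 * hd x y := by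
  rw [hd_le_iff]
  intro j
  have := natAbs_le_hd j x y
  simp only [coord_concat]
  omega

theorem two_mul_hd_le (x y : Word) (k l : Fin 3) :
    2 * hd x y ≤ hd (x ++ [k]) (y ++ [l]) + 1 := by
  have : hd x y ≤ (hd (x ++ [k]) (y ++ [l]) + 1) / 2 := by
    rw [hd_le_iff]
    intro j
    have := natAbs_le_hd j (x ++ [k]) (y ++ [l])
    simp only [coord_concat] at this
    split_ifs at this <;> omega
  omega

/-- By `sum_coord` the three coordinate differences sum to zero. Being in `{-1, 0, 1}`, they either
all vanish or consist of one `1`, one `-1` and one `0`, which leaves seven cases. -/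
theorem exists_common_corner {x y : Word} (hl : x.length = y.length) (h : hd x y ≤ 1) :
    ∃ i j, ∀ k, coord k x + (if i = k then 1 else 0) = coord k y + (if j = k then 1 else 0) := by
  have hx := sum_coord x
  have hy := sum_coord y
  rw [hl, ← hy] at hx
  have h2 := natAbs_le_hd 2 x y
  have hA : ∀ j, coord j x - coord j y = -1 ∨ coord j x - coord j y = 0 ∨
      coord j x - coord j y = 1 := fun j => by have := natAbs_le_hd j x y; omega
  rcases hA 0 with a | a | a <;> rcases hA 1 with b | b | b <;>
    first
    | (exfalso; omega)
    | exact ⟨0, 0, by rw [Fin.forall_fin_succ, Fin.forall_fin_two]; simp; omega⟩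
    | exact ⟨0, 1, by rw [Fin.forall_fin_succ, Fin.forall_fin_two]; simp; omega⟩
    | exact ⟨0, 2, by rw [Fin.forall_fin_succ, Fin.forall_fin_two]; simp; omega⟩
    | exact ⟨1, 0, by rw [Fin.forall_fin_succ, Fin.forall_fin_two]; simp; omega⟩
    | exact ⟨1, 2, by rw [Fin.forall_fin_succ, Fin.forall_fin_two]; simp; omega⟩
    | exact ⟨2, 0, by rw [Fin.forall_fin_succ, Fin.forall_fin_two]; simp; omega⟩
    | exact ⟨2, 1, by rw [Fin.forall_fin_succ, Fin.forall_fin_two]; simp; omega⟩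

/-! ### Levels -/

/-- The words of length `n`. -/
def lvl (n : ℕ) : Finset Word := (List.finite_length_eq (Fin 3) n).toFinset

@[simp] theorem mem_lvl {n : ℕ} {w : Word} : w ∈ lvl n ↔ w.length = n := by simp [lvl]

theorem sum_lvl_succ {M : Type*} [AddCommMonoid M] (n : ℕ) (f : Word → M) :
    ∑ w ∈ lvl (n + 1), f w = ∑ t ∈ lvl n, ∑ k, f (t ++ [k]) := by
  rw [← Finset.sum_product']
  symm
  refine Finset.sum_bij (fun p _ => p.1 ++ [p.2]) ?_ ?_ ?_ ?_
  · rintro ⟨t, k⟩ h; simpa using h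
  · rintro ⟨t, k⟩ _ ⟨s, l⟩ _ h
    have := List.append_inj' h rfl
    simpa using this
  · intro w hw
    obtain ⟨t, k, rfl, ht⟩ := eq_concat_of_length (mem_lvl.1 hw)
    exact ⟨(t, k), by simpa using ht, rfl⟩
  · intros; rfl

/-- A cell is determined by its coordinate differences to `x`, and these lie in `{-1, 0, 1}`; the
bound `3 ^ 3` is crude but independent of the level. -/
theorem card_near_le (x : Word) : ((lvl x.length).filter fun z => hd x z ≤ 1).card ≤ 27 := by
  classical
  calc _ ≤ (Fintype.piFinset fun _ : Fin 3 => Finset.Icc (-1 : ℤ) 1).card := by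
        refine Finset.card_le_card_of_injOn (fun z j => coord j x - coord j z) ?_ ?_
        · intro z hz
          simp only [Finset.coe_filter, mem_lvl, Set.mem_ofPred_eq] at hz
          simp only [Finset.mem_coe, Fintype.mem_piFinset, Finset.mem_Icc]
          intro j
          have := natAbs_le_hd j x z
          omega
        · intro z hz w hw h
          simp only [Finset.coe_filter, mem_lvl, Set.mem_ofPred_eq] at hz hw
          exact coord_injective (hz.1.trans hw.1.symm) fun j => by
            have := congrFun h j
            simp only at this
            omega
    _ = 27 := by simp [Fintype.card_piFinset]

theorem summable_of_lvl {f : Word → ℝ} (hf : ∀ w, 0 ≤ f w) {a : ℕ → ℝ} (ha : Summable a)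
    (h : ∀ n, ∑ w ∈ lvl n, f w ≤ a n) : Summable f := by
  classical
  have h0 : ∀ n, 0 ≤ a n := fun n => (Finset.sum_nonneg fun w _ => hf w).trans (h n)
  refine summable_of_sum_le hf (c := ∑' n, a n) fun s => ?_
  calc ∑ w ∈ s, f w = ∑ n ∈ s.image List.length, ∑ w ∈ s with w.length = n, f w :=
        (Finset.sum_fiberwise_of_maps_to (fun w hw => Finset.mem_image_of_mem _ hw) f).symm
    _ ≤ ∑ n ∈ s.image List.length, a n := by
        refine Finset.sum_le_sum fun n _ => le_trans ?_ (h n)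
        exact Finset.sum_le_sum_of_subset_of_nonneg (fun w hw => by simp at hw; simp [hw.2])
          fun w _ _ => hf w
    _ ≤ _ := ha.sum_le_tsum _ fun n _ => h0 n

/-! ### Horizontal edges in terms of coordinates -/

/-- Barycentric coordinates with respect to the three corners. -/
def bary (j : Fin 3) (p : Plane) : ℝ :=
  match j with
  | 0 => 1 - p 0 - p 1 / Real.sqrt 3
  | 1 => p 0 - p 1 / Real.sqrt 3
  | 2 => 2 * (p 1 / Real.sqrt 3)

theorem continuous_bary (j : Fin 3) : Continuous (bary j) := by
  match j with
  | 0 => unfold bary; fun_prop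
  | 1 => unfold bary; fun_prop
  | 2 => unfold bary; fun_prop

theorem sum_bary (p : Plane) : bary 0 p + bary 1 p + bary 2 p = 1 := by
  simp only [bary]; ring

theorem bary_corner (i j : Fin 3) : bary j (corner i) = if i = j then 1 else 0 := by
  have h : Real.sqrt 3 ≠ 0 := by positivity
  fin_cases i <;> fin_cases j <;> simp [bary, corner] <;> field_simp <;> norm_num

theorem bary_contr (i j : Fin 3) (p : Plane) :
    bary j (contr i p) = (bary j p + if i = j then 1 else 0) / 2 := by
  rw [← bary_corner i j]
  fin_cases j <;> simp [bary, contr] <;> ring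

theorem bary_injective {p q : Plane} (h : ∀ j, bary j p = bary j q) : p = q := by
  have h3 : Real.sqrt 3 ≠ 0 := by positivity
  have h1 := h 1
  have h2 := h 2
  simp only [bary] at h1 h2
  have e1 : p 1 = q 1 := by
    have : p 1 / Real.sqrt 3 = q 1 / Real.sqrt 3 := by linarith
    field_simp at this
    exact this
  ext k
  fin_cases k
  · simp only [e1] at h1; simpa using h1
  · exact e1

theorem bary_wordMap (j : Fin 3) (w : Word) (p : Plane) :
    2 ^ w.length * bary j (wordMap w p) = coord j w + bary j p := by
  induction w with
  | nil => simp [wordMap]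
  | cons i w ih =>
    simp only [wordMap, Function.comp_apply, bary_contr, List.length_cons, coord, pow_succ]
    push_cast
    split_ifs <;> linarith

theorem bary_nonneg {p : Plane} (hp : p ∈ gasket) (j : Fin 3) : 0 ≤ bary j p := by
  have hcl : IsClosed {p : Plane | 0 ≤ bary j p} :=
    isClosed_le continuous_const (continuous_bary j)
  refine closure_minimal (iUnion_subset fun n => ?_) hcl hp
  induction n with
  | zero =>
    rintro _ ⟨i, rfl⟩
    simp only [Set.mem_ofPred_eq, bary_corner]; split_ifs <;> norm_num
  | succ n ih =>
    simp only [vertexSet, iUnion_subset_iff]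
    rintro i _ ⟨x, hx, rfl⟩
    have := ih hx
    simp only [Set.mem_ofPred_eq, bary_contr] at this ⊢
    split_ifs <;> linarith

theorem bary_le_one {p : Plane} (hp : p ∈ gasket) (j : Fin 3) : bary j p ≤ 1 := by
  have h := sum_bary p
  have h0 := bary_nonneg hp 0
  have h1 := bary_nonneg hp 1
  have h2 := bary_nonneg hp 2
  fin_cases j <;> simp <;> linarith

theorem corner_mem_gasket (i : Fin 3) : corner i ∈ gasket :=
  subset_closure (mem_iUnion.mpr ⟨0, i, rfl⟩)

/-- In barycentric coordinates scaled by `2 ^ n`, a cell lies in the product of the intervals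
`[coord j, coord j + 1]`, so cells that meet are at distance at most one. Conversely, cells at
distance at most one share a corner, and corners belong to the gasket. -/
theorem isHorizontal_iff {x y : Word} :
    IsHorizontal x y ↔ x.length = y.length ∧ x ≠ y ∧ hd x y ≤ 1 := by
  refine and_congr_right fun hl => and_congr_right fun hne => ⟨?_, fun h => ?_⟩
  · rintro ⟨p, ⟨a, ha, rfl⟩, ⟨b, hb, hab⟩⟩
    rw [hd_le_iff]
    intro j
    have e1 := bary_wordMap j x a
    have e2 := bary_wordMap j y b
    rw [hab, ← hl, e1] at e2
    have a0 := bary_nonneg ha j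
    have a1 := bary_le_one ha j
    have b0 := bary_nonneg hb j
    have b1 := bary_le_one hb j
    have l1 : (coord j x : ℝ) - coord j y ≤ 1 := by linarith
    have l2 : (coord j y : ℝ) - coord j x ≤ 1 := by linarith
    have l1' : coord j x - coord j y ≤ 1 := by exact_mod_cast l1
    have l2' : coord j y - coord j x ≤ 1 := by exact_mod_cast l2
    omega
  · obtain ⟨i, j, hij⟩ := exists_common_corner hl h
    refine ⟨wordMap x (corner i), ⟨_, corner_mem_gasket i, rfl⟩,
      ⟨corner j, corner_mem_gasket j, bary_injective fun k => ?_⟩⟩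
    have e1 := bary_wordMap k x (corner i)
    have e2 := bary_wordMap k y (corner j)
    rw [bary_corner] at e1 e2
    rw [← hl] at e2
    have hk : (coord k x : ℝ) + (if i = k then 1 else 0) = coord k y + if j = k then 1 else 0 := by
      exact_mod_cast hij k
    have : (2 : ℝ) ^ x.length ≠ 0 := by positivity
    exact mul_left_cancel₀ this (by linarith)

/-! ### Conductances -/

theorem isVertical_symm {x y : Word} : IsVertical x y ↔ IsVertical y x := by
  unfold IsVertical; tauto

theorem isHorizontal_symm {x y : Word} : IsHorizontal x y ↔ IsHorizontal y x := by
  unfold IsHorizontal; rw [inter_comm, eq_comm, ne_comm]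

theorem conductance_symm (x y : Word) :
    conductance lam C₁ C₂ x y = conductance lam C₁ C₂ y x := by
  have e1 : IsVertical x y = IsVertical y x := propext isVertical_symm
  have e2 : IsHorizontal x y = IsHorizontal y x := propext isHorizontal_symm
  unfold conductance
  rw [e1, e2, min_comm]
  by_cases h : IsHorizontal y x
  · rw [h.1]
    simp only [ne_comm (a := wordPoint x)]
  · simp only [h, if_false]

theorem conductance_nonneg (hlam : 0 < lam) (hC₁ : 0 < C₁) (hC₂ : 0 < C₂) (x y : Word) :
    0 ≤ conductance lam C₁ C₂ x y := by
  unfold conductance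
  split_ifs <;> positivity

theorem conductance_concat (x : Word) (k : Fin 3) :
    conductance lam C₁ C₂ x (x ++ [k]) = ((3 * lam) ^ x.length)⁻¹ := by
  have : IsVertical x (x ++ [k]) := Or.inr ⟨by simp, by simp⟩
  simp [conductance, this]

theorem conductance_dropLast {x : Word} (hx : x ≠ []) :
    conductance lam C₁ C₂ x x.dropLast = ((3 * lam) ^ (x.length - 1))⁻¹ := by
  have : IsVertical x x.dropLast := Or.inl ⟨hx, rfl⟩
  simp [conductance, this]

theorem not_isVertical_of_length_eq {x y : Word} (h : x.length = y.length) : ¬ IsVertical x y := by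
  rintro (⟨hx, rfl⟩ | ⟨hx, rfl⟩) <;>
  · have := List.length_pos_iff.2 hx
    simp at h
    omega

theorem conductance_eq_zero {x y : Word} (hl : y.length ≠ x.length)
    (h1 : ¬ (x ≠ [] ∧ y = x.dropLast)) (h2 : ∀ k, y ≠ x ++ [k]) :
    conductance lam C₁ C₂ x y = 0 := by
  have hv : ¬ IsVertical x y := by
    rintro (h | ⟨hy, rfl⟩)
    · exact h1 h
    · obtain ⟨t, k, rfl⟩ := (List.eq_nil_or_concat y).resolve_left hy
      exact h2 k (by simp)
  have hh : ¬ IsHorizontal x y := fun h => hl h.1.symm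
  simp [conductance, hv, hh]

/-- The conductances of horizontal edges, normalized by level. -/
def hrate (lam C₁ C₂ : ℝ) (x y : Word) : ℝ := (3 * lam) ^ x.length * conductance lam C₁ C₂ x y

theorem hrate_nonneg (hlam : 0 < lam) (hC₁ : 0 < C₁) (hC₂ : 0 < C₂) (x y : Word) :
    0 ≤ hrate lam C₁ C₂ x y :=
  mul_nonneg (by positivity) (conductance_nonneg hlam hC₁ hC₂ x y)

theorem hrate_eq (hlam : 0 < lam) {x y : Word} (h : IsHorizontal x y) :
    hrate lam C₁ C₂ x y = C₁ ∨ hrate lam C₁ C₂ x y = C₂ := by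
  have h3 : (3 * lam) ^ x.length ≠ 0 := by positivity
  unfold hrate conductance
  rw [if_neg (not_isVertical_of_length_eq h.1), if_pos h]
  split_ifs
  · left; field_simp
  · right; field_simp

theorem hrate_eq_zero {x y : Word} (hl : x.length = y.length) (h : ¬ IsHorizontal x y) :
    hrate lam C₁ C₂ x y = 0 := by
  simp [hrate, conductance, not_isVertical_of_length_eq hl, h]

theorem hrate_le (hlam : 0 < lam) (hC₁ : 0 < C₁) {x y : Word}
    (hl : x.length = y.length) : hrate lam C₁ C₂ x y ≤ max C₁ C₂ := by
  by_cases h : IsHorizontal x y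
  · rcases hrate_eq (C₁ := C₁) (C₂ := C₂) hlam h with h | h <;> simp [h]
  · rw [hrate_eq_zero hl h]; positivity

theorem min_le_hrate (hlam : 0 < lam) {x y : Word} (h : IsHorizontal x y) :
    min C₁ C₂ ≤ hrate lam C₁ C₂ x y := by
  rcases hrate_eq (C₁ := C₁) (C₂ := C₂) hlam h with h | h <;> simp [h]

/-- A bound for the total horizontal conductance at a vertex. -/
def hbound (C₁ C₂ : ℝ) : ℝ := 27 * max C₁ C₂

theorem hbound_pos (hC₁ : 0 < C₁) : 0 < hbound C₁ C₂ := by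
  unfold hbound; positivity

theorem sum_hrate_le (hlam : 0 < lam) (hC₁ : 0 < C₁) (x : Word) :
    ∑ z ∈ lvl x.length, hrate lam C₁ C₂ x z ≤ hbound C₁ C₂ := by
  calc ∑ z ∈ lvl x.length, hrate lam C₁ C₂ x z
      = ∑ z ∈ (lvl x.length).filter fun z => hd x z ≤ 1, hrate lam C₁ C₂ x z := by
        refine (Finset.sum_filter_of_ne fun z hz hne => ?_).symm
        by_contra h
        exact hne (hrate_eq_zero (mem_lvl.1 hz).symm fun h' => h (isHorizontal_iff.1 h').2.2)
    _ ≤ ∑ z ∈ (lvl x.length).filter fun z => hd x z ≤ 1, max C₁ C₂ :=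
        Finset.sum_le_sum fun z hz =>
          hrate_le hlam hC₁ (mem_lvl.1 (Finset.mem_filter.1 hz).1).symm
    _ ≤ hbound C₁ C₂ := by
        rw [Finset.sum_const, nsmul_eq_mul, hbound]
        have : (((lvl x.length).filter fun z => hd x z ≤ 1).card : ℝ) ≤ 27 := by
          exact_mod_cast card_near_le x
        gcongr

/-- A sum over horizontal neighbours only sees them. -/
theorem sum_hrate_mul_le (hlam : 0 < lam) (hC₁ : 0 < C₁) (hC₂ : 0 < C₂) {x : Word} {F : Word → ℝ}
    {b : ℝ} (hb : 0 ≤ b) (hF : ∀ z, IsHorizontal x z → F z ≤ b) :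
    ∑ z ∈ lvl x.length, hrate lam C₁ C₂ x z * F z ≤ hbound C₁ C₂ * b := by
  calc ∑ z ∈ lvl x.length, hrate lam C₁ C₂ x z * F z
      ≤ ∑ z ∈ lvl x.length, hrate lam C₁ C₂ x z * b := by
        refine Finset.sum_le_sum fun z hz => ?_
        by_cases h : IsHorizontal x z
        · exact mul_le_mul_of_nonneg_left (hF z h) (hrate_nonneg hlam hC₁ hC₂ _ _)
        · simp [hrate_eq_zero (mem_lvl.1 hz).symm h]
    _ ≤ _ := by
        rw [← Finset.sum_mul]
        exact mul_le_mul_of_nonneg_right (sum_hrate_le hlam hC₁ x) hb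

/-! ### The normalized network operator -/

/-- `∑_z c(x, z) F(z)`, normalized by level. -/
def netSum (lam C₁ C₂ : ℝ) (F : Word → ℝ) (x : Word) : ℝ :=
  (if x = [] then 0 else 3 * lam * F x.dropLast) + ∑ k, F (x ++ [k]) +
    ∑ z ∈ lvl x.length, hrate lam C₁ C₂ x z * F z

/-- The network Laplacian, normalized by level. -/
def lap (lam C₁ C₂ : ℝ) (u : Word → ℝ) (x : Word) : ℝ :=
  3 * lam * (u x.dropLast - u x) + ∑ k, (u (x ++ [k]) - u x) +
    ∑ z ∈ lvl x.length, hrate lam C₁ C₂ x z * (u z - u x)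

/-- The neighbours of `x` are its father, its three sons and words of its level; multiplication by
`(3λ)^|x|` turns the father's conductance into `3λ` and those of the sons into `1`. -/
theorem hasSum_conductance_mul (hlam : 0 < lam) (F : Word → ℝ) (x : Word) :
    HasSum (fun z => conductance lam C₁ C₂ x z * F z)
      (((3 * lam) ^ x.length)⁻¹ * netSum lam C₁ C₂ F x) := by
  have h3 : (3 * lam) ^ x.length ≠ 0 := by positivity
  set q := ((3 * lam) ^ x.length)⁻¹ with hq
  have hlen : ∀ k : Fin 3, (x ++ [k]).length ≠ x.length := fun k => by simp
  -- The guard is needed because `[].dropLast = []` would make the root its own father.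
  have hA : HasSum (fun z => if z = x.dropLast then (if x = [] then 0 else q * (3 * lam * F z))
      else 0) (if x = [] then 0 else q * (3 * lam * F x.dropLast)) := by
    convert hasSum_ite_eq x.dropLast (if x = [] then 0 else q * (3 * lam * F x.dropLast))
      (SummationFilter.unconditional Word) using 2
    split_ifs with h1 h2 <;> simp [h1]
  have hB : HasSum (fun z => ∑ k : Fin 3, if z = x ++ [k] then q * F (x ++ [k]) else 0)
      (∑ k : Fin 3, q * F (x ++ [k])) := by
    refine hasSum_sum fun k _ => ?_
    exact hasSum_ite_eq (x ++ [k]) (q * F (x ++ [k])) (SummationFilter.unconditional Word)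
  have hC : HasSum (fun z => if z ∈ lvl x.length then q * (hrate lam C₁ C₂ x z * F z) else 0)
      (∑ z ∈ lvl x.length, q * (hrate lam C₁ C₂ x z * F z)) := by
    have h := hasSum_sum_of_ne_finset_zero
      (f := fun z => if z ∈ lvl x.length then q * (hrate lam C₁ C₂ x z * F z) else 0)
      (s := lvl x.length) (L := SummationFilter.unconditional Word) (by intro b hb; simp only [if_neg hb])
    convert h using 1
    exact Finset.sum_congr rfl fun z hz => by rw [if_pos hz]
  convert (hA.add hB).add hC using 1
  · funext z
    by_cases hz : z.length = x.length
    · have h1 : ∀ k, z ≠ x ++ [k] := by rintro k rfl; exact hlen k hz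
      have h2 : (if z = x.dropLast then (if x = [] then 0 else q * (3 * lam * F z)) else 0) = 0 := by
        split_ifs with h h' <;> try rfl
        exfalso
        subst h
        have := List.length_pos_iff.2 h'
        simp at hz
        omega
      rw [h2]
      simp only [h1, if_false, mem_lvl, hz, if_true, hrate, hq, Finset.sum_const_zero, zero_add]
      field_simp
    · simp only [mem_lvl, hz, if_false, add_zero]
      by_cases h1 : x ≠ [] ∧ z = x.dropLast
      · obtain ⟨hx, rfl⟩ := h1
        have h2 : ∀ k, x.dropLast ≠ x ++ [k] := fun k h => by
          have := congrArg List.length h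
          simp at this
        have hp := List.length_pos_iff.2 hx
        obtain ⟨n, hn⟩ : ∃ n, x.length = n + 1 := ⟨x.length - 1, by omega⟩
        simp only [if_true, h2, hx, if_false, Finset.sum_const_zero, add_zero,
          conductance_dropLast hx, hq, hn, Nat.add_sub_cancel, pow_succ]
        have : (3 * lam) ^ n ≠ 0 := by positivity
        field_simp
      · have h1' : (if z = x.dropLast then (if x = [] then 0 else q * (3 * lam * F z)) else 0)
            = 0 := by
          split_ifs with h h' <;> try rfl
          exact absurd ⟨h', h⟩ h1
        rw [h1', zero_add]
        by_cases h2 : ∃ k, z = x ++ [k]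
        · obtain ⟨k, rfl⟩ := h2
          rw [Finset.sum_eq_single k]
          · simp [conductance_concat, hq]
          · intro l _ hl
            rw [if_neg]
            intro h
            exact hl (by simpa using h.symm)
          · simp
        · push Not at h2
          simp [conductance_eq_zero hz h1 h2, h2]
  · simp only [netSum, mul_add, Finset.mul_sum]
    split_ifs <;> simp

theorem netSum_sub (u : Word → ℝ) (x : Word) :
    netSum lam C₁ C₂ u x - netSum lam C₁ C₂ 1 x * u x = lap lam C₁ C₂ u x := by
  simp only [netSum, lap, add_mul, Finset.sum_mul, mul_sub, Finset.sum_sub_distrib, Pi.one_apply]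
  -- At the root the father term of `lap` vanishes by itself, as `[].dropLast = []`.
  split_ifs with h
  · subst h; simp; ring
  · simp; ring

theorem hasSum_conductance (hlam : 0 < lam) (x : Word) :
    HasSum (fun z => conductance lam C₁ C₂ x z)
      (((3 * lam) ^ x.length)⁻¹ * netSum lam C₁ C₂ 1 x) := by
  simpa using hasSum_conductance_mul (C₁ := C₁) (C₂ := C₂) hlam 1 x

theorem three_le_netSum_one (hlam : 0 < lam) (hC₁ : 0 < C₁) (hC₂ : 0 < C₂) (x : Word) :
    3 ≤ netSum lam C₁ C₂ 1 x := by
  have h : 0 ≤ ∑ z ∈ lvl x.length, hrate lam C₁ C₂ x z :=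
    Finset.sum_nonneg fun z _ => hrate_nonneg hlam hC₁ hC₂ x z
  simp only [netSum, Pi.one_apply, mul_one, Finset.sum_const, Finset.card_univ, Fintype.card_fin]
  split_ifs <;> simp <;> linarith

theorem netSum_one_le (hlam : 0 < lam) (hC₁ : 0 < C₁) (x : Word) :
    netSum lam C₁ C₂ 1 x ≤ 3 * lam + 3 + hbound C₁ C₂ := by
  have h := sum_hrate_le (C₂ := C₂) hlam hC₁ x
  simp only [netSum, Pi.one_apply, mul_one, Finset.sum_const, Finset.card_univ, Fintype.card_fin]
  split_ifs <;> simp <;> linarith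

theorem lap_sub (u v : Word → ℝ) (x : Word) :
    lap lam C₁ C₂ (fun y => u y - v y) x = lap lam C₁ C₂ u x - lap lam C₁ C₂ v x := by
  simp only [lap, mul_sub, Finset.sum_sub_distrib]; ring

theorem lap_const_mul (a : ℝ) (u : Word → ℝ) (x : Word) :
    lap lam C₁ C₂ (fun y => a * u y) x = a * lap lam C₁ C₂ u x := by
  simp only [lap, mul_add, Finset.mul_sum]
  congr 1
  · congr 1
    · ring
    · exact Finset.sum_congr rfl fun _ _ => by ring
  · exact Finset.sum_congr rfl fun _ _ => by ring

theorem lap_sum {ι : Type*} (s : Finset ι) (u : ι → Word → ℝ) (x : Word) :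
    lap lam C₁ C₂ (fun y => ∑ i ∈ s, u i y) x = ∑ i ∈ s, lap lam C₁ C₂ (u i) x := by
  classical
  induction s using Finset.induction_on with
  | empty => simp [lap]
  | insert i s hi ih =>
    simp only [Finset.sum_insert hi, ← ih]
    have := lap_sub (lam := lam) (C₁ := C₁) (C₂ := C₂) (fun y => u i y + ∑ i ∈ s, u i y)
      (fun y => ∑ i ∈ s, u i y) x
    simp only [add_sub_cancel_right] at this
    linarith

/-- The Laplacian of a function of the level. -/
theorem lap_level (φ : ℕ → ℝ) (x : Word) :
    lap lam C₁ C₂ (fun y => φ y.length) x =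
      3 * lam * (φ (x.length - 1) - φ x.length) + 3 * (φ (x.length + 1) - φ x.length) := by
  -- Horizontal increments vanish. At the root the truncated difference `0 - 1 = 0` again cancels
  -- the father term.
  have : ∑ z ∈ lvl x.length, hrate lam C₁ C₂ x z * (φ z.length - φ x.length) = 0 :=
    Finset.sum_eq_zero fun z hz => by rw [mem_lvl.1 hz]; ring
  rw [lap, this]
  simp
  ring

/-! ### Maximum principle -/

/-- If `v` vanishes at infinity and every positive global maximum is attained at some point of
higher level, too, then `v ≤ 0`. -/
theorem nonpos_of_maximum {S : Type*} {v : S → ℝ} {lev : S → ℕ}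
    (hfin : ∀ ε > 0, {s | ε ≤ v s}.Finite)
    (hmax : ∀ s, 0 < v s → (∀ t, v t ≤ v s) → ∃ t, lev s < lev t ∧ v s ≤ v t) (s : S) : v s ≤ 0 := by
  by_contra! hs
  obtain ⟨m, hm, hmm⟩ := Set.exists_max_image _ v (hfin _ hs) ⟨s, le_refl (v s)⟩
  have hm' : ∀ t, v t ≤ v m := fun t => by
    by_cases ht : v s ≤ v t
    · exact hmm t ht
    · exact (not_le.1 ht).le.trans hm
  have hpos : 0 < v m := hs.trans_le hm
  -- Among the finitely many maximizers, one of highest level contradicts `hmax`.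
  obtain ⟨p, hp, hpm⟩ := Set.exists_max_image _ lev (hfin _ hpos) ⟨m, le_refl (v m)⟩
  have hpe : v p = v m := le_antisymm (hm' p) hp
  obtain ⟨t, ht1, ht2⟩ := hmax p (hpe ▸ hpos) (fun t => hpe ▸ hm' t)
  have := hpm t (by simpa [hpe] using ht2)
  omega

theorem finite_length_lt (N : ℕ) : {w : Word | w.length < N}.Finite :=
  List.finite_length_lt _ _

theorem finite_le_of_tendsto {v : Word → ℝ} {a : ℕ → ℝ} (ha : Tendsto a atTop (𝓝 0))
    (h : ∀ w, v w ≤ a w.length) (ε : ℝ) (hε : 0 < ε) : {w | ε ≤ v w}.Finite := by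
  obtain ⟨N, hN⟩ := eventually_atTop.1 (ha.eventually (gt_mem_nhds hε))
  refine (finite_length_lt N).subset fun w hw => ?_
  by_contra hw'
  have := hN w.length (not_lt.1 hw')
  have := h w
  have : ε ≤ v w := hw
  linarith

/-- Functions that are subharmonic where positive and vanish at infinity are non-positive. -/
theorem nonpos_of_lap_nonneg (hlam : 0 < lam) (hC₁ : 0 < C₁) (hC₂ : 0 < C₂) {v : Word → ℝ}
    (hfin : ∀ ε > 0, {w | ε ≤ v w}.Finite) (h : ∀ w, 0 < v w → 0 ≤ lap lam C₁ C₂ v w)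
    (w : Word) : v w ≤ 0 := by
  refine nonpos_of_maximum (lev := List.length) hfin (fun x hx hmax => ?_) w
  refine ⟨x ++ [0], by simp, ?_⟩
  have h0 := h x hx
  have h1 : 3 * lam * (v x.dropLast - v x) ≤ 0 :=
    mul_nonpos_of_nonneg_of_nonpos (by positivity) (by linarith [hmax x.dropLast])
  have h2 : ∑ z ∈ lvl x.length, hrate lam C₁ C₂ x z * (v z - v x) ≤ 0 :=
    Finset.sum_nonpos fun z _ => mul_nonpos_of_nonneg_of_nonpos
      (hrate_nonneg hlam hC₁ hC₂ x z) (by linarith [hmax z])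
  -- All other increments at a maximum are non-positive, so a non-negative Laplacian forces the
  -- increment towards the first son to be non-negative.
  rw [lap, Fin.sum_univ_three] at h0
  linarith [hmax (x ++ [1]), hmax (x ++ [2])]

/-! ### The Green function -/

/-- The total conductance `∑_z c(x, z)`. -/
def totalCond (lam C₁ C₂ : ℝ) (x : Word) : ℝ :=
  ((3 * lam) ^ x.length)⁻¹ * netSum lam C₁ C₂ 1 x

theorem totalCond_pos (hlam : 0 < lam) (hC₁ : 0 < C₁) (hC₂ : 0 < C₂) (x : Word) :
    0 < totalCond lam C₁ C₂ x := by
  have := three_le_netSum_one hlam hC₁ hC₂ x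
  unfold totalCond; positivity

theorem transition_eq (hlam : 0 < lam) (hC₁ : 0 < C₁) (hC₂ : 0 < C₂) (x y : Word) :
    transition lam C₁ C₂ x y =
      ENNReal.ofReal (conductance lam C₁ C₂ x y / totalCond lam C₁ C₂ x) := by
  have h := hasSum_conductance (C₁ := C₁) (C₂ := C₂) hlam x
  rw [transition, ← ENNReal.ofReal_tsum_of_nonneg (conductance_nonneg hlam hC₁ hC₂ x) h.summable,
    h.tsum_eq, ← totalCond, ENNReal.ofReal_div_of_pos (totalCond_pos hlam hC₁ hC₂ x)]

theorem tsum_transition_mul (hlam : 0 < lam) (hC₁ : 0 < C₁) (hC₂ : 0 < C₂) {v : Word → ℝ}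
    (hv : ∀ z, 0 ≤ v z) (x : Word) :
    ∑' z, transition lam C₁ C₂ x z * ENNReal.ofReal (v z) =
      ENNReal.ofReal (netSum lam C₁ C₂ v x / netSum lam C₁ C₂ 1 x) := by
  have h3 : (3 * lam) ^ x.length ≠ 0 := by positivity
  have hp := totalCond_pos hlam hC₁ hC₂ x
  have h1 : netSum lam C₁ C₂ 1 x ≠ 0 := by linarith [three_le_netSum_one hlam hC₁ hC₂ x]
  have h := (hasSum_conductance_mul (C₁ := C₁) (C₂ := C₂) hlam v x).mul_left
    (totalCond lam C₁ C₂ x)⁻¹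
  have e : netSum lam C₁ C₂ v x / netSum lam C₁ C₂ 1 x =
      (totalCond lam C₁ C₂ x)⁻¹ * (((3 * lam) ^ x.length)⁻¹ * netSum lam C₁ C₂ v x) := by
    unfold totalCond; field_simp
  rw [e, ← h.tsum_eq, ENNReal.ofReal_tsum_of_nonneg _ h.summable]
  · refine tsum_congr fun z => ?_
    have hc := conductance_nonneg hlam hC₁ hC₂ x z
    rw [transition_eq hlam hC₁ hC₂, ← ENNReal.ofReal_mul (by positivity)]
    congr 1
    field_simp
  · exact fun z => mul_nonneg (by positivity)
      (mul_nonneg (conductance_nonneg hlam hC₁ hC₂ x z) (hv z))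

theorem green_eq (x y : Word) :
    green lam C₁ C₂ x y = (if x = y then 1 else 0) +
      ∑' z, transition lam C₁ C₂ x z * green lam C₁ C₂ z y := by
  rw [green, tsum_eq_zero_add' ENNReal.summable]
  congr 1
  simp only [transitionIter, green, ← ENNReal.tsum_mul_left]
  exact ENNReal.tsum_comm

/-- The Green function is the smallest non-negative supersolution of its first-step equation: by
induction every partial sum over times below `N` stays under `v`. -/
theorem green_le {y : Word} {v : Word → ℝ≥0∞}
    (hv : ∀ x, (if x = y then 1 else 0) + ∑' z, transition lam C₁ C₂ x z * v z ≤ v x) (x : Word) :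
    green lam C₁ C₂ x y ≤ v x := by
  have key : ∀ N x, ∑ n ∈ Finset.range N, transitionIter lam C₁ C₂ n x y ≤ v x := by
    intro N
    induction N with
    | zero => simp
    | succ N ih =>
      intro x
      rw [Finset.sum_range_succ', add_comm]
      refine le_trans ?_ (hv x)
      refine add_le_add le_rfl ?_
      simp only [transitionIter]
      rw [← Summable.tsum_finsetSum fun _ _ => ENNReal.summable]
      refine ENNReal.tsum_le_tsum fun z => ?_
      rw [← Finset.mul_sum]
      exact mul_le_mul_right (ih z) _
  rw [green, ENNReal.tsum_eq_iSup_nat]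
  exact iSup_le fun N => key N x

theorem transitionIter_succ' (n : ℕ) (x y : Word) :
    transitionIter lam C₁ C₂ (n + 1) x y =
      ∑' z, transitionIter lam C₁ C₂ n x z * transition lam C₁ C₂ z y := by
  induction n generalizing x with
  | zero =>
    simp only [transitionIter]
    rw [tsum_eq_single y (by intro b hb; simp [hb]), tsum_eq_single x (by
      intro b hb; simp [hb.symm])]
    simp
  | succ n ih =>
    rw [transitionIter]
    simp only [ih]
    simp only [transitionIter, ← ENNReal.tsum_mul_left, ← ENNReal.tsum_mul_right]
    rw [ENNReal.tsum_comm]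
    simp only [mul_assoc]

theorem totalCond_mul_transition (hlam : 0 < lam) (hC₁ : 0 < C₁) (hC₂ : 0 < C₂) (x y : Word) :
    ENNReal.ofReal (totalCond lam C₁ C₂ x) * transition lam C₁ C₂ x y =
      ENNReal.ofReal (totalCond lam C₁ C₂ y) * transition lam C₁ C₂ y x := by
  have hx := totalCond_pos hlam hC₁ hC₂ x
  have hy := totalCond_pos hlam hC₁ hC₂ y
  rw [transition_eq hlam hC₁ hC₂, transition_eq hlam hC₁ hC₂, ← ENNReal.ofReal_mul hx.le,
    ← ENNReal.ofReal_mul hy.le, conductance_symm x y]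
  field_simp

theorem totalCond_mul_transitionIter (hlam : 0 < lam) (hC₁ : 0 < C₁) (hC₂ : 0 < C₂) (n : ℕ)
    (x y : Word) :
    ENNReal.ofReal (totalCond lam C₁ C₂ x) * transitionIter lam C₁ C₂ n x y =
      ENNReal.ofReal (totalCond lam C₁ C₂ y) * transitionIter lam C₁ C₂ n y x := by
  induction n generalizing x with
  | zero =>
    simp only [transitionIter]
    by_cases h : x = y
    · subst h; rfl
    · simp [h, Ne.symm h]
  | succ n ih =>
    rw [transitionIter_succ' n y x, transitionIter]
    simp only [← ENNReal.tsum_mul_left]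
    refine tsum_congr fun z => ?_
    rw [← mul_assoc, totalCond_mul_transition hlam hC₁ hC₂ x z, ← mul_assoc, ← ih z]
    ring

/-- Reversibility of the walk. It turns the Martin kernel, where `y` is the target, into the
potential with pole `x` evaluated at `y`, to which the Laplacian in `y` applies. -/
theorem totalCond_mul_green (hlam : 0 < lam) (hC₁ : 0 < C₁) (hC₂ : 0 < C₂) (x y : Word) :
    ENNReal.ofReal (totalCond lam C₁ C₂ x) * green lam C₁ C₂ x y =
      ENNReal.ofReal (totalCond lam C₁ C₂ y) * green lam C₁ C₂ y x := by
  simp only [green, ← ENNReal.tsum_mul_left]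
  exact tsum_congr fun n => totalCond_mul_transitionIter hlam hC₁ hC₂ n x y

/-- A non-negative function whose Laplacian is negative enough dominates the Green function. -/
theorem green_le_of_lap (hlam : 0 < lam) (hC₁ : 0 < C₁) (hC₂ : 0 < C₂) {y : Word} {v : Word → ℝ}
    (hv : ∀ x, 0 ≤ v x)
    (h : ∀ x, lap lam C₁ C₂ v x ≤ if x = y then -netSum lam C₁ C₂ 1 x else 0) (x : Word) :
    green lam C₁ C₂ x y ≤ ENNReal.ofReal (v x) := by
  refine green_le (v := fun x => ENNReal.ofReal (v x)) (fun x => ?_) x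
  have h3 := three_le_netSum_one hlam hC₁ hC₂ x
  rw [tsum_transition_mul hlam hC₁ hC₂ hv]
  have hx := h x
  rw [← netSum_sub] at hx
  have h0 : 0 ≤ netSum lam C₁ C₂ v x := by
    have := (hasSum_conductance_mul (C₁ := C₁) (C₂ := C₂) hlam v x).nonneg fun z =>
      mul_nonneg (conductance_nonneg hlam hC₁ hC₂ x z) (hv z)
    exact nonneg_of_mul_nonneg_right this (by positivity)
  have e : (if x = y then (1 : ℝ≥0∞) else 0) = ENNReal.ofReal (if x = y then 1 else 0) := by
    split_ifs <;> simp
  rw [e, ← ENNReal.ofReal_add (by split_ifs <;> norm_num) (by positivity)]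
  refine ENNReal.ofReal_le_ofReal ?_
  have h1 : 0 < netSum lam C₁ C₂ 1 x := by linarith
  rw [← sub_nonneg]
  have : v x - ((if x = y then 1 else 0) + netSum lam C₁ C₂ v x / netSum lam C₁ C₂ 1 x) =
      (netSum lam C₁ C₂ 1 x * v x - netSum lam C₁ C₂ v x -
        if x = y then netSum lam C₁ C₂ 1 x else 0) / netSum lam C₁ C₂ 1 x := by
    split_ifs <;> field_simp <;> ring
  rw [this]
  refine div_nonneg ?_ h1.le
  split_ifs at hx ⊢ <;> linarith

/-! ### Potentials: decay, Poisson equation and relation to the Martin kernel -/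

/-- The Green function with pole `x`, normalized such that its normalized Laplacian is `-1` at the
pole. -/
def pot (lam C₁ C₂ : ℝ) (x y : Word) : ℝ :=
  (green lam C₁ C₂ y x).toReal / netSum lam C₁ C₂ 1 x

/-- Away from the root, the powers `r ^ n` annihilated by the Laplacian solve `3λ(r⁻¹ - 1) + 3(r -
1) = 0`, that is, `r = 1` or `r = λ`. Gluing both at level `|x|` gives a supersolution whose kink
has Laplacian `-3(1 - λ)λ^|x|`, up to the factor, on that whole level; this is used at `x` and
discarded elsewhere. -/
theorem green_le_pow (hlam : 0 < lam) (hlam' : lam < 1 / 3) (hC₁ : 0 < C₁) (hC₂ : 0 < C₂)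
    (x y : Word) :
    green lam C₁ C₂ y x ≤ ENNReal.ofReal (netSum lam C₁ C₂ 1 x /
      (3 * (1 - lam) * lam ^ x.length) * lam ^ max y.length x.length) := by
  have h1 : 0 < 1 - lam := by linarith
  have h3 := three_le_netSum_one hlam hC₁ hC₂ x
  set M := netSum lam C₁ C₂ 1 x / (3 * (1 - lam) * lam ^ x.length) with hM
  have hM0 : 0 < M := by positivity
  refine green_le_of_lap (v := fun y => M * lam ^ max y.length x.length) hlam hC₁ hC₂
    (fun y => by positivity) (fun z => ?_) y
  rw [lap_level (fun n => M * lam ^ max n x.length)]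
  have hz : (if z = x then -netSum lam C₁ C₂ 1 z else 0) =
      if z = x then -(M * (3 * (1 - lam) * lam ^ x.length)) else 0 := by
    split_ifs with h
    · subst h; rw [hM]; field_simp
    · rfl
  rw [hz]
  rcases lt_trichotomy z.length x.length with h | h | h
  · have hne : z ≠ x := by rintro rfl; exact lt_irrefl _ h
    rw [if_neg hne, max_eq_right h.le, max_eq_right (by omega), max_eq_right (by omega)]
    simp
  · rw [h, max_eq_right (by omega), max_self, max_eq_left (by omega), pow_succ]
    have : 0 < M * lam ^ x.length * (1 - lam) := by positivity
    split_ifs <;> nlinarith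
  · have hne : z ≠ x := by rintro rfl; exact lt_irrefl _ h
    obtain ⟨n, hn⟩ : ∃ n, z.length = n + 1 := ⟨z.length - 1, by omega⟩
    rw [if_neg hne, hn, max_eq_left (by omega), max_eq_left (by omega), max_eq_left (by omega)]
    simp only [Nat.add_sub_cancel, pow_succ]
    apply le_of_eq
    ring

theorem green_ne_top (hlam : 0 < lam) (hlam' : lam < 1 / 3) (hC₁ : 0 < C₁) (hC₂ : 0 < C₂)
    (x y : Word) : green lam C₁ C₂ x y ≠ ∞ :=
  ne_top_of_le_ne_top ENNReal.ofReal_ne_top (green_le_pow hlam hlam' hC₁ hC₂ y x)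

theorem pot_nonneg (hlam : 0 < lam) (hC₁ : 0 < C₁) (hC₂ : 0 < C₂)
    (x y : Word) : 0 ≤ pot lam C₁ C₂ x y :=
  div_nonneg ENNReal.toReal_nonneg (by linarith [three_le_netSum_one hlam hC₁ hC₂ x])

/-- The pole-dependent constant in the decay of the Green function. -/
def potBound (lam : ℝ) (x : Word) : ℝ := (3 * (1 - lam) * lam ^ x.length)⁻¹

theorem potBound_pos (hlam : 0 < lam) (hlam' : lam < 1 / 3) (x : Word) : 0 < potBound lam x := by
  have h1 : 0 < 1 - lam := by linarith
  unfold potBound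
  positivity

theorem pot_le (hlam : 0 < lam) (hlam' : lam < 1 / 3) (hC₁ : 0 < C₁) (hC₂ : 0 < C₂)
    (x y : Word) : pot lam C₁ C₂ x y ≤ potBound lam x * lam ^ y.length := by
  have h1 : 0 < 1 - lam := by linarith
  have h3 := three_le_netSum_one hlam hC₁ hC₂ x
  have h := ENNReal.toReal_le_of_le_ofReal (by positivity) (green_le_pow hlam hlam' hC₁ hC₂ x y)
  rw [pot, div_le_iff₀ (by linarith), potBound]
  refine h.trans ?_
  have : lam ^ max y.length x.length ≤ lam ^ y.length :=
    pow_le_pow_of_le_one hlam.le (by linarith) (le_max_left _ _)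
  calc netSum lam C₁ C₂ 1 x / (3 * (1 - lam) * lam ^ x.length) * lam ^ max y.length x.length
      ≤ netSum lam C₁ C₂ 1 x / (3 * (1 - lam) * lam ^ x.length) * lam ^ y.length := by gcongr
    _ = _ := by ring

/-- This is the first-step equation `green_eq`, transferred to real numbers by the finiteness of the
Green function. -/
theorem lap_pot (hlam : 0 < lam) (hlam' : lam < 1 / 3) (hC₁ : 0 < C₁) (hC₂ : 0 < C₂)
    (x y : Word) : lap lam C₁ C₂ (pot lam C₁ C₂ x) y = if y = x then -1 else 0 := by
  have h3 := three_le_netSum_one hlam hC₁ hC₂ x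
  have h3' := three_le_netSum_one hlam hC₁ hC₂ y
  set g : Word → ℝ := fun y => (green lam C₁ C₂ y x).toReal with hg
  have hG : ∀ y, green lam C₁ C₂ y x = ENNReal.ofReal (g y) := fun y =>
    (ENNReal.ofReal_toReal (green_ne_top hlam hlam' hC₁ hC₂ y x)).symm
  have hg0 : ∀ y, 0 ≤ g y := fun y => ENNReal.toReal_nonneg
  have h := green_eq (lam := lam) (C₁ := C₁) (C₂ := C₂) y x
  simp only [hG] at h
  have h0 : 0 ≤ netSum lam C₁ C₂ g y := by
    have := (hasSum_conductance_mul (C₁ := C₁) (C₂ := C₂) hlam g y).nonneg fun z =>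
      mul_nonneg (conductance_nonneg hlam hC₁ hC₂ y z) (hg0 z)
    exact nonneg_of_mul_nonneg_right this (by positivity)
  rw [tsum_transition_mul hlam hC₁ hC₂ hg0] at h
  have e : (if y = x then (1 : ℝ≥0∞) else 0) = ENNReal.ofReal (if y = x then 1 else 0) := by
    split_ifs <;> simp
  rw [e, ← ENNReal.ofReal_add (by split_ifs <;> norm_num) (by positivity),
    ENNReal.ofReal_eq_ofReal_iff (hg0 y) (by positivity)] at h
  have hpot : pot lam C₁ C₂ x = fun y => (netSum lam C₁ C₂ 1 x)⁻¹ * g y := by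
    funext z; simp only [pot, hg]; ring
  rw [hpot, lap_const_mul, ← netSum_sub, h]
  split_ifs with hyx
  · subst hyx; field_simp; ring
  · field_simp; ring

/-- The Green function with pole at the root. -/
theorem pot_nil (hlam : 0 < lam) (hlam' : lam < 1 / 3) (hC₁ : 0 < C₁) (hC₂ : 0 < C₂) (y : Word) :
    pot lam C₁ C₂ [] y = potBound lam [] * lam ^ y.length := by
  have h1 : 0 < 1 - lam := by linarith
  refine le_antisymm (pot_le hlam hlam' hC₁ hC₂ [] y) (sub_nonpos.1 ?_)
  refine nonpos_of_lap_nonneg (C₁ := C₁) (C₂ := C₂) hlam hC₁ hC₂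
    (v := fun y => potBound lam [] * lam ^ y.length - pot lam C₁ C₂ [] y) ?_ ?_ y
  · refine finite_le_of_tendsto (a := fun n => potBound lam [] * lam ^ n) ?_ fun w => ?_
    · simpa using (tendsto_pow_atTop_nhds_zero_of_lt_one hlam.le (by linarith)).const_mul
        (potBound lam [])
    · linarith [pot_nonneg hlam hC₁ hC₂ [] w]
  · intro w _
    -- Both functions have the same Laplacian: `λ^n` is harmonic off the root, and `potBound lam []`
    -- normalizes its Laplacian at the root to `-1`.
    rw [lap_sub, lap_level (fun n => potBound lam [] * lam ^ n), lap_pot hlam hlam' hC₁ hC₂]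
    by_cases hw : w = []
    · subst hw
      simp [potBound]
      field_simp
      apply le_of_eq
      ring
    · have := List.length_pos_iff.2 hw
      obtain ⟨n, hn⟩ : ∃ n, w.length = n + 1 := ⟨w.length - 1, by omega⟩
      rw [if_neg hw, hn]
      simp only [Nat.add_sub_cancel, pow_succ]
      apply le_of_eq
      ring

theorem pot_nil_pos (hlam : 0 < lam) (hlam' : lam < 1 / 3) (hC₁ : 0 < C₁) (hC₂ : 0 < C₂)
    (y : Word) : 0 < pot lam C₁ C₂ [] y := by
  rw [pot_nil hlam hlam' hC₁ hC₂]
  have := potBound_pos hlam hlam' []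
  positivity

/-- The Martin kernel in terms of the normalized Green function. -/
theorem martinKernel_eq (hlam : 0 < lam) (hlam' : lam < 1 / 3) (hC₁ : 0 < C₁) (hC₂ : 0 < C₂)
    (x y : Word) :
    martinKernel lam C₁ C₂ x y = ENNReal.ofReal
      ((3 * lam) ^ x.length / potBound lam [] * (pot lam C₁ C₂ x y / lam ^ y.length)) := by
  have h3 : ∀ x, 0 < netSum lam C₁ C₂ 1 x := fun x => by
    linarith [three_le_netSum_one hlam hC₁ hC₂ x]
  -- By reversibility the dependence on the total conductance at `y` is a common factor that cancels
  -- in the quotient.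
  have hG : ∀ x, green lam C₁ C₂ x y =
      ENNReal.ofReal (totalCond lam C₁ C₂ y * (3 * lam) ^ x.length * pot lam C₁ C₂ x y) := by
    intro x
    have h := totalCond_mul_green hlam hC₁ hC₂ x y
    have hx := totalCond_pos hlam hC₁ hC₂ x
    have hy := totalCond_pos hlam hC₁ hC₂ y
    have e1 := ENNReal.ofReal_toReal (green_ne_top hlam hlam' hC₁ hC₂ x y)
    have e2 := ENNReal.ofReal_toReal (green_ne_top hlam hlam' hC₁ hC₂ y x)
    rw [← e1, ← e2, ← ENNReal.ofReal_mul hx.le, ← ENNReal.ofReal_mul hy.le,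
      ENNReal.ofReal_eq_ofReal_iff (by positivity) (by positivity)] at h
    rw [← e1]
    congr 1
    have := h3 x
    rw [pot, ← mul_right_inj' hx.ne', h]
    conv_rhs => rw [totalCond]
    field_simp
  have hp := pot_nil_pos hlam hlam' hC₁ hC₂ y
  have hy := totalCond_pos hlam hC₁ hC₂ y
  rw [martinKernel, hG x, hG [], ← ENNReal.ofReal_div_of_pos (by positivity)]
  congr 1
  have := potBound_pos hlam hlam' []
  rw [pot_nil hlam hlam' hC₁ hC₂]
  simp
  field_simp

/-! ### Functions of finite energy extend to the Martin compactification -/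

instance : CompactSpace (MartinCompactification lam C₁ C₂) := martin_isCompactification.compact

instance : T2Space (MartinCompactification lam C₁ C₂) := martin_isCompactification.t2

/-- The increments of `u` along the edges decay like `B * ρ ^ n` in the level `n`. -/
structure IsHolder (u : Word → ℝ) (B ρ : ℝ) : Prop where
  vertical : ∀ y k, |u (y ++ [k]) - u y| ≤ B * ρ ^ y.length
  horizontal : ∀ y z, IsHorizontal y z → |u z - u y| ≤ B * ρ ^ y.length

theorem IsHolder.nonneg {u : Word → ℝ} {B ρ : ℝ} (h : IsHolder u B ρ) : 0 ≤ B := by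
  simpa using (abs_nonneg _).trans (h.vertical [] 0)

/-- A single edge contributes at most the whole energy, and its conductance on level `n` is at least
`m (3λ)^(-n)` with `m = min 1 (min C₁ C₂)`. -/
theorem HasFiniteEnergy.isHolder (hlam : 0 < lam) (hC₁ : 0 < C₁) (hC₂ : 0 < C₂) {u : Word → ℝ}
    (hu : HasFiniteEnergy lam C₁ C₂ u) : ∃ B, IsHolder u B (Real.sqrt (3 * lam)) := by
  have h0 : ∀ p : Word × Word, 0 ≤ conductance lam C₁ C₂ p.1 p.2 * (u p.1 - u p.2) ^ 2 := fun p =>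
    mul_nonneg (conductance_nonneg hlam hC₁ hC₂ _ _) (sq_nonneg _)
  set E := ∑' p : Word × Word, conductance lam C₁ C₂ p.1 p.2 * (u p.1 - u p.2) ^ 2
  have hE0 : 0 ≤ E := tsum_nonneg h0
  have hE : ∀ x y, conductance lam C₁ C₂ x y * (u x - u y) ^ 2 ≤ E := fun x y =>
    hu.le_tsum (x, y) fun p _ => h0 p
  set m := min 1 (min C₁ C₂)
  have hm : 0 < m := by positivity
  have key : ∀ x y, m ≤ (3 * lam) ^ x.length * conductance lam C₁ C₂ x y →
      |u y - u x| ≤ Real.sqrt (E / m) * Real.sqrt (3 * lam) ^ x.length := by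
    intro x y h
    have h3 : 0 < (3 * lam) ^ x.length := by positivity
    refine abs_le_of_sq_le_sq ?_ (by positivity)
    rw [mul_pow, Real.sq_sqrt (by positivity), ← pow_mul, mul_comm _ 2, pow_mul,
      Real.sq_sqrt (by positivity), div_mul_eq_mul_div, le_div_iff₀ hm]
    calc (u y - u x) ^ 2 * m
        ≤ (u y - u x) ^ 2 * ((3 * lam) ^ x.length * conductance lam C₁ C₂ x y) := by gcongr
      _ = conductance lam C₁ C₂ x y * (u x - u y) ^ 2 * (3 * lam) ^ x.length := by ring
      _ ≤ _ := by gcongr; exact hE x y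
  refine ⟨Real.sqrt (E / m), fun y k => key _ _ ?_, fun y z hyz => key _ _ ?_⟩
  · rw [conductance_concat, mul_inv_cancel₀ (by positivity)]
    exact min_le_left _ _
  · exact (min_le_right _ _).trans (min_le_hrate hlam hyz)

theorem IsHolder.abs_sub_append_le {u : Word → ℝ} {B ρ : ℝ} (h : IsHolder u B ρ) (hρ : 0 ≤ ρ)
    (hρ' : ρ < 1) (y s : Word) : |u (y ++ s) - u y| ≤ B * ρ ^ y.length / (1 - ρ) := by
  have hB := h.nonneg
  have h1 : 0 < 1 - ρ := by linarith
  induction s generalizing y with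
  | nil => simp; positivity
  | cons k s ih =>
    have h2 := ih (y ++ [k])
    rw [List.append_assoc, List.singleton_append] at h2
    have h3 := abs_sub_le (u (y ++ k :: s)) (u (y ++ [k])) (u y)
    refine h3.trans ((add_le_add h2 (h.vertical y k)).trans (le_of_eq ?_))
    simp only [List.length_append, List.length_singleton, pow_succ]
    field_simp
    ring

theorem IsHolder.abs_le {u : Word → ℝ} {B ρ : ℝ} (h : IsHolder u B ρ) (hρ : 0 ≤ ρ)
    (hρ' : ρ < 1) (y : Word) : |u y| ≤ |u []| + B / (1 - ρ) := by
  have h1 := h.abs_sub_append_le hρ hρ' [] y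
  have h2 := abs_sub_abs_le_abs_sub (u y) (u [])
  simp at h1
  linarith

/-- Since `λ^n` is harmonic off the root, the terms of order zero in `u` cancel and only increments
of `u` remain. The root is covered by its own constant `D₀`. -/
theorem IsHolder.exists_lap_le (hlam : 0 < lam) (hC₁ : 0 < C₁) (hC₂ : 0 < C₂)
    {u : Word → ℝ} {B ρ : ℝ} (h : IsHolder u B ρ) (hρ : 0 < ρ) (hlam' : lam < 1 / 3) :
    ∃ D, 0 ≤ D ∧ ∀ y, |lap lam C₁ C₂ (fun y => lam ^ y.length * u y) y| ≤ D * (lam * ρ) ^ y.length := by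
  have hB := h.nonneg
  have hQ := hbound_pos (C₂ := C₂) hC₁
  set D₀ := |lap lam C₁ C₂ (fun y => lam ^ y.length * u y) []|
  set D₁ := B * (3 / ρ + 3 + hbound C₁ C₂)
  refine ⟨D₀ + D₁, by positivity, fun y => ?_⟩
  rcases List.eq_nil_or_concat y with rfl | ⟨t, l, rfl⟩
  · simp only [List.length_nil, pow_zero, mul_one]
    have : 0 ≤ D₁ := by positivity
    linarith
  · rw [List.concat_eq_append]
    set y := t ++ [l] with hy
    have hn : y.length = t.length + 1 := by simp [hy]
    have hd : y.dropLast = t := by simp [hy]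
    have hH : |∑ z ∈ lvl y.length, hrate lam C₁ C₂ y z * (u z - u y)| ≤
        hbound C₁ C₂ * (B * ρ ^ y.length) := by
      refine (Finset.abs_sum_le_sum_abs _ _).trans ?_
      simp only [abs_mul, abs_of_nonneg (hrate_nonneg hlam hC₁ hC₂ y _)]
      exact sum_hrate_mul_le (F := fun z => |u z - u y|) hlam hC₁ hC₂ (by positivity)
        fun z hz => h.horizontal y z hz
    have hE : ∑ z ∈ lvl y.length, hrate lam C₁ C₂ y z * (lam ^ z.length * u z - lam ^ y.length * u y)
        = lam ^ y.length * ∑ z ∈ lvl y.length, hrate lam C₁ C₂ y z * (u z - u y) := by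
      rw [Finset.mul_sum]
      refine Finset.sum_congr rfl fun z hz => ?_
      rw [mem_lvl.1 hz]; ring
    have hL : lap lam C₁ C₂ (fun y => lam ^ y.length * u y) y = lam ^ y.length *
        (-3 * (u y - u t) + lam * ∑ k, (u (y ++ [k]) - u y) +
          ∑ z ∈ lvl y.length, hrate lam C₁ C₂ y z * (u z - u y)) := by
      simp only [lap]
      rw [hE, hd]
      simp only [Fin.sum_univ_three, List.length_append, List.length_singleton, hn, pow_succ]
      ring
    have h1 : |u y - u t| ≤ B * ρ ^ t.length := h.vertical t l
    have h2 : |∑ k, (u (y ++ [k]) - u y)| ≤ 3 * (B * ρ ^ y.length) := by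
      refine (Finset.abs_sum_le_sum_abs _ _).trans ?_
      refine (Finset.sum_le_sum fun k _ => h.vertical y k).trans (le_of_eq ?_)
      simp
    have h3 : |lam * ∑ k, (u (y ++ [k]) - u y)| ≤ 3 * (B * ρ ^ y.length) := by
      rw [abs_mul, abs_of_pos hlam]
      exact (mul_le_of_le_one_left (abs_nonneg _) (by linarith)).trans h2
    have h4 : |-3 * (u y - u t)| ≤ 3 / ρ * (B * ρ ^ y.length) := by
      rw [abs_mul, hn, pow_succ]
      have : |(-3 : ℝ)| = 3 := by norm_num
      rw [this]
      calc 3 * |u y - u t| ≤ 3 * (B * ρ ^ t.length) := by gcongr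
        _ = _ := by field_simp
    rw [hL, abs_mul, abs_of_pos (by positivity), mul_pow]
    have h5 := abs_add_three (-3 * (u y - u t)) (lam * ∑ k, (u (y ++ [k]) - u y))
      (∑ z ∈ lvl y.length, hrate lam C₁ C₂ y z * (u z - u y))
    have h6 : 0 ≤ D₀ * ρ ^ y.length := by positivity
    calc _ ≤ lam ^ y.length * ((D₀ + D₁) * ρ ^ y.length) := by
          refine mul_le_mul_of_nonneg_left ?_ (by positivity)
          simp only [D₁]
          linarith
      _ = _ := by ring

/-- Decaying functions with small Laplacian are small. -/
theorem abs_le_of_lap_le (hlam : 0 < lam) (hlam' : lam < 1 / 3) (hC₁ : 0 < C₁) (hC₂ : 0 < C₂)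
    {w : Word → ℝ} {A K γ : ℝ} (hγ : 0 < γ) (hγ' : γ < 1) (hK : 0 ≤ K)
    (hA : ∀ y, |w y| ≤ A * lam ^ y.length)
    (h : ∀ y, |lap lam C₁ C₂ w y| ≤ K * (3 * (1 - γ) * (1 - lam)) * (lam * γ) ^ y.length)
    (y : Word) : |w y| ≤ K * (2 / (1 - lam)) * lam ^ y.length := by
  have h1 : 0 < 1 - lam := by linarith
  have hg1 : 0 < 1 - γ := by linarith
  set b := 2 / (1 - lam) with hb
  have hb2 : b * (1 - lam) = 2 := by rw [hb]; field_simp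
  have hb1 : 1 ≤ b := by rw [hb, le_div_iff₀ h1]; linarith
  set W : ℕ → ℝ := fun n => K * (lam ^ n * (b - γ ^ n)) with hW
  have hWn : ∀ n, 0 ≤ W n := fun n => by
    have : γ ^ n ≤ 1 := pow_le_one₀ hγ.le hγ'.le
    have : 0 ≤ b - γ ^ n := by linarith
    simp only [hW]; positivity
  have hWlap : ∀ x : Word, lap lam C₁ C₂ (fun y => W y.length) x ≤
      -(K * (3 * (1 - γ) * (1 - lam)) * (lam * γ) ^ x.length) := by
    intro x
    rw [lap_level]
    obtain ⟨n, hn⟩ : ∃ n, x.length = n := ⟨_, rfl⟩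
    rw [hn]
    cases n with
    | zero =>
      simp only [hW, Nat.zero_sub, pow_zero, pow_one, mul_one, zero_add]
      have : (1 - γ) * (1 - lam) ≤ 1 := by nlinarith
      have h5 : K * (lam * (b - γ)) - K * (b - 1) = -K - K * (lam * γ) := by
        linear_combination (-K) * hb2
      have h6 : 0 ≤ K * (lam * γ) := by positivity
      have h7 : K * ((1 - γ) * (1 - lam)) ≤ K * 1 := mul_le_mul_of_nonneg_left this hK
      linarith
    | succ n =>
      simp only [hW, Nat.add_sub_cancel]
      have e : 3 * lam * (K * (lam ^ n * (b - γ ^ n)) - K * (lam ^ (n + 1) * (b - γ ^ (n + 1)))) +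
          3 * (K * (lam ^ (n + 1 + 1) * (b - γ ^ (n + 1 + 1))) -
            K * (lam ^ (n + 1) * (b - γ ^ (n + 1)))) =
          -(K * (3 * (1 - γ) * (1 - lam * γ)) * (lam ^ (n + 1) * γ ^ n)) := by
        simp only [pow_succ]; ring
      rw [e, neg_le_neg_iff, mul_pow]
      have e1 : γ ^ (n + 1) ≤ γ ^ n := pow_le_pow_of_le_one hγ.le hγ'.le (Nat.le_succ n)
      have e2 : 1 - lam ≤ 1 - lam * γ := by nlinarith
      have e3 : 0 ≤ 1 - lam * γ := by linarith
      gcongr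
  have main : ∀ w : Word → ℝ, (∀ y, |w y| ≤ A * lam ^ y.length) →
      (∀ y, |lap lam C₁ C₂ w y| ≤ K * (3 * (1 - γ) * (1 - lam)) * (lam * γ) ^ y.length) →
      ∀ y, w y ≤ K * b * lam ^ y.length := by
    intro w hA h y
    have hle := nonpos_of_lap_nonneg (C₁ := C₁) (C₂ := C₂) hlam hC₁ hC₂
      (v := fun y => w y - W y.length) ?_ ?_ y
    · have : W y.length ≤ K * b * lam ^ y.length := by
        have : 0 ≤ K * lam ^ y.length * γ ^ y.length := by positivity
        simp only [hW]
        linarith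
      linarith
    · refine finite_le_of_tendsto (a := fun n => A * lam ^ n) ?_ fun w' => ?_
      · simpa using (tendsto_pow_atTop_nhds_zero_of_lt_one hlam.le (by linarith)).const_mul A
      · linarith [hWn w'.length, le_abs_self (w w'), hA w']
    · intro x _
      rw [lap_sub]
      linarith [hWlap x, neg_abs_le (lap lam C₁ C₂ w x), h x]
  refine abs_le.2 ⟨?_, main w hA h y⟩
  have := main (fun y => -1 * w y) (by simpa using hA)
    (fun y => by rw [lap_const_mul]; simpa using h y) y
  linarith

/-! ### Continuous extension to the compactification -/

/-- The continuous extension of the normalized Martin kernel. -/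
theorem exists_kernelExtension (hlam : 0 < lam) (hlam' : lam < 1 / 3) (hC₁ : 0 < C₁) (hC₂ : 0 < C₂)
    (x : Word) : ∃ g : C(MartinCompactification lam C₁ C₂, ℝ),
      (∀ y, g (incl lam C₁ C₂ y) = pot lam C₁ C₂ x y / lam ^ y.length) ∧
      ∀ z, ENNReal.ofReal ((3 * lam) ^ x.length / potBound lam [] * g z) = (z.1 x).1 := by
  have hcont : Continuous fun z : MartinCompactification lam C₁ C₂ => (z.1 x).1 :=
    continuous_fst.comp ((continuous_apply x).comp continuous_subtype_val)
  have hp0 := potBound_pos hlam hlam' []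
  have hpx := potBound_pos hlam hlam' x
  set a := (3 * lam) ^ x.length / potBound lam [] with ha
  have ha0 : 0 < a := by positivity
  have hval : ∀ y, ((incl lam C₁ C₂ y).1 x).1 =
      ENNReal.ofReal (a * (pot lam C₁ C₂ x y / lam ^ y.length)) := fun y =>
    martinKernel_eq hlam hlam' hC₁ hC₂ x y
  have hle : ∀ z : MartinCompactification lam C₁ C₂,
      (z.1 x).1 ≤ ENNReal.ofReal (a * potBound lam x) := by
    intro z
    refine denseRange_incl.induction_on z (isClosed_le hcont continuous_const) fun y => ?_
    rw [hval]
    refine ENNReal.ofReal_le_ofReal (mul_le_mul_of_nonneg_left ?_ ha0.le)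
    rw [div_le_iff₀ (by positivity)]
    exact pot_le hlam hlam' hC₁ hC₂ x y
  have hfin : ∀ z : MartinCompactification lam C₁ C₂, (z.1 x).1 ≠ ∞ := fun z =>
    ne_top_of_le_ne_top ENNReal.ofReal_ne_top (hle z)
  refine ⟨⟨fun z => a⁻¹ * ((z.1 x).1).toReal, continuous_const.mul
    (ENNReal.continuousOn_toReal.comp_continuous hcont hfin)⟩, fun y => ?_, fun z => ?_⟩
  · have := pot_nonneg hlam hC₁ hC₂ x y
    simp only [ContinuousMap.coe_mk]
    rw [hval, ENNReal.toReal_ofReal (by positivity)]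
    field_simp
  · simp only [ContinuousMap.coe_mk]
    rw [mul_inv_cancel_left₀ ha0.ne', ENNReal.ofReal_toReal (hfin z)]

/-- A uniform limit, on the vertices, of continuous functions on the Martin compactification
extends continuously. -/
theorem exists_extension_of_uniform_limit {u : Word → ℝ}
    (h : ∀ ε > 0, ∃ g : C(MartinCompactification lam C₁ C₂, ℝ),
      ∀ y, |g (incl lam C₁ C₂ y) - u y| ≤ ε) :
    ∃ g : C(MartinCompactification lam C₁ C₂, ℝ), ∀ y, g (incl lam C₁ C₂ y) = u y := by
  choose! g hg using h
  set ε : ℕ → ℝ := fun n => 1 / ((n : ℝ) + 1) with hε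
  have hε0 : ∀ n, 0 < ε n := fun n => by simp only [hε]; positivity
  have hεlim : Tendsto ε atTop (𝓝 0) := tendsto_one_div_add_atTop_nhds_zero_nat
  have hεanti : ∀ {m n}, m ≤ n → ε n ≤ ε m := fun h => by
    simp only [hε]; gcongr
  have hC : CauchySeq fun n => g (ε n) := by
    refine cauchySeq_of_le_tendsto_0 (fun n => 2 * ε n) (fun n m N hn hm => ?_)
      (by simpa using hεlim.const_mul 2)
    rw [ContinuousMap.dist_le (by linarith [hε0 N])]
    intro z
    refine denseRange_incl.induction_on z (isClosed_le (by fun_prop) continuous_const) fun y => ?_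
    rw [Real.dist_eq]
    have h1 := hg (ε n) (hε0 n) y
    have h2 := hg (ε m) (hε0 m) y
    rw [abs_sub_comm] at h2
    have := abs_sub_le (g (ε n) (incl lam C₁ C₂ y)) (u y) (g (ε m) (incl lam C₁ C₂ y))
    linarith [hεanti hn, hεanti hm]
  obtain ⟨G, hG⟩ := cauchySeq_tendsto_of_complete hC
  refine ⟨G, fun y => ?_⟩
  have h1 : Tendsto (fun n => g (ε n) (incl lam C₁ C₂ y)) atTop (𝓝 (G (incl lam C₁ C₂ y))) :=
    ((continuous_eval_const (incl lam C₁ C₂ y)).tendsto G).comp hG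
  have h2 : Tendsto (fun n => g (ε n) (incl lam C₁ C₂ y)) atTop (𝓝 (u y)) := by
    rw [tendsto_iff_dist_tendsto_zero]
    exact squeeze_zero (fun _ => dist_nonneg) (fun n => by
      rw [Real.dist_eq]; exact hg (ε n) (hε0 n) y) hεlim
  exact tendsto_nhds_unique h1 h2

/-- The function `v = λ^|·| u` is approximated by the potentials `V N` of `-lap v` restricted to
levels below `N`. Divided by `λ^|y|`, each `V N` is a finite combination of Martin kernels. -/
theorem IsHolder.exists_extension (hlam : 0 < lam) (hlam' : lam < 1 / 3) (hC₁ : 0 < C₁)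
    (hC₂ : 0 < C₂) {u : Word → ℝ} {B ρ : ℝ} (h : IsHolder u B ρ) (hρ : 0 < ρ) (hρ' : ρ < 1) :
    ∃ g : C(MartinCompactification lam C₁ C₂, ℝ), ∀ y, g (incl lam C₁ C₂ y) = u y := by
  obtain ⟨D, hD0, hD⟩ := h.exists_lap_le (C₁ := C₁) (C₂ := C₂) hlam hC₁ hC₂ hρ hlam'
  choose κ hκ _ using exists_kernelExtension (C₁ := C₁) (C₂ := C₂) hlam hlam' hC₁ hC₂
  set v : Word → ℝ := fun y => lam ^ y.length * u y with hv
  -- Any `γ` strictly between `ρ` and `1` serves: `γ < 1` feeds the barrier and `ρ / γ < 1` gives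
  -- the decay in `N`.
  set γ := (1 + ρ) / 2 with hγ
  have hγ0 : 0 < γ := by positivity
  have hγ1 : γ < 1 := by rw [hγ]; linarith
  have hργ : ρ / γ < 1 := by rw [div_lt_one hγ0, hγ]; linarith
  have h1 : 0 < 1 - lam := by linarith
  have hg1 : 0 < 1 - γ := by linarith
  set σ := 3 * (1 - γ) * (1 - lam) with hσ
  have hσ0 : 0 < σ := by positivity
  let F : ℕ → Finset Word := fun N => (finite_length_lt N).toFinset
  set V : ℕ → Word → ℝ := fun N y => ∑ x ∈ F N, -lap lam C₁ C₂ v x * pot lam C₁ C₂ x y with hV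
  have hVlap : ∀ N y, lap lam C₁ C₂ (V N) y = if y.length < N then lap lam C₁ C₂ v y else 0 := by
    intro N y
    rw [hV, lap_sum]
    simp only [lap_const_mul, lap_pot hlam hlam' hC₁ hC₂]
    simp only [mul_ite, mul_neg, mul_one, neg_neg, mul_zero, Finset.sum_ite_eq]
    simp [F]
  -- The difference is harmonic on levels below `N`; from level `N` on its Laplacian is at most `D
  -- (λρ)^n ≤ D (ρ/γ)^N (λγ)^n`.
  have key : ∀ N y, |v y - V N y| ≤ D * (ρ / γ) ^ N / σ * (2 / (1 - lam)) * lam ^ y.length := by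
    intro N
    refine abs_le_of_lap_le (C₁ := C₁) (C₂ := C₂) (w := fun y => v y - V N y)
      (A := |u []| + B / (1 - ρ) + ∑ x ∈ F N, |lap lam C₁ C₂ v x| * potBound lam x)
      hlam hlam' hC₁ hC₂ hγ0 hγ1 (by positivity) (fun y => ?_) (fun y => ?_)
    · have e1 : |v y| ≤ (|u []| + B / (1 - ρ)) * lam ^ y.length := by
        rw [hv]
        simp only [abs_mul, abs_of_pos (pow_pos hlam y.length)]
        rw [mul_comm]
        exact mul_le_mul_of_nonneg_right (h.abs_le hρ.le hρ' y) (by positivity)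
      have e2 : |V N y| ≤ (∑ x ∈ F N, |lap lam C₁ C₂ v x| * potBound lam x) * lam ^ y.length := by
        rw [Finset.sum_mul]
        refine (Finset.abs_sum_le_sum_abs _ _).trans (Finset.sum_le_sum fun x _ => ?_)
        rw [abs_mul, abs_neg, abs_of_nonneg (pot_nonneg hlam hC₁ hC₂ x y), mul_assoc]
        exact mul_le_mul_of_nonneg_left (pot_le hlam hlam' hC₁ hC₂ x y) (abs_nonneg _)
      have := abs_sub (v y) (V N y)
      linarith
    · rw [lap_sub, hVlap, ← hσ, div_mul_cancel₀ _ hσ0.ne']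
      split_ifs with hy
      · simp only [sub_self, abs_zero]; positivity
      · rw [sub_zero]
        refine (hD y).trans ?_
        have e : lam * ρ = ρ / γ * (lam * γ) := by field_simp
        rw [e, mul_pow, mul_assoc]
        have : (ρ / γ) ^ y.length ≤ (ρ / γ) ^ N :=
          pow_le_pow_of_le_one (by positivity) hργ.le (not_lt.1 hy)
        gcongr
  refine exists_extension_of_uniform_limit fun ε hε => ?_
  have hlim : Tendsto (fun N : ℕ => D * (ρ / γ) ^ N / σ * (2 / (1 - lam))) atTop (𝓝 0) := by
    have := (((tendsto_pow_atTop_nhds_zero_of_lt_one (r := ρ / γ) (by positivity) hργ).const_mul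
      D).div_const σ).mul_const (2 / (1 - lam))
    simpa using this
  obtain ⟨N, hN⟩ := (hlim.eventually (gt_mem_nhds hε)).exists
  refine ⟨∑ x ∈ F N, (-lap lam C₁ C₂ v x) • κ x, fun y => ?_⟩
  have hp : 0 < lam ^ y.length := by positivity
  have e : (∑ x ∈ F N, (-lap lam C₁ C₂ v x) • κ x : C(MartinCompactification lam C₁ C₂, ℝ))
      (incl lam C₁ C₂ y) = V N y / lam ^ y.length := by
    rw [ContinuousMap.sum_apply]
    simp only [ContinuousMap.smul_apply, hκ, smul_eq_mul, hV, Finset.sum_div]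
    exact Finset.sum_congr rfl fun x _ => by ring
  have e' : V N y / lam ^ y.length - u y = -(v y - V N y) / lam ^ y.length := by
    simp only [hv]; field_simp; ring
  rw [e, e', abs_div, abs_neg, abs_of_pos hp, div_le_iff₀ hp]
  exact (key N y).trans (mul_le_mul_of_nonneg_right hN.le hp.le)

theorem HasFiniteEnergy.exists_extension (hlam : 0 < lam) (hlam' : lam < 1 / 3) (hC₁ : 0 < C₁)
    (hC₂ : 0 < C₂) {u : Word → ℝ} (hu : HasFiniteEnergy lam C₁ C₂ u) :
    ∃ g : C(MartinCompactification lam C₁ C₂, ℝ), ∀ y, g (incl lam C₁ C₂ y) = u y := by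
  obtain ⟨B, hB⟩ := hu.isHolder hlam hC₁ hC₂
  exact hB.exists_extension hlam hlam' hC₁ hC₂ (by positivity)
    (by rw [Real.sqrt_lt' one_pos]; linarith)

/-! ### Regularity of the Martin kernel by coupling -/

/-- A function of the distance of two coupled walkers that is a strict supersolution of the coupled
generator, in which both walkers move up at rate `3` and down at rate `3 * lam` together, while
their horizontal moves are independent. -/
theorem exists_barrier {Q c₀ : ℝ} (hlam : 0 < lam) (hlam' : lam < 1 / 3) (hQ : 0 ≤ Q)
    (hc₀ : 0 < c₀) :
    ∃ (ω : ℕ → ℝ) (κ : ℝ), 0 < κ ∧ κ < 1 ∧ ω 0 = 0 ∧ Monotone ω ∧ (∀ d, 1 ≤ d → 1 ≤ ω d) ∧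
      (∀ d d', 2 ≤ d → 2 * d' ≤ d + 1 →
        3 / κ * ω d' + 3 * lam * κ * ω (2 * d) + 2 * Q * (ω (d + 1) - ω d) ≤
          (3 + 3 * lam) * ω d) ∧
      3 / κ * ω 1 + 3 * lam * κ * ω 2 + 2 * Q * (ω 2 - ω 1) ≤ (3 + 3 * lam + c₀) * ω 1 := by
  -- With `X = B η^(d-1)`, halving the distance gains `3X(1 - η)` from the geometric part, and the
  -- remaining moves lose at most `(1 + 2Q)Xη`. This choice leaves a gain of exactly `2X`.
  set η : ℝ := 1 / (4 + 2 * Q) with hη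
  have hη0 : 0 < η := by positivity
  have hηQ : η * (4 + 2 * Q) = 1 := by rw [hη]; field_simp
  have hη1 : η ≤ 1 / 4 := by nlinarith
  -- The losses `3/2 + 2Q` are paid by the linear part, through `d/4`, once `d ≥ D`; for smaller `d`
  -- they are paid by the geometric part, as then `X ≥ B η^D = 2 + 2Q`.
  obtain ⟨D, hD⟩ := exists_nat_ge (6 + 8 * Q)
  set B : ℝ := (2 + 2 * Q) / η ^ D with hB
  have hB0 : 0 < B := by positivity
  have hBD : B * η ^ D = 2 + 2 * Q := by rw [hB]; field_simp
  -- The jump of `ω` at zero is at least `A - B`; half of `c₀ (A - B)` pays for all moves from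
  -- distance one to distance two.
  set A : ℝ := B + 2 * (1 + 2 * Q) * (1 + B) / c₀ with hA
  have hAB : c₀ * (A - B) = 2 * (1 + 2 * Q) * (1 + B) := by rw [hA]; field_simp; ring
  have hAB0 : B ≤ A := by rw [hA]; linarith [show 0 ≤ 2 * (1 + 2 * Q) * (1 + B) / c₀ by positivity]
  -- Here `δ = 3/κ - 3` is the price of the gain `κ` per level. The first bound keeps `δ ω d'` below
  -- `d/4`, the second costs only the other half of `c₀`.
  set δ : ℝ := min (1 / (4 * (A + 1))) (c₀ / 2) with hδ
  have hA1 : 0 < A + 1 := by linarith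
  have hδ0 : 0 < δ := by positivity
  have hδ1 : δ * (A + 1) ≤ 1 / 4 := by
    calc δ * (A + 1) ≤ 1 / (4 * (A + 1)) * (A + 1) := by gcongr; exact min_le_left _ _
      _ = 1 / 4 := by field_simp
  have hδ2 : δ ≤ c₀ / 2 := min_le_right _ _
  set κ : ℝ := 3 / (3 + δ) with hκ
  have hκ0 : 0 < κ := by positivity
  have hκ1 : κ < 1 := by rw [hκ, div_lt_one (by positivity)]; linarith
  have hκ3 : 3 / κ = 3 + δ := by rw [hκ]; field_simp
  set f : ℕ → ℝ := fun d => A - B * η ^ d + d with hf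
  have hηle : ∀ {m n : ℕ}, m ≤ n → η ^ n ≤ η ^ m := fun h =>
    pow_le_pow_of_le_one hη0.le (by linarith) h
  have hfmono : Monotone f := by
    intro m n h
    have h1 := mul_le_mul_of_nonneg_left (hηle h) hB0.le
    have h2 : (m : ℝ) ≤ n := by exact_mod_cast h
    simp only [hf]
    linarith
  have hf0 : 0 ≤ f 0 := by simp [hf]; linarith
  set ω : ℕ → ℝ := fun d => if d = 0 then 0 else f d with hω
  have hωf : ∀ d, ω d ≤ f d := fun d => by
    simp only [hω]; split_ifs with h
    · subst h; exact hf0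
    · exact le_rfl
  have hωe : ∀ d, d ≠ 0 → ω d = f d := fun d h => by simp [hω, h]
  refine ⟨ω, κ, hκ0, hκ1, by simp [hω], ?_, ?_, ?_, ?_⟩
  · intro m n h
    by_cases hm : m = 0
    · subst hm
      simp only [hω, if_true]
      split_ifs
      · exact le_rfl
      · exact hf0.trans (hfmono (Nat.zero_le n))
    · rw [hωe m hm, hωe n (by omega)]
      exact hfmono h
  · intro d hd
    rw [hωe d (by omega)]
    have h1 : B * η ^ d ≤ B * 1 := by
      gcongr; exact pow_le_one₀ hη0.le (by linarith)
    have h2 : (1 : ℝ) ≤ d := by exact_mod_cast hd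
    simp only [hf]
    linarith
  · intro d d' hd hd'
    rw [hωe d (by omega), hωe (2 * d) (by omega), hωe (d + 1) (by omega), hκ3]
    obtain ⟨e, rfl⟩ : ∃ e, d = e + 1 := ⟨d - 1, by omega⟩
    have hd2 : (2 : ℝ) ≤ (e : ℝ) + 1 := by exact_mod_cast hd
    have hd3 : 2 * (d' : ℝ) ≤ e + 1 + 1 := by exact_mod_cast hd'
    set X := B * η ^ e with hX
    have hX0 : 0 < X := by positivity
    have h1 : f d' - f (e + 1) ≤ (1 - (e + 1 : ℝ)) / 2 - X * (1 - η) := by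
      have : B * η ^ e ≤ B * η ^ d' := mul_le_mul_of_nonneg_left (hηle (by omega)) hB0.le
      simp only [hf, pow_succ]
      push_cast
      linarith
    have h2 : f (2 * (e + 1)) - f (e + 1) ≤ (e + 1) + X * η := by
      have : 0 < B * η ^ (2 * (e + 1)) := by positivity
      simp only [hf, pow_succ η e] at this ⊢
      push_cast
      linarith
    have h3 : f (e + 1 + 1) - f (e + 1) ≤ 1 + X * η := by
      have : 0 < B * η ^ (e + 1 + 1) := by positivity
      simp only [hf, pow_succ η e] at this ⊢
      push_cast
      linarith
    have h4 : f (e + 1) ≤ (A + 1) * (e + 1) := by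
      have : 0 < B * η ^ (e + 1) := by positivity
      have : A * 1 ≤ A * (e + 1) := by gcongr; linarith
      simp only [hf]
      push_cast
      linarith
    have h5 : 3 / 2 + 2 * Q ≤ (e + 1) / 4 + 2 * X := by
      by_cases h : D ≤ e + 1
      · have : (D : ℝ) ≤ e + 1 := by exact_mod_cast h
        linarith
      · have : B * η ^ D ≤ X := mul_le_mul_of_nonneg_left (hηle (by omega)) hB0.le
        linarith
    have h6 : ω d' ≤ f (e + 1) := (hωf d').trans (hfmono (by omega))
    have h7 : δ * ω d' ≤ (e + 1 : ℝ) / 4 := by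
      calc δ * ω d' ≤ δ * ((A + 1) * (e + 1)) := by gcongr; exact h6.trans h4
        _ = δ * (A + 1) * (e + 1) := by ring
        _ ≤ 1 / 4 * (e + 1) := by gcongr
        _ = _ := by ring
    have hf2 : 0 ≤ f (2 * (e + 1)) := hf0.trans (hfmono (Nat.zero_le _))
    have h8 : 3 * lam * κ * f (2 * (e + 1)) ≤ 3 * lam * f (2 * (e + 1)) := by
      refine mul_le_mul_of_nonneg_right ?_ hf2
      exact mul_le_of_le_one_right (by positivity) hκ1.le
    have h9 : 3 * lam * (f (2 * (e + 1)) - f (e + 1)) ≤ 3 * lam * ((e + 1) + X * η) := by gcongr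
    have h10 : 2 * Q * (f (e + 1 + 1) - f (e + 1)) ≤ 2 * Q * (1 + X * η) := by gcongr
    have h11 : 3 * lam * ((e + 1) + X * η) ≤ 1 * ((e + 1) + X * η) := by gcongr; linarith
    have h12 : X * η * (4 + 2 * Q) = X := by rw [mul_assoc, hηQ, mul_one]
    linarith [hωf d']
  · rw [hωe 1 one_ne_zero, hωe 2 two_ne_zero, hκ3]
    have hf1 : A - B ≤ f 1 := by
      have : B * η ≤ B * 1 := by gcongr; linarith
      simp only [hf, pow_one]; push_cast; linarith
    have h21 : f 2 - f 1 ≤ 1 + B := by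
      have : B * η ≤ B * 1 := by gcongr; linarith
      have : 0 < B * η ^ 2 := by positivity
      simp only [hf, pow_one]; push_cast; linarith
    have hf1' : 0 ≤ f 1 := by linarith
    have hf2 : 0 ≤ f 2 := hf1'.trans (hfmono (by norm_num))
    have h8 : 3 * lam * κ * f 2 ≤ 3 * lam * f 2 := by
      refine mul_le_mul_of_nonneg_right ?_ hf2
      exact mul_le_of_le_one_right (by positivity) hκ1.le
    have h9 : 3 * lam * (f 2 - f 1) ≤ 1 * (1 + B) := by
      have : 0 ≤ f 2 - f 1 := sub_nonneg.2 (hfmono (by norm_num))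
      gcongr; linarith
    have h10 : 2 * Q * (f 2 - f 1) ≤ 2 * Q * (1 + B) := by gcongr
    have h11 : c₀ * (A - B) ≤ c₀ * f 1 := by gcongr
    have h12 : δ * f 1 ≤ c₀ / 2 * f 1 := by gcongr
    linarith

/-- One horizontal step of one walker changes the distance by at most one. At distance one, a step
onto the other walker is available at rate at least `min C₁ C₂`, and it gains `ω 1`. -/
theorem sum_hrate_barrier_le (hlam : 0 < lam) (hC₁ : 0 < C₁) (hC₂ : 0 < C₂) {ω : ℕ → ℝ}
    (hω0 : ω 0 = 0) (hω : Monotone ω) {y y' : Word} (hl : y.length = y'.length) :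
    ∑ z ∈ lvl y.length, hrate lam C₁ C₂ y z * (ω (hd z y') - ω (hd y y')) ≤
      hbound C₁ C₂ * (ω (hd y y' + 1) - ω (hd y y')) -
        if hd y y' = 1 then min C₁ C₂ * ω 1 else 0 := by
  have hb : 0 ≤ ω (hd y y' + 1) - ω (hd y y') := sub_nonneg.2 (hω (Nat.le_succ _))
  have hz : ∀ z, IsHorizontal y z → ω (hd z y') - ω (hd y y') ≤
      ω (hd y y' + 1) - ω (hd y y') := by
    intro z hz
    have h1 := (isHorizontal_iff.1 hz).2.2
    have h2 := hd_triangle z y y'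
    rw [hd_comm z y] at h2
    exact sub_le_sub_right (hω (by omega)) _
  split_ifs with h1
  · have hω1 : 0 ≤ ω 1 := hω0 ▸ hω (Nat.zero_le 1)
    have hyy : IsHorizontal y y' :=
      isHorizontal_iff.2 ⟨hl, by rintro rfl; simp at h1, h1.le⟩
    -- Adding `ω 1` at `z = y'` removes the gain of the merging step, so that the uniform bound
    -- applies; the gain is then subtracted at its true rate.
    have h2 := sum_hrate_mul_le (F := fun z => ω (hd z y') - ω (hd y y') + if z = y' then ω 1 else 0)
      hlam hC₁ hC₂ hb (fun z hyz => by
        by_cases h : z = y'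
        · subst h
          simpa [h1, hω0] using hω (by norm_num : 1 ≤ 2)
        · simpa [h] using hz z hyz)
    simp only [mul_add, Finset.sum_add_distrib, mul_ite, mul_zero, Finset.sum_ite_eq', mem_lvl,
      hl, if_true] at h2 ⊢
    have h3 : min C₁ C₂ * ω 1 ≤ hrate lam C₁ C₂ y y' * ω 1 :=
      mul_le_mul_of_nonneg_right (min_le_hrate hlam hyy) hω1
    linarith
  · rw [sub_zero]
    exact sum_hrate_mul_le hlam hC₁ hC₂ hb hz

/-- The Green function varies little along levels. -/
theorem exists_pot_sub_le (hlam : 0 < lam) (hlam' : lam < 1 / 3) (hC₁ : 0 < C₁) (hC₂ : 0 < C₂)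
    (x : Word) : ∃ (ω : ℕ → ℝ) (κ : ℝ) (M : ℝ), 0 < κ ∧ κ < 1 ∧ Monotone ω ∧ 0 ≤ M ∧
      ∀ y y' : Word, y.length = y'.length → x.length ≤ y.length →
        pot lam C₁ C₂ x y - pot lam C₁ C₂ x y' ≤ M * (lam * κ) ^ y.length * ω (hd y y') := by
  obtain ⟨ω, κ, hκ0, hκ1, hω0, hω, hω1, hgen, hgen1⟩ := exists_barrier (Q := hbound C₁ C₂)
    (c₀ := min C₁ C₂) hlam hlam' (hbound_pos hC₁).le (by positivity)
  set g := pot lam C₁ C₂ x with hg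
  set μ := lam * κ with hμ
  have hμ0 : 0 < μ := by positivity
  have hp := potBound_pos hlam hlam' x
  -- On the level of the pole the barrier at positive distance is at least `M μ^|x| = potBound lam x
  -- * λ^|x|`, which dominates `g` there.
  set M := potBound lam x * lam ^ x.length / μ ^ x.length with hM
  have hM0 : 0 ≤ M := by positivity
  have hg0 := pot_nonneg (C₁ := C₁) (C₂ := C₂) hlam hC₁ hC₂ x
  have hgle := pot_le hlam hlam' hC₁ hC₂ x
  have hωn : ∀ d, 0 ≤ ω d := fun d => hω0 ▸ hω (Nat.zero_le d)
  refine ⟨ω, κ, M, hκ0, hκ1, hω, hM0, ?_⟩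
  set w : Word × Word → ℝ := fun p => g p.1 - g p.2 - M * μ ^ p.1.length * ω (hd p.1 p.2) with hw
  -- The value zero on pairs of unequal levels, or of levels less than `|x|`, makes the maximum
  -- principle applicable on all pairs.
  set v : Word × Word → ℝ := fun p =>
    if p.1.length = p.2.length ∧ x.length ≤ p.1.length then w p else 0 with hv
  have hvw : ∀ p : Word × Word, p.1.length = p.2.length → x.length ≤ p.1.length → v p = w p :=
    fun p h1 h2 => by simp only [hv, h1, true_and]; rw [if_pos (h1 ▸ h2)]
  suffices h : ∀ p, v p ≤ 0 by
    intro y y' h1 h2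
    have := h (y, y')
    rw [hvw (y, y') h1 h2] at this
    simp only [hw] at this
    linarith
  have hwle : ∀ p, w p ≤ potBound lam x * lam ^ p.1.length := fun p => by
    have : 0 ≤ M * μ ^ p.1.length * ω (hd p.1 p.2) := mul_nonneg (by positivity) (hωn _)
    simp only [hw]
    linarith [hg0 p.2, hgle p.1]
  refine nonpos_of_maximum (lev := fun p => p.1.length) ?_ ?_
  · intro ε hε
    have hlim : Tendsto (fun n : ℕ => potBound lam x * lam ^ n) atTop (𝓝 0) := by
      simpa using (tendsto_pow_atTop_nhds_zero_of_lt_one hlam.le (by linarith)).const_mul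
        (potBound lam x)
    obtain ⟨N, hN⟩ := eventually_atTop.1 (hlim.eventually (gt_mem_nhds hε))
    refine ((finite_length_lt N).prod (finite_length_lt N)).subset ?_
    rintro ⟨y, y'⟩ hp
    have hp' : ε ≤ v (y, y') := hp
    simp only [hv] at hp'
    split_ifs at hp' with h
    · have h3 : y.length < N := by
        by_contra h3
        have := hN y.length (not_lt.1 h3)
        have := hwle (y, y')
        simp only at this
        linarith
      exact ⟨h3, by simpa [← h.1] using h3⟩
    · linarith
  · rintro ⟨y, y'⟩ hpos hmax
    have hcond : y.length = y'.length ∧ x.length ≤ y.length := by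
      by_contra h
      simp only [hv, if_neg h] at hpos
      exact lt_irrefl _ hpos
    obtain ⟨hl, hxl⟩ := hcond
    have hvy := hvw (y, y') hl hxl
    have hne : y ≠ y' := by
      rintro rfl
      rw [hvy] at hpos
      simp [hw, hω0] at hpos
    have hd1 := hd_pos hl hne
    have hlt : x.length < y.length := by
      refine lt_of_le_of_ne hxl fun h => ?_
      rw [hvy] at hpos
      simp only [hw] at hpos
      have h1 : M * μ ^ y.length * 1 ≤ M * μ ^ y.length * ω (hd y y') := by
        gcongr; exact hω1 _ hd1
      have h2 : M * μ ^ y.length = potBound lam x * lam ^ y.length := by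
        rw [← h, hM]; field_simp
      linarith [hg0 y', hgle y]
    -- At a maximum no coupled move increases `w`. Harmonicity of `g` at both points and the
    -- generator inequality make the weighted sum of the increments non-negative, so the move to the
    -- pair of first sons loses nothing.
    refine ⟨(y ++ [0], y' ++ [0]), by simp, ?_⟩
    obtain ⟨s, k, rfl, hs⟩ := eq_concat_of_length (n := y.length - 1) (x := y) (by omega)
    obtain ⟨t, l, rfl, ht⟩ := eq_concat_of_length (n := s.length) (x := y')
      (by rw [← hl]; simp)
    set y := s ++ [k] with hy
    set y' := t ++ [l] with hy'
    have hyn : y.length = s.length + 1 := by simp [hy]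
    have hyn' : y'.length = s.length + 1 := by simp [hy', ht]
    set d := hd y y' with hdd
    set n := s.length with hn
    have hup : v (s, t) ≤ v (y, y') := hmax _
    rw [hvy, hvw (s, t) ht.symm (by simp only; omega)] at hup
    have hchild : ∀ i, v (y ++ [i], y' ++ [i]) ≤ v (y, y') := fun i => hmax _
    have hchild' : ∀ i, v (y ++ [i], y' ++ [i]) = w (y ++ [i], y' ++ [i]) := fun i =>
      hvw _ (by simp [hl]) (by simp; omega)
    simp only [hvy, hchild'] at hchild
    have hleft : ∀ z ∈ lvl y.length, w (z, y') ≤ w (y, y') := fun z hz => by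
      have := hmax (z, y')
      rwa [hvy, hvw (z, y') ((mem_lvl.1 hz).trans hl) (by simp only [mem_lvl.1 hz]; omega)] at this
    have hright : ∀ z ∈ lvl y'.length, w (y, z) ≤ w (y, y') := fun z hz => by
      have := hmax (y, z)
      rwa [hvy, hvw (y, z) (hl.trans (mem_lvl.1 hz).symm) hxl] at this
    rw [hvy, hchild']
    have hLg : lap lam C₁ C₂ g y = 0 := by
      rw [hg, lap_pot hlam hlam' hC₁ hC₂, if_neg (by rintro h; rw [← h] at hlt; omega)]
    have hLg' : lap lam C₁ C₂ g y' = 0 := by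
      rw [hg, lap_pot hlam hlam' hC₁ hC₂, if_neg (by rintro h; rw [← h] at hlt; omega)]
    have hys : y.dropLast = s := by simp [hy]
    have hys' : y'.dropLast = t := by simp [hy']
    rw [lap, hys] at hLg
    rw [lap, hys'] at hLg'
    have hHL : ∑ z ∈ lvl y.length, hrate lam C₁ C₂ y z * (g z - g y) -
        M * μ ^ (n + 1) *
          ∑ z ∈ lvl y.length, hrate lam C₁ C₂ y z * (ω (hd z y') - ω d) ≤ 0 := by
      rw [Finset.mul_sum, ← Finset.sum_sub_distrib]
      refine Finset.sum_nonpos fun z hz => ?_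
      have h := hleft z hz
      simp only [hw, mem_lvl.1 hz, hyn] at h
      have := mul_nonneg (hrate_nonneg hlam hC₁ hC₂ y z) (sub_nonneg.2 h)
      linarith
    have hHR : -∑ z ∈ lvl y'.length, hrate lam C₁ C₂ y' z * (g z - g y') -
        M * μ ^ (n + 1) *
          ∑ z ∈ lvl y'.length, hrate lam C₁ C₂ y' z * (ω (hd z y) - ω (hd y' y)) ≤ 0 := by
      rw [Finset.mul_sum, ← Finset.sum_neg_distrib, ← Finset.sum_sub_distrib]
      refine Finset.sum_nonpos fun z hz => ?_
      have h := hright z hz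
      simp only [hw, hyn, hd_comm y] at h
      have := mul_nonneg (hrate_nonneg hlam hC₁ hC₂ y' z) (sub_nonneg.2 h)
      linarith
    have hBL := sum_hrate_barrier_le hlam hC₁ hC₂ hω0 hω hl
    have hBR := sum_hrate_barrier_le hlam hC₁ hC₂ hω0 hω hl.symm
    rw [← hdd] at hBL
    rw [hd_comm y' y, ← hdd] at hBR hHR
    set HL := ∑ z ∈ lvl y.length, hrate lam C₁ C₂ y z * (ω (hd z y') - ω d)
    set HR := ∑ z ∈ lvl y'.length, hrate lam C₁ C₂ y' z * (ω (hd z y) - ω d)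
    have hm : 0 < min C₁ C₂ := by positivity
    have hgenerator : 3 / κ * ω (hd s t) + 3 * lam * κ * ω (2 * d) + (HL + HR) ≤
        (3 + 3 * lam) * ω d := by
      have h2 : 2 * hd s t ≤ d + 1 := two_mul_hd_le s t k l
      have hm1 : 0 ≤ min C₁ C₂ * ω 1 := mul_nonneg hm.le (hωn 1)
      by_cases hd2 : d = 1
      · rw [if_pos hd2, hd2] at hBL hBR
        rw [hd2]
        have : 3 / κ * ω (hd s t) ≤ 3 / κ * ω 1 := by
          gcongr; exact hω (by omega)
        norm_num at hBL hBR ⊢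
        linarith
      · have := hgen d (hd s t) (by omega) h2
        rw [if_neg hd2] at hBL hBR
        linarith
    have hgenerator' : 3 * lam * (μ ^ n * ω (hd s t)) + 3 * (μ ^ (n + 2) * ω (2 * d)) +
        μ ^ (n + 1) * (HL + HR) ≤ (3 + 3 * lam) * (μ ^ (n + 1) * ω d) := by
      have := mul_le_mul_of_nonneg_left hgenerator (show 0 ≤ μ ^ (n + 1) by positivity)
      -- Relative to `μ^(n+1)`, the rate `3λ` towards the fathers becomes `3λ/μ = 3/κ`, and the rate
      -- `3` towards the sons becomes `3μ = 3λκ`.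
      have e1 : 3 * lam * (μ ^ n * ω (hd s t)) = μ ^ (n + 1) * (3 / κ * ω (hd s t)) := by
        rw [pow_succ, hμ]; field_simp
      have e2 : 3 * (μ ^ (n + 2) * ω (2 * d)) = μ ^ (n + 1) * (3 * lam * κ * ω (2 * d)) := by
        rw [pow_succ μ (n + 1), hμ]; ring
      rw [e1, e2]
      linarith
    have hgM := mul_le_mul_of_nonneg_left hgenerator' hM0
    have hch : ∀ i, M * (μ ^ (n + 2) * ω (hd (y ++ [i]) (y' ++ [i]))) ≤
        M * (μ ^ (n + 2) * ω (2 * d)) := fun i => by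
      gcongr; exact hω (hd_concat_le _ _ _)
    have hup' := mul_nonneg (show 0 ≤ 3 * lam by positivity) (sub_nonneg.2 hup)
    rw [Fin.sum_univ_three] at hLg hLg'
    have hc0 := hch 0
    have hc1 := hch 1
    have hc2 := hch 2
    have hk1 := hchild 1
    have hk2 := hchild 2
    simp only [hw, List.length_append, List.length_singleton, hyn, ← hn, ← hdd] at hup' hk1 hk2 ⊢
    linarith

/-- Harmonicity at `y = t ++ [l]` says that the defect `λ g(t) - g(y)` is the mean of the defects `λ
g(y) - g(y ++ [k])` at the sons minus a third of the horizontal term. Iterating this, the horizontal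
terms form a geometric series and the remaining defect tends to zero. -/
theorem exists_pot_vertical_le (hlam : 0 < lam) (hlam' : lam < 1 / 3) (hC₁ : 0 < C₁) (hC₂ : 0 < C₂)
    (x : Word) {μ M : ℝ} (hμ : 0 < μ) (hμ' : μ < 1) (hM : 0 ≤ M)
    (h : ∀ y z, x.length ≤ y.length → IsHorizontal y z →
      |pot lam C₁ C₂ x z - pot lam C₁ C₂ x y| ≤ M * μ ^ y.length) (t : Word) (l : Fin 3)
    (ht : x.length ≤ t.length) :
    |lam * pot lam C₁ C₂ x t - pot lam C₁ C₂ x (t ++ [l])| ≤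
      hbound C₁ C₂ * M / (1 - μ) * μ ^ (t.length + 1) := by
  set g := pot lam C₁ C₂ x with hg
  have hp := potBound_pos hlam hlam' x
  have hQ := hbound_pos (C₂ := C₂) hC₁
  have h1 : 0 < 1 - μ := by linarith
  have hg0 := pot_nonneg (C₁ := C₁) (C₂ := C₂) hlam hC₁ hC₂ x
  have hgle := pot_le hlam hlam' hC₁ hC₂ x
  -- The first summand is the trivial bound for defects `j` levels further on; it vanishes as `j`
  -- grows.
  have key : ∀ (j : ℕ) (t : Word) (l : Fin 3), x.length ≤ t.length →
      |lam * g t - g (t ++ [l])| ≤ potBound lam x * lam ^ (t.length + 1 + j) +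
        hbound C₁ C₂ * M / (1 - μ) * μ ^ (t.length + 1) := by
    intro j
    induction j with
    | zero =>
      intro t l _
      have e1 := hgle (t ++ [l])
      have e2 : lam * g t ≤ lam * (potBound lam x * lam ^ t.length) := by gcongr; exact hgle t
      have e3 : 0 ≤ hbound C₁ C₂ * M / (1 - μ) * μ ^ (t.length + 1) := by positivity
      have e4 : 0 ≤ lam * g t := mul_nonneg hlam.le (hg0 t)
      have e5 := hg0 (t ++ [l])
      simp only [List.length_append, List.length_singleton, pow_succ, add_zero] at e1 e3 ⊢
      rw [abs_le]
      constructor <;> linarith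
    | succ j ih =>
      intro t l htl
      set y := t ++ [l] with hy
      have hyn : y.length = t.length + 1 := by simp [hy]
      have hLg : lap lam C₁ C₂ g y = 0 := by
        rw [hg, lap_pot hlam hlam' hC₁ hC₂, if_neg (by rintro h; rw [← h] at htl; omega)]
      have hH : |∑ z ∈ lvl y.length, hrate lam C₁ C₂ y z * (g z - g y)| ≤
          hbound C₁ C₂ * (M * μ ^ y.length) := by
        refine (Finset.abs_sum_le_sum_abs _ _).trans ?_
        simp only [abs_mul, abs_of_nonneg (hrate_nonneg hlam hC₁ hC₂ y _)]
        exact sum_hrate_mul_le (F := fun z => |g z - g y|) hlam hC₁ hC₂ (by positivity)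
          fun z hz => h y z (by omega) hz
      have hys : y.dropLast = t := by simp [hy]
      rw [lap, hys, Fin.sum_univ_three] at hLg
      have h0 := abs_le.1 (ih y 0 (by omega))
      have h1' := abs_le.1 (ih y 1 (by omega))
      have h2 := abs_le.1 (ih y 2 (by omega))
      have hH' := abs_le.1 hH
      have e1 : hbound C₁ C₂ * M / (1 - μ) * μ ^ (y.length + 1) + hbound C₁ C₂ * (M * μ ^ y.length)
          = hbound C₁ C₂ * M / (1 - μ) * μ ^ y.length := by
        field_simp; ring
      have e2 : 0 ≤ hbound C₁ C₂ * (M * μ ^ y.length) := by positivity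
      have e3 : t.length + 1 + (j + 1) = y.length + 1 + j := by omega
      rw [e3, ← hyn, abs_le]
      constructor <;> linarith
  have hlim : Tendsto (fun j : ℕ => potBound lam x * lam ^ (t.length + 1 + j) +
      hbound C₁ C₂ * M / (1 - μ) * μ ^ (t.length + 1)) atTop
      (𝓝 (0 + hbound C₁ C₂ * M / (1 - μ) * μ ^ (t.length + 1))) := by
    refine Tendsto.add_const _ ?_
    have h5 := (tendsto_pow_atTop_nhds_zero_of_lt_one hlam.le (by linarith : lam < 1)).const_mul
      (potBound lam x * lam ^ (t.length + 1))
    rw [mul_zero] at h5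
    refine h5.congr fun j => ?_
    rw [pow_add lam (t.length + 1) j]; ring
  rw [zero_add] at hlim
  exact ge_of_tendsto' hlim fun j => key j t l ht

/-- Hölder regularity of the Martin kernel. -/
theorem exists_kernel_isHolder (hlam : 0 < lam) (hlam' : lam < 1 / 3) (hC₁ : 0 < C₁) (hC₂ : 0 < C₂)
    (x : Word) : ∃ κ : ℝ, 0 < κ ∧ κ < 1 ∧
      (∃ B, IsHolder (fun y => pot lam C₁ C₂ x y / lam ^ y.length) B κ) ∧
      ∀ r : ℕ, ∃ M, ∀ y y' : Word, y.length = y'.length → hd y y' ≤ r →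
        |pot lam C₁ C₂ x y' / lam ^ y'.length - pot lam C₁ C₂ x y / lam ^ y.length| ≤
          M * κ ^ y.length := by
  obtain ⟨ω, κ, M, hκ0, hκ1, hω, hM0, hsub⟩ := exists_pot_sub_le hlam hlam' hC₁ hC₂ x
  have hp := potBound_pos hlam hlam' x
  have hQ := hbound_pos (C₂ := C₂) hC₁
  set g := pot lam C₁ C₂ x with hg
  have hg0 := pot_nonneg (C₁ := C₁) (C₂ := C₂) hlam hC₁ hC₂ x
  have hgle := pot_le hlam hlam' hC₁ hC₂ x
  have habs : ∀ r (y y' : Word), y.length = y'.length → hd y y' ≤ r → x.length ≤ y.length →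
      |g y' - g y| ≤ M * |ω r| * (lam * κ) ^ y.length := by
    intro r y y' hl hr hx
    have hωr : ω (hd y y') ≤ |ω r| := (hω hr).trans (le_abs_self _)
    have h1 := hsub y y' hl hx
    have h2 := hsub y' y hl.symm (hl ▸ hx)
    rw [hd_comm y' y, ← hl] at h2
    have h3 : M * (lam * κ) ^ y.length * ω (hd y y') ≤ M * (lam * κ) ^ y.length * |ω r| := by
      gcongr
    rw [abs_le]
    constructor <;> linarith
  have hU0 : ∀ y, 0 ≤ g y / lam ^ y.length := fun y => div_nonneg (hg0 y) (by positivity)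
  have hU1 : ∀ y, g y / lam ^ y.length ≤ potBound lam x := fun y => by
    rw [div_le_iff₀ (by positivity)]; exact hgle y
  -- Levels below the pole are absorbed by a constant, since the kernel takes values in `[0,
  -- potBound lam x]`.
  set P := potBound lam x / κ ^ x.length with hP
  have hP0 : 0 < P := by positivity
  have hlow : ∀ y y' : Word, y.length < x.length →
      |g y' / lam ^ y'.length - g y / lam ^ y.length| ≤ P * κ ^ y.length := by
    intro y y' hy
    have h1 : potBound lam x ≤ P * κ ^ y.length := by
      rw [hP, div_mul_eq_mul_div, le_div_iff₀ (by positivity)]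
      exact mul_le_mul_of_nonneg_left (pow_le_pow_of_le_one hκ0.le hκ1.le hy.le) hp.le
    rw [abs_le]
    constructor <;> linarith [hU0 y, hU0 y', hU1 y, hU1 y']
  have hlevel : ∀ r (y y' : Word), y.length = y'.length → hd y y' ≤ r →
      |g y' / lam ^ y'.length - g y / lam ^ y.length| ≤ (M * |ω r| + P) * κ ^ y.length := by
    intro r y y' hl hr
    have h2 : 0 ≤ P * κ ^ y.length := by positivity
    have h3 : 0 ≤ M * |ω r| * κ ^ y.length := by positivity
    rcases lt_or_ge y.length x.length with h | h
    · linarith [hlow y y' h]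
    · have h1 := habs r y y' hl hr h
      rw [← hl, ← sub_div, abs_div, abs_of_pos (pow_pos hlam y.length),
        div_le_iff₀ (by positivity)]
      refine h1.trans ?_
      rw [mul_pow]
      have : 0 ≤ P * κ ^ y.length * lam ^ y.length := by positivity
      linarith
  set M₁ := M * |ω 1| with hM₁
  have hM₁0 : 0 ≤ M₁ := by positivity
  have hμ1 : lam * κ < 1 := by nlinarith
  set T := hbound C₁ C₂ * M₁ / (1 - lam * κ) with hT
  have hμ2 : 0 < 1 - lam * κ := by linarith
  have hT0 : 0 ≤ T := by positivity
  refine ⟨κ, hκ0, hκ1, ⟨M₁ + P + T, fun y k => ?_, fun y z hyz => ?_⟩, fun r => ⟨_, hlevel r⟩⟩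
  · have hB : 0 ≤ (M₁ + P) * κ ^ y.length := by positivity
    have hB' : 0 ≤ (M₁ + T) * κ ^ y.length := by positivity
    rcases lt_or_ge y.length x.length with h | h
    · linarith [hlow y (y ++ [k]) h]
    · have h1 := exists_pot_vertical_le hlam hlam' hC₁ hC₂ x (mul_pos hlam hκ0) hμ1 hM₁0
        (fun y z hx hyz => habs 1 y z hyz.1 (isHorizontal_iff.1 hyz).2.2 hx) y k h
      have e : g (y ++ [k]) / lam ^ (y ++ [k]).length - g y / lam ^ y.length =
          -(lam * g y - g (y ++ [k])) / lam ^ (y.length + 1) := by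
        simp only [List.length_append, List.length_singleton, pow_succ]
        field_simp
        ring
      rw [e, abs_div, abs_neg, abs_of_pos (pow_pos hlam _), div_le_iff₀ (by positivity)]
      refine h1.trans ?_
      rw [← hT, mul_pow]
      have h2 : T * κ ^ (y.length + 1) ≤ T * κ ^ y.length :=
        mul_le_mul_of_nonneg_left (pow_le_pow_of_le_one hκ0.le hκ1.le (Nat.le_succ _)) hT0
      calc T * (lam ^ (y.length + 1) * κ ^ (y.length + 1))
          = T * κ ^ (y.length + 1) * lam ^ (y.length + 1) := by ring
        _ ≤ (M₁ + P + T) * κ ^ y.length * lam ^ (y.length + 1) := by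
          refine mul_le_mul_of_nonneg_right ?_ (by positivity)
          linarith
  · have h1 := hlevel 1 y z hyz.1 (isHorizontal_iff.1 hyz).2.2
    have : 0 ≤ T * κ ^ y.length := by positivity
    linarith

/-! ### Harmonic splines -/

/-- Values at the three corners of a cell (given by the reversed word): the `i`-th barycentric
coordinate at the corners of cells up to level `n`, and its harmonic continuation below. -/
def splineRev (n : ℕ) (i : Fin 3) : List (Fin 3) → Fin 3 → ℝ
  | [], j => if j = i then 1 else 0
  | k :: t, j =>
    if t.length < n then (splineRev n i t k + splineRev n i t j) / 2
    else if j = k then splineRev n i t k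
    else (splineRev n i t k + splineRev n i t j + ∑ l, splineRev n i t l) / 5

/-- The values of the `n`-th harmonic spline of the `i`-th barycentric coordinate at the corners
of a cell. -/
def spline (n : ℕ) (i : Fin 3) (w : Word) (j : Fin 3) : ℝ := splineRev n i w.reverse j

theorem spline_nil (n : ℕ) (i j : Fin 3) : spline n i [] j = if j = i then 1 else 0 := rfl

theorem spline_concat (n : ℕ) (i : Fin 3) (w : Word) (k j : Fin 3) :
    spline n i (w ++ [k]) j =
      if w.length < n then (spline n i w k + spline n i w j) / 2
      else if j = k then spline n i w k
      else (spline n i w k + spline n i w j + ∑ l, spline n i w l) / 5 := by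
  simp [spline, splineRev]

/-- Both the midpoint rule and the harmonic rule, with weights `2/5, 2/5, 1/5`, are convex
combinations. -/
theorem spline_mem_Icc {n : ℕ} {i : Fin 3} {w : Word} {a b : ℝ}
    (h : ∀ j, spline n i w j ∈ Icc a b) (s : Word) (j : Fin 3) :
    spline n i (w ++ s) j ∈ Icc a b := by
  induction s generalizing w j with
  | nil => simpa using h j
  | cons k s ih =>
    have e : w ++ k :: s = (w ++ [k]) ++ s := by simp
    rw [e]
    refine ih (fun j => ?_) j
    have hk := h k
    have hj := h j
    have h0 := h 0
    have h1 := h 1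
    have h2 := h 2
    simp only [mem_Icc] at *
    rw [spline_concat, Fin.sum_univ_three]
    split_ifs
    · constructor <;> linarith
    · exact hk
    · constructor <;> linarith

theorem spline_eq_of_le {n : ℕ} {i : Fin 3} {w : Word} (hw : w.length ≤ n) (j : Fin 3) :
    2 ^ w.length * spline n i w j = coord i w + if j = i then 1 else 0 := by
  obtain ⟨m, hm⟩ : ∃ m, w.length = m := ⟨_, rfl⟩
  induction m generalizing w j with
  | zero =>
    rw [List.length_eq_zero_iff] at hm
    subst hm
    simp [spline_nil]
  | succ m ih =>
    obtain ⟨t, k, rfl, ht⟩ := eq_concat_of_length hm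
    have h1 := ih (w := t) (by omega) k ht
    have h2 := ih (w := t) (by omega) j ht
    rw [spline_concat, if_pos (by omega), coord_concat, hm, pow_succ, ← ht]
    push_cast
    linarith

/-- Splines are well defined at points of the gasket. A corner of a cell is either a corner of the
father's cell, which allows induction, or the midpoint of an edge of it. In the latter case parities
show that the fathers agree and that the edge is the same, and both rules are symmetric in its end
points. -/
theorem spline_eq_of_common_corner {n : ℕ} {i : Fin 3} {x y : Word} (hl : x.length = y.length)
    {a b : Fin 3}
    (h : ∀ m, coord m x + (if a = m then 1 else 0) = coord m y + (if b = m then 1 else 0)) :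
    spline n i x a = spline n i y b := by
  obtain ⟨m, hm⟩ : ∃ m, x.length = m := ⟨_, rfl⟩
  induction m generalizing x y a b with
  | zero =>
    rw [hm] at hl
    rw [List.length_eq_zero_iff] at hm
    have hy := List.length_eq_zero_iff.1 hl.symm
    subst hm hy
    have := h a
    simp only [coord_nil, if_true, zero_add] at this
    have hab : b = a := by by_contra hne; simp [hne] at this
    rw [hab]
  | succ m ih =>
    obtain ⟨s, k, rfl, hs⟩ := eq_concat_of_length hm
    obtain ⟨t, l, rfl, ht⟩ := eq_concat_of_length (hl.symm.trans hm)
    simp only [coord_concat] at h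
    have hself : ∀ (w : Word) k, spline n i (w ++ [k]) k = spline n i w k := fun w k => by
      rw [spline_concat, if_pos rfl]; split_ifs <;> ring
    by_cases hka : k = a
    · have hlb : l = b := by
        by_contra hne
        have := h l
        rw [← hka, if_neg (Ne.symm hne), if_pos rfl] at this
        split_ifs at this <;> omega
      subst hka hlb
      rw [hself, hself]
      exact ih (hs.trans ht.symm) (fun m => by have := h m; split_ifs at this ⊢ <;> omega) hs
    · have hlb : l ≠ b := by
        rintro rfl
        have := h k
        rw [if_pos rfl, if_neg (Ne.symm hka)] at this
        split_ifs at this <;> omega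
      -- The coordinates modulo two at the common corner mark the edge `{k, a}` on one side and `{l,
      -- b}` on the other.
      have hset : (k = l ∧ a = b) ∨ (k = b ∧ a = l) := by
        have h1 := h k
        have h2 := h a
        rw [if_pos rfl, if_neg (Ne.symm hka)] at h1
        rw [if_pos rfl, if_neg hka] at h2
        by_cases hkl : k = l
        · left
          refine ⟨hkl, ?_⟩
          subst hkl
          rw [if_neg hka] at h2
          by_contra hne
          rw [if_neg (Ne.symm hne)] at h2
          omega
        · right
          rw [if_neg (Ne.symm hkl)] at h1
          have hkb : k = b := by
            by_contra hne
            rw [if_neg (Ne.symm hne)] at h1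
            omega
          refine ⟨hkb, ?_⟩
          subst hkb
          rw [if_neg hka] at h2
          by_contra hne
          rw [if_neg (Ne.symm hne)] at h2
          omega
      have hst : s = t := by
        refine coord_injective (hs.trans ht.symm) fun m => ?_
        have := h m
        rcases hset with ⟨rfl, rfl⟩ | ⟨rfl, rfl⟩ <;> omega
      subst hst
      rcases hset with ⟨rfl, rfl⟩ | ⟨rfl, rfl⟩
      · rfl
      · rw [spline_concat, spline_concat, if_neg (Ne.symm hka), if_neg hka]
        split_ifs <;> ring

/-! ### Energy of the splines -/

/-- The energy of a spline on one cell. -/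
def cellEnergy (n : ℕ) (i : Fin 3) (w : Word) : ℝ :=
  (spline n i w 0 - spline n i w 1) ^ 2 + (spline n i w 1 - spline n i w 2) ^ 2 +
    (spline n i w 2 - spline n i w 0) ^ 2

theorem cellEnergy_nonneg (n : ℕ) (i : Fin 3) (w : Word) : 0 ≤ cellEnergy n i w := by
  unfold cellEnergy; positivity

theorem sq_sub_le_cellEnergy (n : ℕ) (i : Fin 3) (w : Word) (a b : Fin 3) :
    (spline n i w a - spline n i w b) ^ 2 ≤ cellEnergy n i w := by
  have h0 := sq_nonneg (spline n i w 0 - spline n i w 1)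
  have h1 := sq_nonneg (spline n i w 1 - spline n i w 2)
  have h2 := sq_nonneg (spline n i w 2 - spline n i w 0)
  unfold cellEnergy
  fin_cases a <;> fin_cases b <;> simp <;> linarith

/-- Linear interpolation multiplies the energy by `3/4` per level, harmonic continuation by the
smaller factor `3/5`. -/
theorem sum_cellEnergy (n : ℕ) (i : Fin 3) (w : Word) :
    ∑ k, cellEnergy n i (w ++ [k]) = (if w.length < n then 3 / 4 else 3 / 5) * cellEnergy n i w := by
  simp only [cellEnergy, spline_concat, Fin.sum_univ_three]
  by_cases h : w.length < n <;> simp [h] <;> ring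

/-- The root has energy `2`, and each of the first `n` levels costs `3/4 = 5/4 * (3/5)`. -/
theorem sum_lvl_cellEnergy_le (n : ℕ) (i : Fin 3) (m : ℕ) :
    ∑ w ∈ lvl m, cellEnergy n i w ≤ 2 * (5 / 4) ^ n * (3 / 5) ^ m := by
  suffices h : ∑ w ∈ lvl m, cellEnergy n i w ≤ 2 * (5 / 4) ^ (min m n) * (3 / 5) ^ m by
    refine h.trans ?_
    gcongr
    · norm_num
    · exact min_le_right _ _
  induction m with
  | zero =>
    have : lvl 0 = {[]} := by ext w; simp [List.length_eq_zero_iff]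
    rw [this]
    fin_cases i <;> simp [cellEnergy, spline_nil] <;> norm_num
  | succ m ih =>
    rw [sum_lvl_succ]
    simp only [sum_cellEnergy]
    have e : ∑ w ∈ lvl m, (if w.length < n then 3 / 4 else 3 / 5) * cellEnergy n i w =
        (if m < n then 3 / 4 else 3 / 5) * ∑ w ∈ lvl m, cellEnergy n i w := by
      rw [Finset.mul_sum]
      exact Finset.sum_congr rfl fun w hw => by rw [mem_lvl.1 hw]
    rw [e]
    split_ifs with h
    · rw [min_eq_left h.le] at ih
      rw [min_eq_left (by omega), pow_succ, pow_succ]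
      linarith
    · rw [min_eq_right (by omega)] at ih ⊢
      rw [pow_succ (3 / 5 : ℝ)]
      linarith

/-- The value at a son is a convex combination of values on the father's cell. Horizontal neighbours
share a corner, through which their values are compared. -/
theorem sq_spline_sub_le (n : ℕ) (i : Fin 3) {x y : Word} (h : IsVertical x y ∨ IsHorizontal x y) :
    (spline n i x 0 - spline n i y 0) ^ 2 ≤ 2 * (cellEnergy n i x + cellEnergy n i y) := by
  have hv : ∀ (t : Word) k,
      (spline n i t 0 - spline n i (t ++ [k]) 0) ^ 2 ≤ cellEnergy n i t := by
    intro t k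
    rw [spline_concat, Fin.sum_univ_three]
    unfold cellEnergy
    have h0 := sq_nonneg (spline n i t 0 - spline n i t 1)
    have h1 := sq_nonneg (spline n i t 1 - spline n i t 2)
    have h2 := sq_nonneg (spline n i t 2 - spline n i t 0)
    split_ifs with h3 h4
    · fin_cases k <;> simp <;> nlinarith
    · rw [← h4, sub_self, zero_pow two_ne_zero]; linarith
    · fin_cases k <;> simp at h4 ⊢ <;> nlinarith
  have hx := cellEnergy_nonneg n i x
  have hy := cellEnergy_nonneg n i y
  rcases h with (⟨hne, rfl⟩ | ⟨hne, rfl⟩) | h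
  · obtain ⟨t, k, rfl⟩ := (List.eq_nil_or_concat x).resolve_left hne
    simp only [List.concat_eq_append, List.dropLast_concat] at *
    have := hv t k
    rw [← neg_sq, neg_sub] at this
    linarith
  · obtain ⟨t, k, rfl⟩ := (List.eq_nil_or_concat y).resolve_left hne
    simp only [List.concat_eq_append, List.dropLast_concat] at *
    linarith [hv t k]
  · obtain ⟨hl, -, hd1⟩ := isHorizontal_iff.1 h
    obtain ⟨a, b, hab⟩ := exists_common_corner hl hd1
    have e := spline_eq_of_common_corner (n := n) (i := i) hl hab
    have h1 := sq_sub_le_cellEnergy n i x 0 a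
    have h2 := sq_sub_le_cellEnergy n i y b 0
    rw [e] at h1
    nlinarith [sq_nonneg ((spline n i x 0 - spline n i y b) - (spline n i y b - spline n i y 0))]

/-- Summing over one end point produces the total conductance at the other; the second summand
follows by symmetry. -/
theorem summable_conductance_mul_add (hlam : 0 < lam) (hC₁ : 0 < C₁) (hC₂ : 0 < C₂) {e : Word → ℝ}
    (he : ∀ x, 0 ≤ e x) (hS : Summable fun x => totalCond lam C₁ C₂ x * e x) :
    Summable fun p : Word × Word => conductance lam C₁ C₂ p.1 p.2 * (e p.1 + e p.2) := by
  have hc := conductance_nonneg (C₁ := C₁) (C₂ := C₂) hlam hC₁ hC₂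
  have hrow : ∀ x, HasSum (fun y => conductance lam C₁ C₂ x y * e x) (totalCond lam C₁ C₂ x * e x) :=
    fun x => (hasSum_conductance hlam x).mul_right (e x)
  have h1 : Summable fun p : Word × Word => conductance lam C₁ C₂ p.1 p.2 * e p.1 := by
    refine (summable_prod_of_nonneg fun p => mul_nonneg (hc _ _) (he _)).2
      ⟨fun x => (hrow x).summable, hS.congr fun x => ?_⟩
    exact (hrow x).tsum_eq.symm
  have h2 : Summable fun p : Word × Word => conductance lam C₁ C₂ p.1 p.2 * e p.2 := by
    rw [← (Equiv.prodComm Word Word).summable_iff]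
    refine h1.congr fun p => ?_
    simp [conductance_symm p.1 p.2]
  exact (h1.add h2).congr fun p => (mul_add _ _ _).symm

/-- Harmonic splines have finite energy. -/
theorem hasFiniteEnergy_spline (hlam : 1 / 5 < lam) (hC₁ : 0 < C₁) (hC₂ : 0 < C₂)
    (n : ℕ) (i : Fin 3) : HasFiniteEnergy lam C₁ C₂ fun w => spline n i w 0 := by
  have hlam0 : 0 < lam := by linarith
  have hQ := hbound_pos (C₂ := C₂) hC₁
  have hc := conductance_nonneg (C₁ := C₁) (C₂ := C₂) hlam0 hC₁ hC₂
  have hE := cellEnergy_nonneg n i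
  have hS : Summable fun x => totalCond lam C₁ C₂ x * cellEnergy n i x := by
    -- This is where `λ > 1/5` enters. Linear interpolation on all levels would give the ratio
    -- `(3λ)⁻¹ * (3/4)` and require `λ > 1/4`.
    have hr : (3 * lam)⁻¹ * (3 / 5) < 1 := by
      rw [inv_mul_lt_iff₀ (by positivity)]; linarith
    refine summable_of_lvl (fun x => mul_nonneg (totalCond_pos hlam0 hC₁ hC₂ x).le (hE x))
      ((summable_geometric_of_lt_one (by positivity) hr).mul_left
        ((3 * lam + 3 + hbound C₁ C₂) * (2 * (5 / 4) ^ n))) fun m => ?_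
    calc ∑ x ∈ lvl m, totalCond lam C₁ C₂ x * cellEnergy n i x
        ≤ ∑ x ∈ lvl m, (((3 * lam) ^ m)⁻¹ * (3 * lam + 3 + hbound C₁ C₂)) * cellEnergy n i x := by
          refine Finset.sum_le_sum fun x hx => mul_le_mul_of_nonneg_right ?_ (hE x)
          rw [totalCond, mem_lvl.1 hx]
          exact mul_le_mul_of_nonneg_left (netSum_one_le hlam0 hC₁ x) (by positivity)
      _ ≤ (((3 * lam) ^ m)⁻¹ * (3 * lam + 3 + hbound C₁ C₂)) *
            (2 * (5 / 4) ^ n * (3 / 5) ^ m) := by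
          rw [← Finset.mul_sum]
          exact mul_le_mul_of_nonneg_left (sum_lvl_cellEnergy_le n i m) (by positivity)
      _ = _ := by rw [mul_pow (3 * lam)⁻¹, inv_pow]; ring
  refine Summable.of_nonneg_of_le (fun p => mul_nonneg (hc _ _) (sq_nonneg _)) (fun p => ?_)
    ((summable_conductance_mul_add hlam0 hC₁ hC₂ hE hS).mul_left 2)
  by_cases h : IsVertical p.1 p.2 ∨ IsHorizontal p.1 p.2
  · have := mul_le_mul_of_nonneg_left (sq_spline_sub_le n i h) (hc p.1 p.2)
    linarith
  · push Not at h
    simp [conductance, h.1, h.2]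

/-- The value of a spline below a cell determines the cell up to bounded distance. -/
theorem spline_append_mem_Icc (n : ℕ) (i : Fin 3) {v : Word} (hv : v.length = n) (s : Word) :
    2 ^ n * spline n i (v ++ s) 0 ∈ Icc (coord i v : ℝ) (coord i v + 1) := by
  have h2 : (0 : ℝ) < 2 ^ n := by positivity
  have h := spline_mem_Icc (n := n) (i := i) (w := v) (a := coord i v / 2 ^ n)
    (b := (coord i v + 1) / 2 ^ n) (fun j => ?_) s 0
  · rw [mem_Icc, div_le_iff₀ h2, le_div_iff₀ h2] at h
    rw [mem_Icc]
    constructor <;> linarith [h.1, h.2]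
  · have := spline_eq_of_le (n := n) (i := i) hv.le j
    rw [hv] at this
    rw [mem_Icc, div_le_iff₀ h2, le_div_iff₀ h2, mul_comm _ (2 ^ n : ℝ), this]
    split_ifs <;> constructor <;> linarith

/-! ### Functions of finite energy -/

theorem HasFiniteEnergy.of_sq_le (hlam : 0 < lam) (hC₁ : 0 < C₁) (hC₂ : 0 < C₂) {u v : Word → ℝ}
    (hu : HasFiniteEnergy lam C₁ C₂ u) (h : ∀ x y, (v x - v y) ^ 2 ≤ (u x - u y) ^ 2) :
    HasFiniteEnergy lam C₁ C₂ v :=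
  Summable.of_nonneg_of_le
    (fun _ => mul_nonneg (conductance_nonneg hlam hC₁ hC₂ _ _) (sq_nonneg _))
    (fun p => mul_le_mul_of_nonneg_left (h p.1 p.2) (conductance_nonneg hlam hC₁ hC₂ _ _)) hu

theorem HasFiniteEnergy.of_sq_le_add (hlam : 0 < lam) (hC₁ : 0 < C₁) (hC₂ : 0 < C₂)
    {u v w : Word → ℝ} (hu : HasFiniteEnergy lam C₁ C₂ u) (hv : HasFiniteEnergy lam C₁ C₂ v) {a b : ℝ}
    (h : ∀ x y, (w x - w y) ^ 2 ≤ a * (u x - u y) ^ 2 + b * (v x - v y) ^ 2) :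
    HasFiniteEnergy lam C₁ C₂ w := by
  refine Summable.of_nonneg_of_le
    (fun _ => mul_nonneg (conductance_nonneg hlam hC₁ hC₂ _ _) (sq_nonneg _)) (fun p => ?_)
    ((Summable.mul_left a hu).add (Summable.mul_left b hv))
  have := mul_le_mul_of_nonneg_left (h p.1 p.2)
    (conductance_nonneg (lam := lam) (C₁ := C₁) (C₂ := C₂) hlam hC₁ hC₂ p.1 p.2)
  linarith

theorem HasFiniteEnergy.add (hlam : 0 < lam) (hC₁ : 0 < C₁) (hC₂ : 0 < C₂) {u v : Word → ℝ}
    (hu : HasFiniteEnergy lam C₁ C₂ u) (hv : HasFiniteEnergy lam C₁ C₂ v) :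
    HasFiniteEnergy lam C₁ C₂ fun x => u x + v x :=
  hu.of_sq_le_add hlam hC₁ hC₂ hv (a := 2) (b := 2) fun x y => by
    nlinarith [sq_nonneg ((u x - u y) - (v x - v y))]

theorem HasFiniteEnergy.sub (hlam : 0 < lam) (hC₁ : 0 < C₁) (hC₂ : 0 < C₂) {u v : Word → ℝ}
    (hu : HasFiniteEnergy lam C₁ C₂ u) (hv : HasFiniteEnergy lam C₁ C₂ v) :
    HasFiniteEnergy lam C₁ C₂ fun x => u x - v x :=
  hu.of_sq_le_add hlam hC₁ hC₂ hv (a := 2) (b := 2) fun x y => by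
    nlinarith [sq_nonneg ((u x - u y) + (v x - v y))]

theorem HasFiniteEnergy.const_mul {u : Word → ℝ} (hu : HasFiniteEnergy lam C₁ C₂ u) (a : ℝ) :
    HasFiniteEnergy lam C₁ C₂ fun x => a * u x :=
  (Summable.mul_left (a ^ 2) hu).congr fun p => by ring

theorem hasFiniteEnergy_const (a : ℝ) : HasFiniteEnergy lam C₁ C₂ fun _ => a := by
  simp [HasFiniteEnergy, summable_zero]

theorem HasFiniteEnergy.summable_mul (hlam : 0 < lam) (hC₁ : 0 < C₁) (hC₂ : 0 < C₂) {u v : Word → ℝ}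
    (hu : HasFiniteEnergy lam C₁ C₂ u) (hv : HasFiniteEnergy lam C₁ C₂ v) :
    Summable fun p : Word × Word =>
      conductance lam C₁ C₂ p.1 p.2 * (u p.1 - u p.2) * (v p.1 - v p.2) := by
  refine Summable.of_norm_bounded (Summable.add hu hv) fun p => ?_
  have hc := conductance_nonneg (lam := lam) (C₁ := C₁) (C₂ := C₂) hlam hC₁ hC₂ p.1 p.2
  rw [Real.norm_eq_abs, mul_assoc, abs_mul, abs_of_nonneg hc, ← mul_add]
  refine mul_le_mul_of_nonneg_left (abs_le.2 ⟨?_, ?_⟩) hc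
  · nlinarith [sq_nonneg ((u p.1 - u p.2) + (v p.1 - v p.2)), sq_nonneg (u p.1 - u p.2),
      sq_nonneg (v p.1 - v p.2)]
  · nlinarith [sq_nonneg ((u p.1 - u p.2) - (v p.1 - v p.2)), sq_nonneg (u p.1 - u p.2),
      sq_nonneg (v p.1 - v p.2)]

theorem hasFiniteEnergy_single (hlam : 0 < lam) (hC₁ : 0 < C₁) (hC₂ : 0 < C₂) (x : Word) :
    HasFiniteEnergy lam C₁ C₂ fun y => if y = x then 1 else 0 := by
  have he : ∀ y : Word, (0 : ℝ) ≤ if y = x then 1 else 0 := fun y => by split_ifs <;> norm_num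
  refine Summable.of_nonneg_of_le
    (fun _ => mul_nonneg (conductance_nonneg hlam hC₁ hC₂ _ _) (sq_nonneg _)) (fun p => ?_)
    (summable_conductance_mul_add (e := fun y => if y = x then 1 else 0) hlam hC₁ hC₂ he
      (summable_of_ne_finset_zero (s := {x}) fun y hy => by
        simp only [Finset.mem_singleton] at hy; simp [hy]))
  refine mul_le_mul_of_nonneg_left ?_ (conductance_nonneg hlam hC₁ hC₂ _ _)
  by_cases h1 : p.1 = x <;> by_cases h2 : p.2 = x <;> simp [h1, h2]

/-! ### Uniform density -/

/-- The algebra of continuous functions of finite energy on the Martin compactification. -/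
def energyAlgebra (hlam : 0 < lam) (hC₁ : 0 < C₁) (hC₂ : 0 < C₂) :
    Subalgebra ℝ C(MartinCompactification lam C₁ C₂, ℝ) where
  carrier := {u | HasFiniteEnergy lam C₁ C₂ fun x => u (incl lam C₁ C₂ x)}
  add_mem' := by
    intro u v hu hv
    exact HasFiniteEnergy.add (u := fun x => u (incl lam C₁ C₂ x))
      (v := fun x => v (incl lam C₁ C₂ x)) hlam hC₁ hC₂ hu hv
  algebraMap_mem' a := hasFiniteEnergy_const a
  mul_mem' := by
    intro u v hu hv
    refine HasFiniteEnergy.of_sq_le_add (u := fun x => u (incl lam C₁ C₂ x))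
      (v := fun x => v (incl lam C₁ C₂ x)) (w := fun x => u (incl lam C₁ C₂ x) * v (incl lam C₁ C₂ x)) hlam hC₁ hC₂ hu hv
      (a := 2 * ‖v‖ ^ 2) (b := 2 * ‖u‖ ^ 2) fun x y => ?_
    have h1 : (u (incl lam C₁ C₂ y)) ^ 2 ≤ ‖u‖ ^ 2 := sq_le_sq' (by
      linarith [neg_abs_le (u (incl lam C₁ C₂ y)), u.norm_coe_le_norm (incl lam C₁ C₂ y),
        Real.norm_eq_abs (u (incl lam C₁ C₂ y))])
      ((le_abs_self _).trans (u.norm_coe_le_norm (incl lam C₁ C₂ y)))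
    have h2 : (v (incl lam C₁ C₂ x)) ^ 2 ≤ ‖v‖ ^ 2 := sq_le_sq' (by
      linarith [neg_abs_le (v (incl lam C₁ C₂ x)), v.norm_coe_le_norm (incl lam C₁ C₂ x),
        Real.norm_eq_abs (v (incl lam C₁ C₂ x))])
      ((le_abs_self _).trans (v.norm_coe_le_norm (incl lam C₁ C₂ x)))
    set a := u (incl lam C₁ C₂ x)
    set a' := u (incl lam C₁ C₂ y)
    set b := v (incl lam C₁ C₂ x)
    set b' := v (incl lam C₁ C₂ y)
    have h3 := mul_le_mul_of_nonneg_right h1 (sq_nonneg (b - b'))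
    have h4 := mul_le_mul_of_nonneg_right h2 (sq_nonneg (a - a'))
    -- The discrete product rule: bounded functions of finite energy form an algebra.
    have e : a * b - a' * b' = b * (a - a') + a' * (b - b') := by ring
    rw [e]
    nlinarith [sq_nonneg (b * (a - a') - a' * (b - b'))]

theorem mem_energyAlgebra {hlam : 0 < lam} {hC₁ : 0 < C₁} {hC₂ : 0 < C₂}
    {u : C(MartinCompactification lam C₁ C₂, ℝ)} : u ∈ energyAlgebra hlam hC₁ hC₂ ↔
      HasFiniteEnergy lam C₁ C₂ fun x => u (incl lam C₁ C₂ x) := Iff.rfl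

/-- A closed condition that holds at all vertices but one holds off this vertex. -/
theorem of_forall_incl_ne {x : Word} {s : Set (MartinCompactification lam C₁ C₂)} (hs : IsClosed s)
    (h : ∀ y, y ≠ x → incl lam C₁ C₂ y ∈ s) {z : MartinCompactification lam C₁ C₂}
    (hz : z ≠ incl lam C₁ C₂ x) : z ∈ s := by
  have h1 : z ∈ s ∪ {incl lam C₁ C₂ x} := by
    refine denseRange_incl.induction_on (p := fun z => z ∈ s ∪ {incl lam C₁ C₂ x}) z
      (hs.union isClosed_singleton) fun y => ?_
    by_cases hy : y = x
    · right; rw [hy]; rfl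
    · left; exact h y hy
  exact h1.resolve_right hz

/-- Each boundary point is approached by vertices of arbitrarily high level, since the finitely many
vertices of low level form a closed set. -/
theorem exists_incl_mem {z : MartinCompactification lam C₁ C₂} (hz : z ∉ range (incl lam C₁ C₂))
    {O : Set (MartinCompactification lam C₁ C₂)} (hO : O ∈ 𝓝 z) (n : ℕ) :
    ∃ y : Word, n ≤ y.length ∧ incl lam C₁ C₂ y ∈ O := by
  have hF : IsClosed (incl lam C₁ C₂ '' {w | w.length < n}) :=
    ((finite_length_lt n).image _).isClosed
  have hmem : O ∩ (incl lam C₁ C₂ '' {w | w.length < n})ᶜ ∈ 𝓝 z :=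
    inter_mem hO (hF.isOpen_compl.mem_nhds fun ⟨w, _, hw⟩ => hz ⟨w, hw⟩)
  obtain ⟨_, ⟨h1, h2⟩, y, rfl⟩ := mem_closure_iff_nhds.1 (denseRange_incl z) _ hmem
  exact ⟨y, not_lt.1 fun h => h2 ⟨y, h, rfl⟩, h1⟩

/-- Boundary points with the same position in the gasket (as seen by the splines) are not
distinguished by the Martin kernels. -/
theorem kernel_eq_of_spline_eq (hlam : 0 < lam) (hlam' : lam < 1 / 3) (hC₁ : 0 < C₁) (hC₂ : 0 < C₂)
    {z z' : MartinCompactification lam C₁ C₂} (hz : z ∉ range (incl lam C₁ C₂))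
    (hz' : z' ∉ range (incl lam C₁ C₂)) (S : ℕ → Fin 3 → C(MartinCompactification lam C₁ C₂, ℝ))
    (hS : ∀ n i y, S n i (incl lam C₁ C₂ y) = spline n i y 0) (h : ∀ n i, S n i z = S n i z')
    (x : Word) {g : C(MartinCompactification lam C₁ C₂, ℝ)}
    (hg : ∀ y, g (incl lam C₁ C₂ y) = pot lam C₁ C₂ x y / lam ^ y.length) : g z = g z' := by
  obtain ⟨κ, hκ0, hκ1, ⟨B, hB⟩, hM⟩ := exists_kernel_isHolder hlam hlam' hC₁ hC₂ x
  obtain ⟨M, hM⟩ := hM 1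
  have h1κ : 0 < 1 - κ := by linarith
  have hlim : Tendsto (fun n : ℕ => (2 * B / (1 - κ) + M) * κ ^ n) atTop (𝓝 0) := by
    simpa using (tendsto_pow_atTop_nhds_zero_of_lt_one hκ0.le hκ1).const_mul (2 * B / (1 - κ) + M)
  refine eq_of_forall_dist_le fun ε hε => ?_
  rw [Real.dist_eq]
  obtain ⟨n, hn⟩ := (hlim.eventually (gt_mem_nhds (show 0 < ε / 3 by positivity))).exists
  -- Half of `2^(-n)` on each side puts the spline values at `y` and `y'` within `2^(-n)`. The
  -- integer coordinates of the ancestors on level `n` then differ by less than two, hence by at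
  -- most one.
  have h2n : (0 : ℝ) < 1 / (2 * 2 ^ n) := by positivity
  have near : ∀ z, z ∉ range (incl lam C₁ C₂) → ∃ y : Word, n ≤ y.length ∧
      |g (incl lam C₁ C₂ y) - g z| < ε / 3 ∧
      ∀ i, |spline n i y 0 - S n i z| < 1 / (2 * 2 ^ n) := by
    intro z hz
    have hO : {q | |g q - g z| < ε / 3} ∩ ⋂ i, {q | |S n i q - S n i z| < 1 / (2 * 2 ^ n)} ∈ 𝓝 z := by
      refine inter_mem ?_ (iInter_mem.2 fun i => ?_)
      · exact (isOpen_lt (by fun_prop) continuous_const).mem_nhds (by simp; positivity)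
      · exact (isOpen_lt (by fun_prop) continuous_const).mem_nhds (by simp)
    obtain ⟨y, hy, hy1, hy2⟩ := exists_incl_mem hz hO n
    refine ⟨y, hy, hy1, fun i => ?_⟩
    have := mem_iInter.1 hy2 i
    simpa [hS] using this
  obtain ⟨y, hy, hy1, hy2⟩ := near z hz
  obtain ⟨y', hy', hy1', hy2'⟩ := near z' hz'
  set v := y.take n with hv
  set v' := y'.take n with hv'
  have hvn : v.length = n := by simp [hv, hy]
  have hvn' : v'.length = n := by simp [hv', hy']
  have ey : y = v ++ y.drop n := (List.take_append_drop n y).symm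
  have ey' : y' = v' ++ y'.drop n := (List.take_append_drop n y').symm
  have hd1 : hd v v' ≤ 1 := by
    rw [hd_le_iff]
    intro i
    have e1 := spline_append_mem_Icc n i hvn (y.drop n)
    have e2 := spline_append_mem_Icc n i hvn' (y'.drop n)
    rw [← ey] at e1
    rw [← ey'] at e2
    have e3 := abs_lt.1 (hy2 i)
    have e4 := abs_lt.1 (hy2' i)
    rw [← h n i] at e4
    have e5 : |2 ^ n * spline n i y 0 - 2 ^ n * spline n i y' 0| < 1 := by
      rw [← mul_sub, abs_mul, abs_of_pos (by positivity), ← lt_div_iff₀' (by positivity), abs_lt]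
      have : (1 : ℝ) / 2 ^ n = 2 * (1 / (2 * 2 ^ n)) := by field_simp
      rw [this]
      constructor <;> linarith [e3.1, e3.2, e4.1, e4.2]
    have e6 := abs_lt.1 e5
    have l1 : (coord i v : ℝ) - coord i v' < 2 := by linarith [e1.1, e2.2, e6.2]
    have l2 : (coord i v' : ℝ) - coord i v < 2 := by linarith [e2.1, e1.2, e6.1]
    have l1' : coord i v - coord i v' < 2 := by exact_mod_cast l1
    have l2' : coord i v' - coord i v < 2 := by exact_mod_cast l2
    omega
  have k1 := hB.abs_sub_append_le hκ0.le hκ1 v (y.drop n)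
  have k2 := hB.abs_sub_append_le hκ0.le hκ1 v' (y'.drop n)
  have k3 := hM v v' (hvn.trans hvn'.symm) hd1
  simp only [← hg] at k1 k2 k3
  rw [← ey, hvn] at k1
  rw [← ey', hvn'] at k2
  rw [hvn] at k3
  have e : (2 * B / (1 - κ) + M) * κ ^ n = B * κ ^ n / (1 - κ) + B * κ ^ n / (1 - κ) + M * κ ^ n := by
    ring
  rw [e] at hn
  have a1 := abs_le.1 k1
  have a2 := abs_le.1 k2
  have a3 := abs_le.1 k3
  have a4 := abs_lt.1 hy1
  have a5 := abs_lt.1 hy1'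
  rw [abs_le]
  constructor <;> linarith [a1.1, a1.2, a2.1, a2.2, a3.1, a3.2, a4.1, a4.2, a5.1, a5.2]

/-- If no function of finite energy distinguishes two boundary points, the splines do not, so
neither do the Martin kernels, and the points have the same coordinates. -/
theorem energyAlgebra_separatesPoints (hlam : 1 / 5 < lam) (hlam' : lam < 1 / 3) (hlam0 : 0 < lam)
    (hC₁ : 0 < C₁) (hC₂ : 0 < C₂) : (energyAlgebra hlam0 hC₁ hC₂).SeparatesPoints := by
  have hvertex : ∀ (x : Word) (z : MartinCompactification lam C₁ C₂), z ≠ incl lam C₁ C₂ x →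
      ∃ u ∈ energyAlgebra hlam0 hC₁ hC₂, u (incl lam C₁ C₂ x) ≠ u z := by
    intro x z hz
    have hE := hasFiniteEnergy_single hlam0 hC₁ hC₂ x
    obtain ⟨u, hu⟩ := hE.exists_extension hlam0 hlam' hC₁ hC₂
    refine ⟨u, by simpa only [mem_energyAlgebra, hu] using hE, ?_⟩
    have h0 : z ∈ {z | u z = 0} := of_forall_incl_ne (x := x)
      (isClosed_eq u.continuous continuous_const) (fun y hy => by simp [hu, hy]) hz
    have h0' : u z = 0 := h0
    rw [h0', hu, if_pos rfl]
    exact one_ne_zero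
  intro z z' hne
  suffices h : ∃ u ∈ energyAlgebra hlam0 hC₁ hC₂, u z ≠ u z' by
    obtain ⟨u, hu, h⟩ := h
    exact ⟨u, ⟨u, hu, rfl⟩, h⟩
  by_cases hz : z ∈ range (incl lam C₁ C₂)
  · obtain ⟨x, rfl⟩ := hz
    exact hvertex x z' hne.symm
  by_cases hz' : z' ∈ range (incl lam C₁ C₂)
  · obtain ⟨x, rfl⟩ := hz'
    obtain ⟨u, hu, h⟩ := hvertex x z hne
    exact ⟨u, hu, h.symm⟩
  by_contra! hall
  have hE := fun n i => hasFiniteEnergy_spline (C₁ := C₁) (C₂ := C₂) hlam hC₁ hC₂ n i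
  choose S hS using fun n i => (hE n i).exists_extension hlam0 hlam' hC₁ hC₂
  apply hne
  refine Subtype.ext (funext fun x => ?_)
  have hbool : ∀ z : MartinCompactification lam C₁ C₂, z ∉ range (incl lam C₁ C₂) →
      (z.1 x).2 = false := by
    intro z hz
    have hc : Continuous (fun z : MartinCompactification lam C₁ C₂ => (z.1 x).2) :=
      continuous_snd.comp ((continuous_apply x).comp continuous_subtype_val)
    exact of_forall_incl_ne (x := x) (s := {z | (z.1 x).2 = false})
      (isClosed_eq hc continuous_const)
      (fun y hy => decide_eq_false hy.symm) fun h => hz ⟨x, h.symm⟩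
  obtain ⟨g, hg, hg'⟩ := exists_kernelExtension (C₁ := C₁) (C₂ := C₂) hlam0 hlam' hC₁ hC₂ x
  refine Prod.ext ?_ ((hbool z hz).trans (hbool z' hz').symm)
  rw [← hg' z, ← hg' z', kernel_eq_of_spline_eq hlam0 hlam' hC₁ hC₂ hz hz' S hS
    (fun n i => hall (S n i) (by simpa only [mem_energyAlgebra, hS] using hE n i)) x hg]

theorem dense_energyAlgebra (hlam : 1 / 5 < lam) (hlam' : lam < 1 / 3) (hlam0 : 0 < lam)
    (hC₁ : 0 < C₁) (hC₂ : 0 < C₂) :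
    Dense (energyAlgebra hlam0 hC₁ hC₂ : Set C(MartinCompactification lam C₁ C₂, ℝ)) := by
  have h := ContinuousMap.subalgebra_topologicalClosure_eq_top_of_separatesPoints _
    (energyAlgebra_separatesPoints hlam hlam' hlam0 hC₁ hC₂)
  rw [dense_iff_closure_eq, ← Subalgebra.topologicalClosure_coe, h]
  rfl

/-! ### The measure -/

instance : BorelSpace (MartinCompactification lam C₁ C₂) := ⟨rfl⟩

instance : TopologicalSpace.MetrizableSpace (MartinCompactification lam C₁ C₂) :=
  inferInstanceAs (TopologicalSpace.MetrizableSpace (closure (range (martinCoord lam C₁ C₂))))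

instance : TopologicalSpace.SeparableSpace (MartinCompactification lam C₁ C₂) :=
  ⟨range (incl lam C₁ C₂), countable_range _, denseRange_incl⟩

/-- The vertices are atoms and carry all the mass, so values of L² classes at vertices are well
defined and almost everywhere means at every vertex. -/
theorem ae_vertexMeasure_iff (hlam : 0 < lam) (hc : 0 < c)
    {p : MartinCompactification lam C₁ C₂ → Prop} :
    (∀ᵐ z ∂vertexMeasure lam C₁ C₂ c, p z) ↔ ∀ x, p (incl lam C₁ C₂ x) := by
  have h0 : ∀ x : Word, ENNReal.ofReal ((c / (3 * lam)) ^ x.length) ≠ 0 := fun x => by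
    rw [ne_eq, ENNReal.ofReal_eq_zero, not_le]; positivity
  simp only [vertexMeasure, Measure.ae_sum_eq, eventually_iSup,
    Measure.ae_ennreal_smul_measure_eq (h0 _), ae_dirac_eq, eventually_pure]

theorem sum_lvl_pow (r : ℝ) (m : ℕ) : ∑ w ∈ lvl m, r ^ w.length = (3 * r) ^ m := by
  induction m with
  | zero =>
    have : lvl 0 = {[]} := by ext w; simp [List.length_eq_zero_iff]
    simp [this]
  | succ m ih =>
    rw [sum_lvl_succ, pow_succ, ← ih, Finset.sum_mul]
    refine Finset.sum_congr rfl fun t _ => ?_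
    simp [pow_succ]; ring

/-- Level `n` has `3^n` vertices and total mass `(c/λ)^n`, which is summable as `c < λ`. -/
theorem isFiniteMeasure_vertexMeasure (hlam : 0 < lam) (hc : 0 < c) (hc' : c < lam) :
    IsFiniteMeasure (vertexMeasure lam C₁ C₂ c) := by
  constructor
  have hS : Summable fun x : Word => (c / (3 * lam)) ^ x.length := by
    refine summable_of_lvl (fun w => by positivity)
      (summable_geometric_of_lt_one (r := 3 * (c / (3 * lam))) (by positivity) ?_)
      fun n => (sum_lvl_pow _ n).le
    have e : 3 * (c / (3 * lam)) = c / lam := by field_simp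
    rwa [e, div_lt_one hlam]
  simp only [vertexMeasure, Measure.sum_apply _ MeasurableSet.univ, Measure.smul_apply,
    measure_univ, smul_eq_mul, mul_one]
  rw [← ENNReal.ofReal_tsum_of_nonneg (fun x => by positivity) hS]
  exact ENNReal.ofReal_lt_top

theorem vertexMeasure_singleton_ne_zero (hlam : 0 < lam) (hc : 0 < c) (x : Word) :
    vertexMeasure lam C₁ C₂ c {incl lam C₁ C₂ x} ≠ 0 := by
  intro h
  have : ∀ᵐ z ∂vertexMeasure lam C₁ C₂ c, z ≠ incl lam C₁ C₂ x := by
    rw [ae_iff]; simpa using h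
  exact (ae_vertexMeasure_iff hlam hc).1 this x rfl

theorem isOpenPosMeasure_vertexMeasure (hlam : 0 < lam) (hc : 0 < c) :
    (vertexMeasure lam C₁ C₂ c).IsOpenPosMeasure := by
  refine ⟨fun U hU hne h => ?_⟩
  obtain ⟨x, hx⟩ := denseRange_incl.exists_mem_open hU hne
  exact vertexMeasure_singleton_ne_zero hlam hc x (measure_mono_null (singleton_subset_iff.2 hx) h)

/-! ### The form domain -/

theorem Lp_add_incl (hlam : 0 < lam) (hc : 0 < c) (f g : Lp ℝ 2 (vertexMeasure lam C₁ C₂ c)) (x : Word) :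
    (f + g : Lp ℝ 2 (vertexMeasure lam C₁ C₂ c)) (incl lam C₁ C₂ x) =
      f (incl lam C₁ C₂ x) + g (incl lam C₁ C₂ x) :=
  (ae_vertexMeasure_iff hlam hc).1 (Lp.coeFn_add f g) x

theorem Lp_sub_incl (hlam : 0 < lam) (hc : 0 < c) (f g : Lp ℝ 2 (vertexMeasure lam C₁ C₂ c)) (x : Word) :
    (f - g : Lp ℝ 2 (vertexMeasure lam C₁ C₂ c)) (incl lam C₁ C₂ x) =
      f (incl lam C₁ C₂ x) - g (incl lam C₁ C₂ x) :=
  (ae_vertexMeasure_iff hlam hc).1 (Lp.coeFn_sub f g) x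

theorem Lp_smul_incl (hlam : 0 < lam) (hc : 0 < c) (a : ℝ)
    (f : Lp ℝ 2 (vertexMeasure lam C₁ C₂ c)) (x : Word) :
    (a • f : Lp ℝ 2 (vertexMeasure lam C₁ C₂ c)) (incl lam C₁ C₂ x) = a * f (incl lam C₁ C₂ x) :=
  (ae_vertexMeasure_iff hlam hc).1 (Lp.coeFn_smul a f) x

theorem Lp_zero_incl (hlam : 0 < lam) (hc : 0 < c) (x : Word) :
    (0 : Lp ℝ 2 (vertexMeasure lam C₁ C₂ c)) (incl lam C₁ C₂ x) = 0 :=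
  (ae_vertexMeasure_iff hlam hc).1 (Lp.coeFn_zero ℝ 2 (vertexMeasure lam C₁ C₂ c)) x

/-- Continuity is no restriction, because functions of finite energy extend. -/
theorem mem_formDomain_iff (hlam : 0 < lam) (hc : 0 < c) (hlam' : lam < 1 / 3) (hC₁ : 0 < C₁)
    (hC₂ : 0 < C₂) (f : Lp ℝ 2 (vertexMeasure lam C₁ C₂ c)) :
    f ∈ formDomain lam C₁ C₂ c ↔ HasFiniteEnergy lam C₁ C₂ fun x => f (incl lam C₁ C₂ x) := by
  constructor
  · rintro ⟨u, hu, hfu⟩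
    have h := (ae_vertexMeasure_iff hlam hc).1 hfu
    simpa only [h] using hu
  · intro h
    obtain ⟨u, hu⟩ := h.exists_extension hlam hlam' hC₁ hC₂
    exact ⟨u, by simpa only [hu] using h,
      (ae_vertexMeasure_iff hlam hc).2 fun x => (hu x).symm⟩

theorem energyForm_self (f : Lp ℝ 2 (vertexMeasure lam C₁ C₂ c)) :
    energyForm lam C₁ C₂ c f f = 1 / 2 * ∑' p : Word × Word, conductance lam C₁ C₂ p.1 p.2 *
      (f (incl lam C₁ C₂ p.1) - f (incl lam C₁ C₂ p.2)) ^ 2 := by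
  unfold energyForm
  congr 1
  exact tsum_congr fun p => by ring

theorem energyForm_self_nonneg (hlam : 0 < lam) (hC₁ : 0 < C₁) (hC₂ : 0 < C₂)
    (f : Lp ℝ 2 (vertexMeasure lam C₁ C₂ c)) : 0 ≤ energyForm lam C₁ C₂ c f f := by
  rw [energyForm_self]
  exact mul_nonneg (by norm_num) (tsum_nonneg fun p =>
    mul_nonneg (conductance_nonneg hlam hC₁ hC₂ _ _) (sq_nonneg _))

/-- Convergence in `L²` implies convergence at the vertices. -/
theorem tendsto_incl_of_tendsto_Lp (hlam : 0 < lam) (hc : 0 < c)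
    {f : ℕ → Lp ℝ 2 (vertexMeasure lam C₁ C₂ c)} {g : Lp ℝ 2 (vertexMeasure lam C₁ C₂ c)}
    (h : Tendsto f atTop (𝓝 g)) (x : Word) :
    Tendsto (fun n => f n (incl lam C₁ C₂ x)) atTop (𝓝 (g (incl lam C₁ C₂ x))) := by
  have hm := tendstoInMeasure_of_tendsto_Lp h
  rw [EMetric.tendsto_atTop]
  intro ε hε
  -- Once the measure of the set where `f n` and `g` are `ε` apart drops below the mass of the atom
  -- at `x`, that set cannot contain `x`.
  have h1 := hm ε hε
  have h2 := h1.eventually (gt_mem_nhds (pos_iff_ne_zero.2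
    (vertexMeasure_singleton_ne_zero (C₁ := C₁) (C₂ := C₂) hlam hc x)))
  obtain ⟨N, hN⟩ := eventually_atTop.1 h2
  refine ⟨N, fun n hn => ?_⟩
  by_contra! hle
  exact absurd (hN n hn) (not_lt.2 (measure_mono (singleton_subset_iff.2 hle)))

/-- The L² limit is a limit at every vertex, so finite partial sums of the energy of `f k - f l`
pass to the limit in `l`. This is Fatou's lemma, and `mem_formDomain_iff` puts the limit back into
the domain. -/
theorem exists_energyOne_limit (hlam : 0 < lam) (hlam' : lam < 1 / 3) (hC₁ : 0 < C₁) (hC₂ : 0 < C₂)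
    (hc : 0 < c) {f : ℕ → Lp ℝ 2 (vertexMeasure lam C₁ C₂ c)}
    (hf : ∀ n, f n ∈ formDomain lam C₁ C₂ c)
    (hC : ∀ ε > 0, ∃ N, ∀ k ≥ N, ∀ l ≥ N,
      DirichletForms.energyOne (energyForm lam C₁ C₂ c) (f k - f l) < ε) :
    ∃ g ∈ formDomain lam C₁ C₂ c, Tendsto
      (fun n => DirichletForms.energyOne (energyForm lam C₁ C₂ c) (f n - g)) atTop (𝓝 0) := by
  have hmem := mem_formDomain_iff (C₁ := C₁) (C₂ := C₂) hlam hc hlam' hC₁ hC₂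
  have hcn := conductance_nonneg (lam := lam) (C₁ := C₁) (C₂ := C₂) hlam hC₁ hC₂
  have hE0 := energyForm_self_nonneg (lam := lam) (C₁ := C₁) (C₂ := C₂) (c := c) hlam hC₁ hC₂
  have hsub : ∀ a b : Lp ℝ 2 (vertexMeasure lam C₁ C₂ c), a ∈ formDomain lam C₁ C₂ c →
      b ∈ formDomain lam C₁ C₂ c → a - b ∈ formDomain lam C₁ C₂ c := fun a b ha hb => by
    rw [hmem] at *
    simpa only [Lp_sub_incl hlam hc] using ha.sub hlam hC₁ hC₂ hb
  have hcauchy : CauchySeq f := by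
    rw [Metric.cauchySeq_iff]
    intro ε hε
    obtain ⟨N, hN⟩ := hC (ε ^ 2) (by positivity)
    refine ⟨N, fun k hk l hl => ?_⟩
    have h := hN k hk l hl
    rw [dist_eq_norm]
    refine lt_of_pow_lt_pow_left₀ 2 hε.le (lt_of_le_of_lt ?_ h)
    exact le_add_of_nonneg_left (hE0 _)
  obtain ⟨g, hg⟩ := cauchySeq_tendsto_of_complete hcauchy
  have hpt := tendsto_incl_of_tendsto_Lp hlam hc hg
  have hfatou : ∀ ε > 0, ∃ N, ∀ k ≥ N, (f k - g) ∈ formDomain lam C₁ C₂ c ∧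
      energyForm lam C₁ C₂ c (f k - g) (f k - g) ≤ ε := by
    intro ε hε
    obtain ⟨N, hN⟩ := hC ε hε
    refine ⟨N, fun k hk => ?_⟩
    have hfin : ∀ s : Finset (Word × Word), ∑ p ∈ s, conductance lam C₁ C₂ p.1 p.2 *
        ((f k - g : Lp ℝ 2 (vertexMeasure lam C₁ C₂ c)) (incl lam C₁ C₂ p.1) -
          (f k - g : Lp ℝ 2 (vertexMeasure lam C₁ C₂ c)) (incl lam C₁ C₂ p.2)) ^ 2 ≤ 2 * ε := by
      intro s
      have hlim : Tendsto (fun l => ∑ p ∈ s, conductance lam C₁ C₂ p.1 p.2 *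
          ((f k - f l : Lp ℝ 2 (vertexMeasure lam C₁ C₂ c)) (incl lam C₁ C₂ p.1) -
            (f k - f l : Lp ℝ 2 (vertexMeasure lam C₁ C₂ c)) (incl lam C₁ C₂ p.2)) ^ 2) atTop
          (𝓝 (∑ p ∈ s, conductance lam C₁ C₂ p.1 p.2 *
            ((f k - g : Lp ℝ 2 (vertexMeasure lam C₁ C₂ c)) (incl lam C₁ C₂ p.1) -
              (f k - g : Lp ℝ 2 (vertexMeasure lam C₁ C₂ c)) (incl lam C₁ C₂ p.2)) ^ 2)) := by
        simp only [Lp_sub_incl hlam hc]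
        exact tendsto_finsetSum _ fun p _ => ((((hpt p.1).const_sub _).sub
          ((hpt p.2).const_sub _)).pow 2).const_mul _
      refine le_of_tendsto hlim (eventually_atTop.2 ⟨N, fun l hl => ?_⟩)
      have h1 : energyForm lam C₁ C₂ c (f k - f l) (f k - f l) ≤ ε := by
        have h2 := hN k hk l hl
        have : 0 ≤ ‖f k - f l‖ ^ 2 := by positivity
        unfold DirichletForms.energyOne at h2
        linarith
      rw [energyForm_self] at h1
      have h3 : HasFiniteEnergy lam C₁ C₂ fun x =>
          (f k - f l : Lp ℝ 2 (vertexMeasure lam C₁ C₂ c)) (incl lam C₁ C₂ x) :=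
        (hmem _).1 (hsub _ _ (hf k) (hf l))
      have h4 := Summable.sum_le_tsum s (fun p _ => mul_nonneg (hcn _ _) (sq_nonneg _)) h3
      simp only at h4
      linarith
    have hs := summable_of_sum_le (fun p => mul_nonneg (hcn _ _) (sq_nonneg _)) hfin
    refine ⟨(hmem _).2 hs, ?_⟩
    have := hs.tsum_le_of_sum_le hfin
    rw [energyForm_self]
    linarith
  have hgmem : g ∈ formDomain lam C₁ C₂ c := by
    obtain ⟨N, hN⟩ := hfatou 1 one_pos
    have := hsub _ _ (hf N) (hN N le_rfl).1
    rwa [sub_sub_cancel] at this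
  refine ⟨g, hgmem, ?_⟩
  have hA : Tendsto (fun n => energyForm lam C₁ C₂ c (f n - g) (f n - g)) atTop (𝓝 0) := by
    rw [Metric.tendsto_atTop]
    intro ε hε
    obtain ⟨N, hN⟩ := hfatou (ε / 2) (by positivity)
    refine ⟨N, fun n hn => ?_⟩
    rw [Real.dist_eq, sub_zero, abs_of_nonneg (hE0 _)]
    linarith [(hN n hn).2]
  have hB : Tendsto (fun n => ‖f n - g‖ ^ 2) atTop (𝓝 0) := by
    have := (tendsto_iff_norm_sub_tendsto_zero.1 hg).pow 2
    simpa using this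
  simpa [DirichletForms.energyOne] using hA.add hB

/-! ### The unit contraction and the regular Dirichlet form -/

theorem sq_clamp_sub_le (a b : ℝ) :
    (max 0 (min a 1) - max 0 (min b 1)) ^ 2 ≤ (a - b) ^ 2 := by
  rcases le_total a b with h | h
  · have h1 : max 0 (min a 1) ≤ max 0 (min b 1) := max_le_max le_rfl (min_le_min h le_rfl)
    have h2 : max 0 (min b 1) - max 0 (min a 1) ≤ b - a := by
      simp only [max_def, min_def]; split_ifs <;> linarith
    nlinarith
  · have h1 : max 0 (min b 1) ≤ max 0 (min a 1) := max_le_max le_rfl (min_le_min h le_rfl)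
    have h2 : max 0 (min a 1) - max 0 (min b 1) ≤ a - b := by
      simp only [max_def, min_def]; split_ifs <;> linarith
    nlinarith

theorem isRegularDirichletForm (hlam : 1 / 5 < lam) (hlam' : lam < 1 / 3)
    (hC₁ : 0 < C₁) (hC₂ : 0 < C₂) (hc : 0 < c) (hc' : c < lam) :
    DirichletForms.IsRegularDirichletForm (vertexMeasure lam C₁ C₂ c)
      (formDomain lam C₁ C₂ c) (energyForm lam C₁ C₂ c) := by
  have hlam0 : 0 < lam := by linarith
  have hfinite := isFiniteMeasure_vertexMeasure (C₁ := C₁) (C₂ := C₂) hlam0 hc hc'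
  have hopen := isOpenPosMeasure_vertexMeasure (C₁ := C₁) (C₂ := C₂) hlam0 hc
  have hmem := mem_formDomain_iff (C₁ := C₁) (C₂ := C₂) hlam0 hc hlam' hC₁ hC₂
  have hcn := conductance_nonneg (lam := lam) (C₁ := C₁) (C₂ := C₂) hlam0 hC₁ hC₂
  have hdense := dense_energyAlgebra hlam hlam' hlam0 hC₁ hC₂
  have htoLp : ∀ u : C(MartinCompactification lam C₁ C₂, ℝ),
      ContinuousMap.toLp (E := ℝ) 2 (vertexMeasure lam C₁ C₂ c) ℝ u =ᵐ[vertexMeasure lam C₁ C₂ c] u :=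
    fun u => ContinuousMap.coeFn_toLp _ u
  have hD : ∀ u ∈ energyAlgebra hlam0 hC₁ hC₂,
      ContinuousMap.toLp (E := ℝ) 2 (vertexMeasure lam C₁ C₂ c) ℝ u ∈ formDomain lam C₁ C₂ c :=
    fun u hu => ⟨u, hu, htoLp u⟩
  refine
    { zero_mem := ?_
      add_mem := ?_
      smul_mem := ?_
      dense := ?_
      symm := ?_
      add_left := ?_
      smul_left := ?_
      nonneg := fun f _ => energyForm_self_nonneg hlam0 hC₁ hC₂ f
      closed := fun f hf hC => exists_energyOne_limit hlam0 hlam' hC₁ hC₂ hc hf hC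
      markov := ?_
      borel := inferInstance
      locallyCompact := inferInstance
      separable := inferInstance
      metrizable := inferInstance
      finiteOnCompacts := inferInstance
      fullSupport := hopen
      dense_energy := ?_
      dense_uniform := ?_ }
  · rw [hmem]
    simpa only [Lp_zero_incl hlam0 hc] using hasFiniteEnergy_const 0
  · intro f hf g hg
    rw [hmem] at *
    simpa only [Lp_add_incl hlam0 hc] using hf.add hlam0 hC₁ hC₂ hg
  · intro a f hf
    rw [hmem] at *
    simpa only [Lp_smul_incl hlam0 hc] using hf.const_mul a
  -- Uniform density passes to L², as continuous functions are dense there and the embedding is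
  -- continuous.
  · refine (((ContinuousMap.toLp_denseRange (p := 2) ℝ (vertexMeasure lam C₁ C₂ c) ℝ
      ENNReal.ofNat_ne_top).dense_image
        (ContinuousLinearMap.continuous _) hdense)).mono ?_
    rintro _ ⟨u, hu, rfl⟩
    exact hD u hu
  · intro f _ g _
    unfold energyForm
    congr 1
    exact tsum_congr fun p => by ring
  · intro f hf g hg h hh
    rw [hmem] at *
    unfold energyForm
    rw [← mul_add, ← (hf.summable_mul hlam0 hC₁ hC₂ hh).tsum_add (hg.summable_mul hlam0 hC₁ hC₂ hh)]
    congr 1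
    exact tsum_congr fun p => by simp only [Lp_add_incl hlam0 hc]; ring
  · intro a f _ g _
    unfold energyForm
    rw [mul_left_comm a, ← tsum_mul_left (a := a)]
    congr 1
    exact tsum_congr fun p => by simp only [Lp_smul_incl hlam0 hc]; ring
  · intro f hf
    have hf' := (hmem f).1 hf
    have hv : HasFiniteEnergy lam C₁ C₂ fun x => max 0 (min (f (incl lam C₁ C₂ x)) 1) :=
      hf'.of_sq_le hlam0 hC₁ hC₂ fun x y => sq_clamp_sub_le _ _
    obtain ⟨v, hvx⟩ := hv.exists_extension hlam0 hlam' hC₁ hC₂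
    have hval := (ae_vertexMeasure_iff hlam0 hc).1 (htoLp v)
    refine ⟨_, hD v (by simpa only [mem_energyAlgebra, hvx] using hv),
      (ae_vertexMeasure_iff hlam0 hc).2 fun x => (hval x).trans (hvx x), ?_⟩
    rw [energyForm_self, energyForm_self]
    simp only [hval, hvx]
    refine mul_le_mul_of_nonneg_left ?_ (by norm_num)
    exact hv.tsum_le_tsum (fun p => mul_le_mul_of_nonneg_left (sq_clamp_sub_le _ _) (hcn _ _)) hf'
  · intro f hf ε hε
    obtain ⟨u, hu, hfu⟩ := hf
    -- On a compact space the continuous representative of `f` already has compact support, so `f`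
    -- approximates itself.
    refine ⟨f, ⟨u, hu, hfu⟩, ⟨u, HasCompactSupport.of_compactSpace _, hfu⟩, ?_⟩
    have : DirichletForms.energyOne (energyForm lam C₁ C₂ c) (f - f) = 0 := by
      rw [sub_self, DirichletForms.energyOne, energyForm_self]
      simp only [Lp_zero_incl hlam0 hc]
      simp
    rw [this]
    exact hε
  · intro u _ ε hε
    obtain ⟨v, hv, huv⟩ := Metric.dense_iff.1 hdense u ε hε
    rw [Metric.mem_ball, dist_comm] at hv
    refine ⟨v, HasCompactSupport.of_compactSpace _, ⟨_, hD v huv, htoLp v⟩, fun x => ?_⟩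
    rw [← Real.dist_eq]
    exact (ContinuousMap.dist_apply_le_dist x).trans_lt hv

end Sierpinski

end

theorem mainTheorem3 (lam C₁ C₂ c : ℝ) (hlam : 1 / 5 < lam) (hlam' : lam < 1 / 3)
    (hC₁ : 0 < C₁) (hC₂ : 0 < C₂) (hc : 0 < c) (hc' : c < lam) :
    DirichletForms.IsRegularDirichletForm (Sierpinski.vertexMeasure lam C₁ C₂ c)
      (Sierpinski.formDomain lam C₁ C₂ c) (Sierpinski.energyForm lam C₁ C₂ c) :=
  Sierpinski.isRegularDirichletForm hlam hlam' hC₁ hC₂ hc hc'
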